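/- **Conventions.** A decision problem is a language $L\subseteq\{0,1\}^*$. For $f:\mathbb N\to\mathbb N$ and $g:\mathbb N\to\mathbb R$, $\mathrm{NDTIME}(f(n),g(n))$ is the class of decision problems solvable in $O(g(n))$ time by a multi-tape Turing machine using an $f(n)$-bit nondeterministic oracle: $L$ is in the class if there are a deterministic multi-tape Turing machine $M$ and a function $T(n)=O(g(n))$ such that, for every input $x\in\{0,1\}^n$, $M$ started with $x$ on its input tape and any $w\in\{0,1\}^{f(n)}$ on its oracle tape halts within $T(n)$ steps, and $x\in L$ if and only if $M$ accepts for some $w\in\{0,1\}^{f(n)}$. Further, $\mathrm{DTIME}(g(n))=\mathrm{NDTIME}(0,g(n))$. Let $K$ be a field and let $\omega$ be the exponent of matrix multiplication over $K$, that is, the infimum of all real $\tau$ such that two $n\times n$ matrices over $K$ can be multiplied with $O(n^{\tau})$ arithmetic operations (additions, subtractions, multiplications and divisions, with constants from $K$). The (unweighted) triangle detection problem is: given an undirected graph on $N$ vertices (by $N$ and its adjacency matrix), decide whether it contains a triangle. Algorithms for it are random access machine (RAM) programs, with running time measured by the logarithmic cost. **Theorem.** Suppose that for every real $\delta<\omega$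 triangle detection in graphs on $N$ vertices has no $O(N^{\delta+o(1)})$-time algorithm. Then for every positive real $\delta'<\omega$, $$\mathrm{NDTIME}\bigl(\lceil \tfrac12\log_2 n\rceil,\,n\bigr)\not\subseteq \mathrm{DTIME}\bigl(n^{\delta'/2}\bigr).$$ -/

import Mathlib

open Filter Topology Asymptotics

/-! ## Multi-tape Turing machines and the classes NDTIME, DTIME -/

/-- A head movement. -/
inductive Move where
  | left
  | stay
  | right

/-- The displacement of a head movement. -/
def Move.shift : Move → ℤ
  | .left => -1
  | .stay => 0
  | .right => 1

/-- A deterministic Turing machine with `k + 2` two-way infinite read-write tapes: tape `0` holds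
the input, tape `1` the bits supplied by the nondeterministic oracle, the other `k` are work tapes.
`sym none` is the blank symbol, `sym (some b)` the tape symbol of the bit `b`.
In state `q`, scanning the symbols `a`, the machine halts if `tr q a = none`; otherwise
`tr q a = some (q', a', m)` gives the new state, the symbols to write and the head movements.
It accepts if it halts in a state with `acc q = true`. -/
structure MultiTapeTM where
  k : ℕ
  Q : Type
  Γ : Type
  finQ : Finite Q
  finΓ : Finite Γ
  sym : Option Bool ↪ Γ
  start : Q
  acc : Q → Bool
  tr : Q → (Fin (k + 2) → Γ) → Option (Q × (Fin (k + 2) → Γ) × (Fin (k + 2) → Move))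

namespace MultiTapeTM

/-- A configuration: state, tape contents, head positions. -/
structure Cfg (M : MultiTapeTM) where
  state : M.Q
  tape : Fin (M.k + 2) → ℤ → M.Γ
  head : Fin (M.k + 2) → ℤ

variable (M : MultiTapeTM)

/-- The tape that holds the word `x` in the cells `0, …, |x| - 1` and is blank elsewhere. -/
def wordTape (x : List Bool) : ℤ → M.Γ :=
  fun p => M.sym (if 0 ≤ p then x[p.toNat]? else none)

/-- The initial configuration on input `x` with oracle bits `w`. -/
def init (x w : List Bool) : M.Cfg where
  state := M.start
  tape := fun i => M.wordTape (if i = 0 then x else if i = 1 then w else [])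
  head := fun _ => 0

/-- What the machine does next in the configuration `c`. -/
def next (c : M.Cfg) : Option (M.Q × (Fin (M.k + 2) → M.Γ) × (Fin (M.k + 2) → Move)) :=
  M.tr c.state (fun i => c.tape i (c.head i))

/-- The machine has halted. -/
def Halted (c : M.Cfg) : Prop := M.next c = none

/-- One step of the machine (a halted configuration is left unchanged). -/
def step (c : M.Cfg) : M.Cfg :=
  match M.next c with
  | none => c
  | some (q, a, m) =>
    { state := q
      tape := fun i => Function.update (c.tape i) (c.head i) (a i)
      head := fun i => c.head i + (m i).shift }

/-- The machine halts after at most `t` steps. -/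
def HaltsWithin (x w : List Bool) (t : ℕ) : Prop :=
  M.Halted (M.step^[t] (M.init x w))

/-- The machine halts in an accepting state. -/
def Accepts (x w : List Bool) : Prop :=
  ∃ t : ℕ, M.Halted (M.step^[t] (M.init x w)) ∧ M.acc (M.step^[t] (M.init x w)).state = true

end MultiTapeTM

/-- `NDTIME f g`: the decision problems `L ⊆ {0,1}*` solvable in `O(g(n))` time by a multi-tape
Turing machine using an `f(n)`-bit nondeterministic oracle. On inputs of length `n` the machine halts
within `T n = O(g n)` steps whatever the `f n` oracle bits are, and it accepts for some choice of the
oracle bits if and only if the input is in `L`. -/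
def NDTIME (f : ℕ → ℕ) (g : ℕ → ℝ) : Set (Set (List Bool)) :=
  {L | ∃ (M : MultiTapeTM) (T : ℕ → ℕ),
    (fun n => (T n : ℝ)) =O[atTop] g ∧
    (∀ x w : List Bool, w.length = f x.length → M.HaltsWithin x w (T x.length)) ∧
    (∀ x : List Bool, x ∈ L ↔ ∃ w : List Bool, w.length = f x.length ∧ M.Accepts x w)}

/-- Deterministic time: no oracle bits. -/
def DTIME (g : ℕ → ℝ) : Set (Set (List Bool)) := NDTIME (fun _ => 0) g

/-! ## Random access machines under the logarithmic cost -/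

namespace RAM

/-- Operands: the number `i` itself, the content of register `i`, or the content of the register
whose index is the content of register `i`. -/
inductive Operand where
  | lit (i : ℤ)
  | reg (i : ℕ)
  | ind (i : ℕ)

/-- Target addresses: register `i`, or the register whose index is the content of register `i`. -/
inductive Addr where
  | reg (i : ℕ)
  | ind (i : ℕ)

/-- Instructions of an accumulator machine (the accumulator is register `0`) over the labels `Λ`.
The label argument is the label of the instruction that is executed next; the conditional jumps
have two of them, the first for the case that the condition holds. `halt b` stops the machine with
the answer `b`. -/
inductive Instr (Λ : Type) where
  | load (a : Operand) (l : Λ)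
  | store (a : Addr) (l : Λ)
  | add (a : Operand) (l : Λ)
  | sub (a : Operand) (l : Λ)
  | mult (a : Operand) (l : Λ)
  | div (a : Operand) (l : Λ)
  | read (a : Addr) (l : Λ)
  | jgtz (l l' : Λ)
  | jzero (l l' : Λ)
  | halt (b : Bool)

/-- A RAM program: finitely many labelled instructions and the label at which to start. -/
structure Program where
  Λ : Type
  finΛ : Finite Λ
  start : Λ
  code : Λ → Instr Λ

/-- A configuration: the label of the current instruction, the contents of the registers,
and the part of the input (a list of integers) that has not been read yet. -/
structure Cfg (P : Program) where
  pc : P.Λ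
  mem : ℕ → ℤ
  input : List ℤ

/-- Logarithmic size of an integer: `⌊log₂ |i|⌋ + 1` for `i ≠ 0`, and `1` for `i = 0`. -/
def size (i : ℤ) : ℕ := Nat.log 2 i.natAbs + 1

/-- The value of an operand (a negative index counts as index `0`). -/
def Operand.val (m : ℕ → ℤ) : Operand → ℤ
  | .lit i => i
  | .reg i => m i
  | .ind i => m (m i).toNat

/-- The logarithmic cost of an operand. -/
def Operand.cost (m : ℕ → ℤ) : Operand → ℕ
  | .lit i => size i
  | .reg i => size i + size (m i)
  | .ind i => size i + size (m i) + size (m (m i).toNat)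

/-- The register a target address refers to (a negative index counts as index `0`). -/
def Addr.target (m : ℕ → ℤ) : Addr → ℕ
  | .reg i => i
  | .ind i => (m i).toNat

/-- The logarithmic cost of a target address. -/
def Addr.cost (m : ℕ → ℤ) : Addr → ℕ
  | .reg i => size i
  | .ind i => size i + size (m i)

variable (P : Program)

/-- The initial configuration: all registers hold `0`, the input is unread. -/
def init (inp : List ℤ) : Cfg P := ⟨P.start, fun _ => 0, inp⟩

/-- One step (a halted configuration is left unchanged; division rounds down; reading past the end
of the input yields `0`). -/
def step (c : Cfg P) : Cfg P :=
  match P.code c.pc with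
  | .load a l => ⟨l, Function.update c.mem 0 (a.val c.mem), c.input⟩
  | .store a l => ⟨l, Function.update c.mem (a.target c.mem) (c.mem 0), c.input⟩
  | .add a l => ⟨l, Function.update c.mem 0 (c.mem 0 + a.val c.mem), c.input⟩
  | .sub a l => ⟨l, Function.update c.mem 0 (c.mem 0 - a.val c.mem), c.input⟩
  | .mult a l => ⟨l, Function.update c.mem 0 (c.mem 0 * a.val c.mem), c.input⟩
  | .div a l => ⟨l, Function.update c.mem 0 ((c.mem 0).fdiv (a.val c.mem)), c.input⟩
  | .read a l => ⟨l, Function.update c.mem (a.target c.mem) (c.input.headD 0), c.input.tail⟩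
  | .jgtz l l' => ⟨if 0 < c.mem 0 then l else l', c.mem, c.input⟩
  | .jzero l l' => ⟨if c.mem 0 = 0 then l else l', c.mem, c.input⟩
  | .halt _ => c

/-- The logarithmic cost of the instruction executed in the configuration `c`. -/
def stepCost (c : Cfg P) : ℕ :=
  match P.code c.pc with
  | .load a _ => a.cost c.mem
  | .store a _ => size (c.mem 0) + a.cost c.mem
  | .add a _ => size (c.mem 0) + a.cost c.mem
  | .sub a _ => size (c.mem 0) + a.cost c.mem
  | .mult a _ => size (c.mem 0) + a.cost c.mem
  | .div a _ => size (c.mem 0) + a.cost c.mem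
  | .read a _ => size (c.input.headD 0) + a.cost c.mem
  | .jgtz _ _ => size (c.mem 0)
  | .jzero _ _ => size (c.mem 0)
  | .halt _ => 1

/-- On the input `inp` the program halts with the answer `b`, and the logarithmic cost of the whole
computation is at most `T`. -/
def AnswersWithin (inp : List ℤ) (b : Bool) (T : ℕ) : Prop :=
  ∃ t : ℕ, P.code ((step P)^[t] (init P inp)).pc = .halt b ∧
    ∑ s ∈ Finset.range (t + 1), stepCost P ((step P)^[s] (init P inp)) ≤ T

end RAM

/-! ## Triangle detection -/

open Classical in
/-- A graph as input of a RAM: the number `N` of vertices, followed by the `N²` entries of the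
adjacency matrix, row by row. -/
noncomputable def graphInput {N : ℕ} (G : SimpleGraph (Fin N)) : List ℤ :=
  (N : ℤ) :: (List.finRange N).flatMap fun i =>
    (List.finRange N).map fun j => if G.Adj i j then 1 else 0

open Classical in
/-- There is an algorithm (a RAM program under the logarithmic cost) that decides in time
`O(N^(δ + o(1)))` whether a graph on `N` vertices has a triangle. -/
def TriangleDetectionInTime (δ : ℝ) : Prop :=
  ∃ (P : RAM.Program) (T : ℕ → ℕ) (e : ℕ → ℝ),
    Tendsto e atTop (𝓝 0) ∧
    (fun N => (T N : ℝ)) =O[atTop] (fun N => (N : ℝ) ^ (δ + e N)) ∧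
    ∀ (N : ℕ) (G : SimpleGraph (Fin N)),
      RAM.AnswersWithin P (graphInput G) (decide (∃ a b c, G.Adj a b ∧ G.Adj b c ∧ G.Adj a c)) (T N)

/-! ## The exponent of matrix multiplication -/

/-- `ArithReach K I s S`: starting from the elements of `I` and the constants of `K`, some sequence
of `s` arithmetic operations (additions, subtractions, multiplications, divisions) in the field `F`
yields the set `S` of available elements. -/
inductive ArithReach (K : Type*) {F : Type*} [Field K] [Field F] [Algebra K F] (I : Set F) :
    ℕ → Set F → Prop
  | start : ArithReach K I 0 (I ∪ Set.range (algebraMap K F))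
  | add {s : ℕ} {S : Set F} {a b : F} (h : ArithReach K I s S) (ha : a ∈ S) (hb : b ∈ S) :
      ArithReach K I (s + 1) (insert (a + b) S)
  | sub {s : ℕ} {S : Set F} {a b : F} (h : ArithReach K I s S) (ha : a ∈ S) (hb : b ∈ S) :
      ArithReach K I (s + 1) (insert (a - b) S)
  | mul {s : ℕ} {S : Set F} {a b : F} (h : ArithReach K I s S) (ha : a ∈ S) (hb : b ∈ S) :
      ArithReach K I (s + 1) (insert (a * b) S)
  | div {s : ℕ} {S : Set F} {a b : F} (h : ArithReach K I s S) (ha : a ∈ S) (hb : b ∈ S)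
      (hb0 : b ≠ 0) : ArithReach K I (s + 1) (insert (a / b) S)

/-- The field of rational functions over `K` in the entries of two generic `n × n` matrices. -/
abbrev MatEntriesField (K : Type*) [Field K] (n : ℕ) : Type _ :=
  FractionRing (MvPolynomial (Fin 2 × Fin n × Fin n) K)

/-- The two generic `n × n` matrices (`u = 0` and `u = 1`), with independent indeterminates as
entries. -/
noncomputable def genericMatrix (K : Type*) [Field K] (n : ℕ) (u : Fin 2) :
    Matrix (Fin n) (Fin n) (MatEntriesField K n) :=
  fun i j => algebraMap (MvPolynomial (Fin 2 × Fin n × Fin n) K) _ (MvPolynomial.X (u, i, j))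

/-- Two `n × n` matrices over `K` can be multiplied by `s` arithmetic operations. -/
def MatMulInOps (K : Type*) [Field K] (n s : ℕ) : Prop :=
  ∃ S : Set (MatEntriesField K n),
    ArithReach K {x | ∃ u i j, x = genericMatrix K n u i j} s S ∧
    ∀ i j, (genericMatrix K n 0 * genericMatrix K n 1) i j ∈ S

/-- The exponent `ω` of matrix multiplication over `K`: the infimum of the reals `τ` such that
`n × n` matrices over `K` can be multiplied by `O(n^τ)` arithmetic operations. -/
noncomputable def matMulExponent (K : Type*) [Field K] : ℝ :=
  sInf {τ : ℝ | ∃ s : ℕ → ℕ, (∀ n, MatMulInOps K n (s n)) ∧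
    (fun n => (s n : ℝ)) =O[atTop] (fun n => (n : ℝ) ^ τ)}

/-! One linear-time language encodes triangle detection. Its words are streams of three-bit
instructions, and the interpreter `Op.interp` executes them while crossing its input once. The
instructions act on the oracle tape, a flag and a result bit, so `Op.lang` lies in the
nondeterministic class with time bound `n`.

A graph on `N` vertices becomes a stream of `O(N²)` instructions (`Op.program`). The oracle bits, in
the cells from `0` on, name a vertex `v`. A first pass over the adjacency matrix compares these bits
with each row index and, at the match, copies that row to the cells left of `0`. A second pass
tests, for each `i` in the copied row, whether row `i` meets the copied row. The result is positive
exactly if `v` lies in a triangle (`Op.found_program`). About `log₂ N` bits name a vertex, and the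
word has at least `9N²` bits, so half the logarithm of its length suffices
(`Op.encList_program_mem_lang`).

Suppose that `Op.lang` is decidable in time `O(n^(δ'/2))`. If `δ' < 2`, the time is sublinear, so
the last instruction of long words is never read, although it can decide membership
(`Op.lang_not_mem_DTIME`); no hardness assumption is needed. If `δ' ≥ 2`, a RAM generates the word
of a graph in `O(N²)` operations and simulates the machine for `O(N^δ')` steps. All numbers involved
are polynomial in `N`, so the logarithmic cost adds only a factor `O(log N)`, which is `N^(o(1))`.
This contradicts the hardness of triangle detection (`triangleDetectionInTime_of_mem_DTIME`).

Most of the work is the RAM side: structured code compiled to labelled instructions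
(`RAM.Code.Exec.reach`), variables and arrays laid out in registers (`RAM.Rep`, `RAM.Runs`), the
simulation of a Turing machine (`MultiTapeTM.runs_simCode`) and the generation of the word
(`MultiTapeTM.Gen.runs_genCode`). The matrix multiplication exponent enters only as the threshold in
the hypothesis. -/

/-! ## A real-time interpreter for a stream of instructions -/

/-- Instructions that act on a flag, a result bit and the tape of the oracle bits. -/
inductive Op where
  | set
  | isOne
  | isZero
  | write
  | check
  | left
  | right
  | nop

namespace Op

/-- The code of an instruction as three bits. -/
def enc : Op → List Bool
  | set => [false, false, false]
  | isOne => [false, false, true]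
  | isZero => [false, true, false]
  | write => [false, true, true]
  | check => [true, false, false]
  | left => [true, false, true]
  | right => [true, true, false]
  | nop => [true, true, true]

/-- The instruction with a given code. -/
def decode : Bool → Bool → Bool → Op
  | false, false, false => set
  | false, false, true => isOne
  | false, true, false => isZero
  | false, true, true => write
  | true, false, false => check
  | true, false, true => left
  | true, true, false => right
  | true, true, true => nop

/-- The effect of an instruction on the flag, the result and the scanned cell, and the head
movement. -/
def act : Op → Bool → Bool → Option Bool → Bool × Bool × Option Bool × Move
  | set, _, d, a => (true, d, a, .stay)
  | isOne, f, d, a => (f && a == some true, d, a, .stay)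
  | isZero, f, d, a => (f && a == some false, d, a, .stay)
  | write, f, d, a => (f, d, if f then some true else a, .stay)
  | check, f, d, a => (f, d || (f && a == some true), a, .stay)
  | left, f, d, a => (f, d, a, .left)
  | right, f, d, a => (f, d, a, .right)
  | nop, f, d, a => (f, d, a, .stay)

theorem exists_enc (o : Op) : ∃ a b c, o.enc = [a, b, c] ∧ decode a b c = o := by
  cases o <;> exact ⟨_, _, _, rfl, rfl⟩

/-- The bit string of a list of instructions. -/
def encList (l : List Op) : List Bool := l.flatMap enc

theorem length_encList (l : List Op) : (encList l).length = 3 * l.length := by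
  induction l with
  | nil => rfl
  | cons o l ih =>
    obtain ⟨a, b, c, h, -⟩ := o.exists_enc
    simp only [encList, List.flatMap_cons, List.length_append, h, List.length_cons] at ih ⊢
    simp [ih]; ring

theorem encList_append (l l' : List Op) : encList (l ++ l') = encList l ++ encList l' := by
  simp [encList]

/-- The state on which instructions act. -/
structure St where
  flag : Bool
  found : Bool
  tape : ℤ → Option Bool
  head : ℤ

/-- The execution of an instruction. -/
def exec (s : St) (o : Op) : St where
  flag := (o.act s.flag s.found (s.tape s.head)).1
  found := (o.act s.flag s.found (s.tape s.head)).2.1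
  tape := Function.update s.tape s.head (o.act s.flag s.found (s.tape s.head)).2.2.1
  head := s.head + (o.act s.flag s.found (s.tape s.head)).2.2.2.shift

/-- The Turing machine that executes the instructions on its input tape. -/
abbrev interp : MultiTapeTM where
  k := 0
  Q := Option (Bool × Option Bool) × Bool × Bool
  Γ := Option Bool
  finQ := inferInstance
  finΓ := inferInstance
  sym := Function.Embedding.refl _
  start := (none, false, false)
  acc := fun q => q.2.2
  tr := fun q a =>
    match a 0 with
    | none => none
    | some b =>
      match q with
      | (none, f, d) =>
        some ((some (b, none), f, d), a, fun i => if i = 0 then .right else .stay)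
      | (some (b₁, none), f, d) =>
        some ((some (b₁, some b), f, d), a, fun i => if i = 0 then .right else .stay)
      | (some (b₁, some b₂), f, d) =>
        some ((none, ((decode b₁ b₂ b).act f d (a 1)).1, ((decode b₁ b₂ b).act f d (a 1)).2.1),
          fun i => if i = 0 then a 0 else ((decode b₁ b₂ b).act f d (a 1)).2.2.1,
          fun i => if i = 0 then .right else ((decode b₁ b₂ b).act f d (a 1)).2.2.2)

/-- The tape with the word `x`. -/
def word (x : List Bool) : ℤ → Option Bool := fun p => if 0 ≤ p then x[p.toNat]? else none

theorem word_natCast (x : List Bool) (p : ℕ) : word x p = x[p]? := by simp [word]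

/-- A configuration of the interpreter. -/
def cfg (q : Option (Bool × Option Bool)) (x : List Bool) (p : ℕ) (s : St) : interp.Cfg where
  state := (q, s.flag, s.found)
  tape := fun i => if i = 0 then word x else s.tape
  head := fun i => if i = 0 then p else s.head

/-- The state before the first instruction. -/
def St.init (w : List Bool) : St := ⟨false, false, word w, 0⟩

theorem cfg_ext {c c' : interp.Cfg} (h : c.state = c'.state) (h0 : c.tape 0 = c'.tape 0)
    (h1 : c.tape 1 = c'.tape 1) (g0 : c.head 0 = c'.head 0) (g1 : c.head 1 = c'.head 1) :
    c = c' := by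
  obtain ⟨q, t, e⟩ := c
  obtain ⟨q', t', e'⟩ := c'
  have ht : t = t' := by
    funext i; change Fin 2 at i; fin_cases i; exacts [h0, h1]
  have he : e = e' := by
    funext i; change Fin 2 at i; fin_cases i; exacts [g0, g1]
  simp only at h
  subst h ht he; rfl

theorem init_eq (x w : List Bool) : interp.init x w = cfg none x 0 (St.init w) := by
  exact cfg_ext rfl rfl rfl rfl rfl

theorem cfg_halted (q x s) : interp.Halted (cfg q x x.length s) := by
  simp [MultiTapeTM.Halted, MultiTapeTM.next, interp, cfg, word_natCast]

/-- The state buffers up to two bits of the current code; the third bit triggers the execution, so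
every instruction takes exactly three steps. -/
theorem step_cfg {q : Option (Bool × Option Bool)} {x : List Bool} {p : ℕ} {b : Bool} (s : St)
    (h : x[p]? = some b) :
    interp.step (cfg q x p s) = match q with
      | none => cfg (some (b, none)) x (p + 1) s
      | some (b₁, none) => cfg (some (b₁, some b)) x (p + 1) s
      | some (b₁, some b₂) => cfg none x (p + 1) (exec s (decode b₁ b₂ b)) := by
  have hw : word x p = some b := by rw [word_natCast, h]
  rcases q with _ | ⟨b₁, _ | b₂⟩
  · refine cfg_ext ?_ ?_ ?_ ?_ ?_ <;>
      simp [MultiTapeTM.step, MultiTapeTM.next, interp, cfg, hw, Move.shift]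
  · refine cfg_ext ?_ ?_ ?_ ?_ ?_ <;>
      simp [MultiTapeTM.step, MultiTapeTM.next, interp, cfg, hw, Move.shift]
  · refine cfg_ext ?_ ?_ ?_ ?_ ?_ <;>
      simp [MultiTapeTM.step, MultiTapeTM.next, interp, cfg, hw, Move.shift, exec]

theorem iterate_step_init (x w : List Bool) (t : ℕ) (ht : t ≤ x.length) :
    ∃ q s, interp.step^[t] (interp.init x w) = cfg q x t s := by
  induction t with
  | zero => exact ⟨_, _, init_eq x w⟩
  | succ t ih =>
    obtain ⟨q, s, h⟩ := ih (by omega)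
    rw [Function.iterate_succ_apply', h, step_cfg s (List.getElem?_eq_getElem (by omega))]
    rcases q with _ | ⟨b₁, _ | b₂⟩ <;> exact ⟨_, _, rfl⟩

/-- Every step moves the input head one cell to the right and the first blank halts the machine, so
the bound also holds for words that encode no instruction list. -/
theorem haltsWithin (x w : List Bool) : interp.HaltsWithin x w x.length := by
  obtain ⟨q, s, h⟩ := iterate_step_init x w x.length le_rfl
  rw [MultiTapeTM.HaltsWithin, h]
  exact cfg_halted q x s

theorem iterate_step_cfg (pre : List Bool) (ops : List Op) (s : St) :
    interp.step^[3 * ops.length] (cfg none (pre ++ encList ops) pre.length s) =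
      cfg none (pre ++ encList ops) (pre ++ encList ops).length (ops.foldl exec s) := by
  induction ops generalizing pre s with
  | nil => simp [encList]
  | cons o l ih =>
    obtain ⟨a, b, c, h, hd⟩ := o.exists_enc
    have e : pre ++ encList (o :: l) = (pre ++ [a, b, c]) ++ encList l := by
      simp [encList, h]
    have e3 : 3 * (o :: l).length = 3 * l.length + 1 + 1 + 1 := by simp; ring
    rw [e3, Function.iterate_succ_apply, Function.iterate_succ_apply, Function.iterate_succ_apply,
      e]
    rw [step_cfg (b := a) s (by simp)]
    dsimp only
    rw [step_cfg (b := b) s (by simp)]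
    dsimp only
    rw [step_cfg (b := c) s (by
      rw [List.append_assoc, List.getElem?_append_right (by omega),
        show pre.length + 1 + 1 - pre.length = 2 by omega]; rfl)]
    dsimp only
    have := ih (pre ++ [a, b, c]) (exec s o)
    simp only [List.length_append, List.length_cons, List.length_nil] at this ⊢
    rw [hd]
    exact this

end Op

/-! ### Halting, acceptance and locality of Turing machine runs -/

namespace MultiTapeTM

variable {M : MultiTapeTM}

theorem Halted.step_eq {c : M.Cfg} (h : M.Halted c) : M.step c = c := by
  unfold Halted at h
  simp [step, h]

theorem Halted.iterate_eq {c : M.Cfg} (h : M.Halted c) (t : ℕ) : M.step^[t] c = c := by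
  induction t with
  | zero => rfl
  | succ t ih => rw [Function.iterate_succ_apply, h.step_eq, ih]

theorem iterate_eq_of_halted {c : M.Cfg} {t t' : ℕ} (h : M.Halted (M.step^[t] c))
    (h' : M.Halted (M.step^[t'] c)) : M.step^[t] c = M.step^[t'] c := by
  wlog hle : t ≤ t' generalizing t t'
  · exact (this h' h (by omega)).symm
  obtain ⟨d, rfl⟩ := Nat.exists_eq_add_of_le hle
  rw [add_comm t d, Function.iterate_add_apply, h.iterate_eq]

/-- Halted configurations are fixed points, so acceptance can be read off at any time bound. -/
theorem accepts_iff {x w : List Bool} {t : ℕ} (h : M.HaltsWithin x w t) :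
    M.Accepts x w ↔ M.acc (M.step^[t] (M.init x w)).state = true := by
  constructor
  · rintro ⟨t', h', ha⟩
    rwa [iterate_eq_of_halted h h']
  · exact fun ha => ⟨t, h, ha⟩

/-- Two runs on inputs that agree on the first `m` cells agree before step `m`. -/
theorem iterate_step_congr {x y w : List Bool} {m : ℕ}
    (hxy : ∀ p : ℤ, p < m → M.wordTape x p = M.wordTape y p) (t : ℕ) (ht : t ≤ m) :
    (M.step^[t] (M.init x w)).state = (M.step^[t] (M.init y w)).state ∧
    (M.step^[t] (M.init x w)).head = (M.step^[t] (M.init y w)).head ∧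
    (M.step^[t] (M.init x w)).head 0 ≤ t ∧
    (∀ i, i ≠ 0 → (M.step^[t] (M.init x w)).tape i = (M.step^[t] (M.init y w)).tape i) ∧
    ∀ p : ℤ, p < m →
      (M.step^[t] (M.init x w)).tape 0 p = (M.step^[t] (M.init y w)).tape 0 p := by
  induction t with
  | zero =>
    refine ⟨rfl, rfl, by simp [init], fun i hi => ?_, ?_⟩
    · simp [init, hi]
    · simpa [init] using hxy
  | succ t ih =>
    obtain ⟨h1, h2, h3, h4, h5⟩ := ih (by omega)
    rw [Function.iterate_succ_apply', Function.iterate_succ_apply']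
    generalize M.step^[t] (M.init x w) = c at *
    generalize M.step^[t] (M.init y w) = c' at *
    have hs : (fun i => c.tape i (c.head i)) = fun i => c'.tape i (c'.head i) := by
      funext i
      rw [← h2]
      by_cases hi : i = 0
      · subst hi
        -- After `t` steps the input head is at position at most `t < m`, inside the part where the
        -- tapes agree.
        exact h5 _ (by omega)
      · rw [h4 i hi]
    have hn : M.next c = M.next c' := by simp only [next, h1, hs]
    unfold step
    rw [← hn]
    rcases M.next c with _ | ⟨q, a, mv⟩
    · exact ⟨h1, h2, by push_cast; omega, h4, h5⟩
    · refine ⟨rfl, by simp [h2], ?_, fun i hi => ?_, fun p hp => ?_⟩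
      · have : (mv 0).shift ≤ 1 := by cases mv 0 <;> simp [Move.shift]
        push_cast
        omega
      · simp [h4 i hi, h2]
      · simp only [h2, Function.update_apply]
        split
        · rfl
        · exact h5 p hp

/-- A machine that halts before it can reach cell `m` cannot tell apart two inputs of the same
length that agree on the first `m` cells. -/
theorem accepts_congr {x y w : List Bool} {m t : ℕ} (ht : t < m)
    (hxy : ∀ p : ℤ, p < m → M.wordTape x p = M.wordTape y p)
    (hx : M.HaltsWithin x w t) (hy : M.HaltsWithin y w t) : M.Accepts x w ↔ M.Accepts y w := by
  rw [accepts_iff hx, accepts_iff hy, (iterate_step_congr hxy t ht.le).1]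

end MultiTapeTM

/-! ### The language of the interpreter and a linear lower bound for it -/

namespace Op

theorem accepts_encList (ops : List Op) (w : List Bool) :
    interp.Accepts (encList ops) w ↔ (ops.foldl exec (St.init w)).found = true := by
  rw [MultiTapeTM.accepts_iff (haltsWithin _ w), init_eq, length_encList]
  have := iterate_step_cfg [] ops (St.init w)
  simp only [List.nil_append, List.length_nil] at this
  rw [this]
  rfl

/-- The number of oracle bits. -/
noncomputable def bits (n : ℕ) : ℕ := ⌈(1 / 2 : ℝ) * Real.logb 2 n⌉₊

/-- The words that the interpreter accepts for some choice of the oracle bits. -/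
def lang : Set (List Bool) :=
  {x | ∃ w : List Bool, w.length = bits x.length ∧ interp.Accepts x w}

theorem lang_mem_NDTIME : lang ∈ NDTIME bits (fun n => (n : ℝ)) :=
  ⟨interp, fun n => n, isBigO_refl _ _, fun x w _ => haltsWithin x w, fun _ => Iff.rfl⟩

theorem found_foldl_left (n : ℕ) (s : St) :
    ((List.replicate n left).foldl exec s).found = s.found := by
  induction n generalizing s with
  | zero => rfl
  | succ n ih => rw [List.replicate_succ, List.foldl_cons, ih]; rfl

/-- Two words of equal length that differ only in their last instruction, one inside and one outside
the language, are indistinguishable to a machine that halts before its head can reach that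
instruction. -/
theorem lang_not_mem_DTIME {c : ℝ} (hc : c < 1) : lang ∉ DTIME (fun n => (n : ℝ) ^ c) := by
  rintro ⟨M, T, hT, hM, hL⟩
  have ho : (fun n => (T n : ℝ)) =o[atTop] (fun n : ℕ => (n : ℝ)) := by
    refine hT.trans_isLittleO ?_
    have h1 : (fun x : ℝ => x ^ c) =o[atTop] fun x : ℝ => x := by
      have h0 : ∀ᶠ x : ℝ in atTop, x = 0 → x ^ c = 0 := by
        filter_upwards [eventually_gt_atTop 0] with x hx h using absurd h hx.ne'
      rw [isLittleO_iff_tendsto' h0]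
      refine (tendsto_rpow_neg_atTop (show 0 < 1 - c by linarith)).congr' ?_
      filter_upwards [eventually_gt_atTop 0] with x hx
      rw [neg_sub, Real.rpow_sub hx, Real.rpow_one]
    exact h1.comp_tendsto tendsto_natCast_atTop_atTop
  -- The `3` is the length of one instruction code: the machine stops before it reaches the last
  -- one.
  have hev : ∀ᶠ n : ℕ in atTop, T n + 3 < n := by
    filter_upwards [ho.bound (show (0 : ℝ) < 1 / 2 by norm_num), eventually_gt_atTop 6] with n hn h6
    simp only [Real.norm_natCast] at hn
    have h6' : (6 : ℝ) < n := by exact_mod_cast h6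
    have : (T n : ℝ) + 3 < n := by linarith
    exact_mod_cast this
  obtain ⟨n₀, hn₀⟩ := eventually_atTop.1 hev
  -- The moves to the left are padding beyond the threshold `n₀`. Then `set` and `write` put `true`
  -- into the scanned cell; a final `check` reports it, a final `set` does not.
  let pre : List Op := List.replicate n₀ left ++ [set, write]
  let x := encList (pre ++ [check])
  let y := encList (pre ++ [set])
  have hlx : x.length = 3 * (n₀ + 3) := by simp [x, pre, length_encList]
  have hly : y.length = 3 * (n₀ + 3) := by simp [y, pre, length_encList]
  have hlt := hn₀ (3 * (n₀ + 3)) (by omega)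
  have hxL : x ∈ lang := by
    refine ⟨List.replicate (bits x.length) true, by simp, ?_⟩
    rw [accepts_encList]
    simp only [pre, List.foldl_append, List.foldl_cons, List.foldl_nil]
    simp [exec, act, Move.shift]
  have hyL : y ∉ lang := by
    rintro ⟨w, -, hw⟩
    rw [accepts_encList] at hw
    simp only [pre, List.foldl_append, List.foldl_cons, List.foldl_nil] at hw
    have := found_foldl_left n₀ (St.init w)
    simp [exec, act] at hw
    rw [this] at hw
    simp [St.init] at hw
  have hx0 : M.HaltsWithin x [] (T (3 * (n₀ + 3))) := hlx ▸ hM x [] rfl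
  have hy0 : M.HaltsWithin y [] (T (3 * (n₀ + 3))) := hly ▸ hM y [] rfl
  have hpre : (encList pre).length = 3 * (n₀ + 2) := by simp [pre, length_encList]
  have hagree : ∀ p : ℤ, p < ((3 * (n₀ + 2) : ℕ) : ℤ) → M.wordTape x p = M.wordTape y p := by
    intro p hp
    unfold MultiTapeTM.wordTape
    congr 1
    split_ifs with h0
    · have : p.toNat < (encList pre).length := by omega
      simp only [x, y, encList_append]
      rw [List.getElem?_append_left this, List.getElem?_append_left this]
    · rfl
  have hiff := MultiTapeTM.accepts_congr (by omega) hagree hx0 hy0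
  obtain ⟨w, hw, hacc⟩ := (hL x).1 hxL
  obtain rfl : w = [] := List.length_eq_zero_iff.1 hw
  exact hyL ((hL y).2 ⟨[], rfl, hiff.1 hacc⟩)

end Op

namespace Op

/-! ## The instructions that test a graph for triangles -/

/-- Execution of a list of instructions. -/
abbrev run (l : List Op) (s : St) : St := l.foldl exec s

theorem run_append (l l' : List Op) (s : St) : run (l ++ l') s = run l' (run l s) :=
  List.foldl_append

theorem run_lefts (n : ℕ) (s : St) :
    run (List.replicate n left) s = { s with head := s.head - n } := by
  induction n generalizing s with
  | zero => simp
  | succ n ih =>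
    rw [List.replicate_succ, run, List.foldl_cons]
    refine (ih _).trans ?_
    simp [exec, act, Move.shift]; ring

theorem run_rights (n : ℕ) (s : St) :
    run (List.replicate n right) s = { s with head := s.head + n } := by
  induction n generalizing s with
  | zero => simp
  | succ n ih =>
    rw [List.replicate_succ, run, List.foldl_cons]
    refine (ih _).trans ?_
    simp [exec, act, Move.shift]; ring

/-- Compare `l` cells with the binary digits of `i`, the least significant one first. -/
def digits (l i : ℕ) : List Op :=
  (List.range l).flatMap fun d => [if i.testBit d then isOne else isZero, right]

theorem digits_succ (l i : ℕ) :
    digits (l + 1) i = digits l i ++ [if i.testBit l then isOne else isZero, right] := by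
  simp [digits, List.range_succ]

/-- The first `l` cells hold the binary digits of `i`. -/
def Matches (l i : ℕ) (t : ℤ → Option Bool) : Prop := ∀ d < l, t d = some (i.testBit d)

/-- Bits from position `l` on vanish below `2 ^ l`. Hence the oracle bits select at most one row. -/
theorem Matches.eq {l i j : ℕ} {t : ℤ → Option Bool} (hi : Matches l i t) (hj : Matches l j t)
    (hil : i < 2 ^ l) (hjl : j < 2 ^ l) : i = j := by
  refine Nat.eq_of_testBit_eq fun d => ?_
  by_cases hd : d < l
  · simpa using (hi d hd).symm.trans (hj d hd)
  · have : 2 ^ l ≤ 2 ^ d := Nat.pow_le_pow_right (by norm_num) (by omega)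
    rw [Nat.testBit_lt_two_pow (by omega), Nat.testBit_lt_two_pow (by omega)]

theorem run_digits (l i : ℕ) (s : St) (h0 : s.head = 0) :
    (run (digits l i) s).found = s.found ∧ (run (digits l i) s).tape = s.tape ∧
    (run (digits l i) s).head = l ∧
    ((run (digits l i) s).flag = true ↔ s.flag = true ∧ Matches l i s.tape) := by
  induction l with
  | zero => simp [digits, h0, Matches]
  | succ l ih =>
    rw [digits_succ, run_append]
    obtain ⟨h1, h2, h3, h4⟩ := ih
    generalize run (digits l i) s = r at *
    have hM : Matches (l + 1) i s.tape ↔ Matches l i s.tape ∧ s.tape l = some (i.testBit l) := by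
      simp only [Matches, Nat.lt_succ_iff_lt_or_eq]
      exact ⟨fun h => ⟨fun d hd => h d (Or.inl hd), h l (Or.inr rfl)⟩,
        fun h d hd => hd.elim (h.1 d) fun e => e ▸ h.2⟩
    rw [hM, ← and_assoc (a := s.flag = true), ← h4, ← h2]
    cases hb : i.testBit l <;> simp [exec, act, Move.shift, h1, h3]

/-- Go through `n` cells to the left, executing `o` where `f` holds. -/
def entries (o : Op) (f : ℕ → Bool) (n : ℕ) : List Op :=
  (List.range n).flatMap fun j => [if f j then o else nop, left]

theorem entries_succ (o : Op) (f : ℕ → Bool) (n : ℕ) :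
    entries o f (n + 1) = entries o f n ++ [if f n then o else nop, left] := by
  simp [entries, List.range_succ]

/-- Writing only ever adds cells with `true`, and a false flag adds none. Only these cells are
tracked: blank and `false` play the same role in the later tests. -/
theorem run_entries_write (f : ℕ → Bool) (n : ℕ) (s : St) :
    (run (entries write f n) s).found = s.found ∧ (run (entries write f n) s).flag = s.flag ∧
    (run (entries write f n) s).head = s.head - n ∧
    (∀ p, s.head < p → (run (entries write f n) s).tape p = s.tape p) ∧
    ∀ j : ℕ, (run (entries write f n) s).tape (s.head - j) = some true ↔
      s.tape (s.head - j) = some true ∨ (s.flag = true ∧ j < n ∧ f j = true) := by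
  induction n with
  | zero => simp [entries]
  | succ n ih =>
    rw [entries_succ, run_append]
    obtain ⟨h1, h2, h3, h4, h5⟩ := ih
    generalize run (entries write f n) s = r at *
    cases hb : f n
    · simp only [run, List.foldl_cons, List.foldl_nil, Bool.false_eq_true, if_false]
      refine ⟨by simp [exec, act, h1], by simp [exec, act, h2],
        by simp [exec, act, Move.shift, h3]; ring, by simpa [exec, act] using h4, fun j => ?_⟩
      simp only [exec, act, Function.update_eq_self, h5]
      have : j < n + 1 ∧ f j = true ↔ j < n ∧ f j = true := by
        rw [Nat.lt_succ_iff_lt_or_eq]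
        constructor
        · rintro ⟨h | rfl, h'⟩
          · exact ⟨h, h'⟩
          · simp [hb] at h'
        · exact fun h => ⟨Or.inl h.1, h.2⟩
      rw [this]
    · simp only [run, List.foldl_cons, List.foldl_nil, if_true]
      refine ⟨by simp [exec, act, h1], by simp [exec, act, h2],
        by simp [exec, act, Move.shift, h3]; ring, fun p hp => ?_, fun j => ?_⟩
      · simp only [exec, act, Function.update_eq_self]
        rw [Function.update_of_ne (by omega), h4 p hp]
      · simp only [exec, act, Function.update_eq_self]
        by_cases hj : j = n
        · subst hj
          rw [← h3, Function.update_self]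
          have := h5 j
          rw [← h3] at this
          cases hf : s.flag <;> simp [h2, hf, hb, this]
        · rw [Function.update_of_ne (by omega), h5 j]
          have : j < n + 1 ↔ j < n := by omega
          rw [this]

theorem run_entries_check (f : ℕ → Bool) (n : ℕ) (s : St) :
    (run (entries check f n) s).tape = s.tape ∧ (run (entries check f n) s).flag = s.flag ∧
    (run (entries check f n) s).head = s.head - n ∧
    ((run (entries check f n) s).found = true ↔ s.found = true ∨
      (s.flag = true ∧ ∃ j < n, f j = true ∧ s.tape (s.head - j) = some true)) := by
  induction n with
  | zero => simp [entries]
  | succ n ih =>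
    rw [entries_succ, run_append]
    obtain ⟨h1, h2, h3, h4⟩ := ih
    generalize run (entries check f n) s = r at *
    have hM : (∃ j < n + 1, f j = true ∧ s.tape (s.head - j) = some true) ↔
        (∃ j < n, f j = true ∧ s.tape (s.head - j) = some true) ∨
          (f n = true ∧ s.tape (s.head - n) = some true) := by
      simp only [Nat.lt_succ_iff_lt_or_eq]
      constructor
      · rintro ⟨j, hj | rfl, h⟩
        · exact Or.inl ⟨j, hj, h⟩
        · exact Or.inr h
      · rintro (⟨j, hj, h⟩ | h)
        · exact ⟨j, Or.inl hj, h⟩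
        · exact ⟨n, Or.inr rfl, h⟩
    rw [hM, and_or_left, ← or_assoc, ← h4, ← h1, ← h2, ← h3]
    cases hb : f n
    · simp [exec, act, Move.shift, h3]; ring
    · simp [exec, act, Move.shift, h3]; ring

/-- Copy row `i` of the matrix to the cells `-1, -2, …` if the oracle bits are the digits
of `i`. -/
def copyRow (n l i : ℕ) (f : ℕ → Bool) : List Op :=
  [set] ++ digits l i ++ List.replicate l left ++ [left] ++ entries write f n ++
    List.replicate n right ++ [right]

/-- Look for a common neighbour in row `i` and the copied row, if `i` is in the copied row. -/
def checkRow (n i : ℕ) (f : ℕ → Bool) : List Op :=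
  [left] ++ List.replicate i left ++ [set, isOne] ++ List.replicate i right ++
    entries check f n ++ List.replicate n right ++ [right]

/-- The comparison leaves its outcome in the flag, which gates the writing; the head movements do
not depend on it. The oracle bits survive and the head returns to `0`, so the next row can be
treated in the same way. -/
theorem run_copyRow (n l i : ℕ) (f : ℕ → Bool) (s : St) (h0 : s.head = 0) :
    (run (copyRow n l i f) s).found = s.found ∧ (run (copyRow n l i f) s).head = 0 ∧
    (∀ p, 0 ≤ p → (run (copyRow n l i f) s).tape p = s.tape p) ∧
    ∀ j : ℕ, (run (copyRow n l i f) s).tape (-1 - j) = some true ↔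
      s.tape (-1 - j) = some true ∨ (Matches l i s.tape ∧ j < n ∧ f j = true) := by
  simp only [copyRow, run_append, run_lefts, run_rights]
  have hs : run [set] s = { s with flag := true } := by simp [exec, act, Move.shift]
  rw [hs]
  obtain ⟨a1, a2, a3, a4⟩ := run_digits l i { s with flag := true } h0
  generalize run (digits l i) { s with flag := true } = r at *
  have hl : run [left] { r with head := r.head - l } = { r with head := -1 } := by
    simp [exec, act, Move.shift, a3]
  rw [hl]
  obtain ⟨b1, b2, b3, b4, b5⟩ := run_entries_write f n { r with head := -1 }
  generalize run (entries write f n) { r with head := -1 } = q at *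
  simp only [true_and] at a4
  simp only [a2, a4] at b4 b5
  refine ⟨by simp [exec, act, b1, a1], by simp [exec, act, Move.shift, b3], fun p hp => ?_,
    fun j => ?_⟩
  · simpa [exec, act] using b4 p (by omega)
  · simpa [exec, act] using b5 j

/-- Testing cell `-1 - i` makes the flag say whether `i` belongs to the copied row; this flag then
gates the search for a common entry of row `i` and the copied row. -/
theorem run_checkRow (n i : ℕ) (f : ℕ → Bool) (s : St) (h0 : s.head = 0) :
    (run (checkRow n i f) s).tape = s.tape ∧ (run (checkRow n i f) s).head = 0 ∧
    ((run (checkRow n i f) s).found = true ↔ s.found = true ∨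
      (s.tape (-1 - i) = some true ∧ ∃ j < n, f j = true ∧ s.tape (-1 - j) = some true)) := by
  simp only [checkRow, run_append, run_lefts, run_rights]
  have hs : run [left] s = { s with head := -1 } := by simp [exec, act, Move.shift, h0]
  rw [hs]
  have hl : run [set, isOne] { s with head := -1 - i } =
      { s with head := -1 - i, flag := s.tape (-1 - i) == some true } := by
    simp [exec, act, Move.shift]
  dsimp only
  rw [hl]
  dsimp only
  rw [show (-1 - i + i : ℤ) = -1 by ring]
  obtain ⟨b1, b2, b3, b4⟩ := run_entries_check f n
    { s with head := -1, flag := s.tape (-1 - i) == some true }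
  generalize run (entries check f n)
    { s with head := -1, flag := s.tape (-1 - i) == some true } = q at *
  refine ⟨by simp [exec, act, b1], by simp [exec, act, Move.shift, b3], ?_⟩
  simpa [exec, act] using b4

/-- The instructions for a graph with `n` vertices and adjacency matrix `A`. -/
def program (n l : ℕ) (A : ℕ → ℕ → Bool) : List Op :=
  ((List.range n).flatMap fun i => copyRow n l i (A i)) ++
    (List.range n).flatMap fun i => checkRow n i (A i)

theorem run_copyRows (n l m : ℕ) (A : ℕ → ℕ → Bool) (w : List Bool) :
    let r := run ((List.range m).flatMap fun i => copyRow n l i (A i)) (St.init w)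
    r.found = false ∧ r.head = 0 ∧ (∀ p, 0 ≤ p → r.tape p = word w p) ∧
    ∀ j : ℕ, r.tape (-1 - j) = some true ↔
      ∃ i < m, Matches l i (word w) ∧ j < n ∧ A i j = true := by
  induction m with
  | zero =>
    simp only [St.init, List.range_zero, List.flatMap_nil, run, List.foldl_nil, implies_true,
      true_and, Nat.not_lt_zero, false_and, exists_false, iff_false]
    -- Initially the cells left of `0` are blank, since the oracle word starts at cell `0`.
    intro j h
    simp only [word] at h
    rw [if_neg (by omega)] at h
    exact absurd h (by simp)
  | succ m ih =>
    simp only [List.range_succ, List.flatMap_append, run_append, List.flatMap_cons,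
      List.flatMap_nil, List.append_nil] at ih ⊢
    generalize run ((List.range m).flatMap fun i => copyRow n l i (A i)) (St.init w) = r at *
    obtain ⟨h1, h2, h3, h4⟩ := ih
    obtain ⟨a1, a2, a3, a4⟩ := run_copyRow n l m (A m) r h2
    refine ⟨a1.trans h1, a2, fun p hp => (a3 p hp).trans (h3 p hp), fun j => ?_⟩
    have hm : Matches l m r.tape ↔ Matches l m (word w) :=
      forall₂_congr fun d _ => by rw [h3 d (by omega)]
    rw [a4, h4, hm]
    constructor
    · rintro (⟨i, hi, h⟩ | h)
      · exact ⟨i, by omega, h⟩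
      · exact ⟨m, by omega, h⟩
    · rintro ⟨i, hi, h⟩
      rcases Nat.lt_succ_iff_lt_or_eq.1 hi with hi | rfl
      · exact Or.inl ⟨i, hi, h⟩
      · exact Or.inr h

theorem run_checkRows (n m : ℕ) (A : ℕ → ℕ → Bool) (s : St) (h0 : s.head = 0) :
    let r := run ((List.range m).flatMap fun i => checkRow n i (A i)) s
    r.tape = s.tape ∧ r.head = 0 ∧ (r.found = true ↔ s.found = true ∨
      ∃ i < m, s.tape (-1 - i) = some true ∧ ∃ j < n, A i j = true ∧
        s.tape (-1 - j) = some true) := by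
  induction m with
  | zero => simp [h0]
  | succ m ih =>
    simp only [List.range_succ, List.flatMap_append, run_append, List.flatMap_cons,
      List.flatMap_nil, List.append_nil] at ih ⊢
    generalize run ((List.range m).flatMap fun i => checkRow n i (A i)) s = r at *
    obtain ⟨h1, h2, h3⟩ := ih
    obtain ⟨a1, a2, a3⟩ := run_checkRow n m (A m) r h2
    refine ⟨a1.trans h1, a2, ?_⟩
    rw [a3, h3, h1, or_assoc]
    refine or_congr_right ?_
    constructor
    · rintro (⟨i, hi, h⟩ | h)
      · exact ⟨i, by omega, h⟩
      · exact ⟨m, by omega, h⟩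
    · rintro ⟨i, hi, h⟩
      rcases Nat.lt_succ_iff_lt_or_eq.1 hi with hi | rfl
      · exact Or.inl ⟨i, hi, h⟩
      · exact Or.inr h

theorem found_program (n l : ℕ) (hn : n ≤ 2 ^ l) (A : ℕ → ℕ → Bool) (w : List Bool) :
    (run (program n l A) (St.init w)).found = true ↔
      ∃ v < n, Matches l v (word w) ∧
        ∃ i < n, ∃ j < n, A v i = true ∧ A i j = true ∧ A v j = true := by
  rw [program, run_append]
  obtain ⟨h1, h2, -, h4⟩ := run_copyRows n l n A w
  generalize run ((List.range n).flatMap fun i => copyRow n l i (A i)) (St.init w) = r at *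
  rw [(run_checkRows n n A r h2).2.2, h1]
  simp only [h4, Bool.false_eq_true, false_or]
  constructor
  · rintro ⟨i, hi, ⟨v, hv, hm, -, hvi⟩, j, hj, hij, v', hv', hm', -, hvj⟩
    -- The two entries found in the copied row come from rows selected by the same oracle bits,
    -- hence from the same vertex.
    obtain rfl := hm.eq hm' (by omega) (by omega)
    exact ⟨v, hv, hm, i, hi, j, hj, hvi, hij, hvj⟩
  · rintro ⟨v, hv, hm, i, hi, j, hj, hvi, hij, hvj⟩
    exact ⟨i, hi, ⟨v, hv, hm, hi, hvi⟩, j, hj, hij, v, hv, hm, hj, hvj⟩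

theorem length_entries (o : Op) (f : ℕ → Bool) (n : ℕ) : (entries o f n).length = 2 * n := by
  simp [entries, mul_comm]

theorem length_digits (l i : ℕ) : (digits l i).length = 2 * l := by
  simp [digits, mul_comm]

theorem length_copyRow (n l i : ℕ) (f : ℕ → Bool) :
    (copyRow n l i f).length = 3 * n + 3 * l + 3 := by
  simp [copyRow, length_entries, length_digits]; ring

theorem length_checkRow_le (n i : ℕ) (hi : i < n) (f : ℕ → Bool) :
    (checkRow n i f).length ≤ 5 * n + 4 := by
  simp [checkRow, length_entries]; omega

theorem length_program_le (n l : ℕ) (A : ℕ → ℕ → Bool) :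
    (program n l A).length ≤ n * (8 * n + 3 * l + 7) := by
  rw [program, List.length_append, List.length_flatMap, List.length_flatMap]
  have h1 : ((List.range n).map fun i => (copyRow n l i (A i)).length).sum =
      n * (3 * n + 3 * l + 3) := by simp [length_copyRow]
  have h2 : ((List.range n).map fun i => (checkRow n i (A i)).length).sum ≤
      n * (5 * n + 4) := by
    refine (List.sum_le_card_nsmul _ (5 * n + 4) ?_).trans (by simp)
    simp only [List.mem_map, List.mem_range]
    rintro _ ⟨i, hi, rfl⟩
    exact length_checkRow_le n i hi _
  rw [h1]
  nlinarith

/-- A lower bound on the length is needed because the number of available oracle bits grows with the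
input length. -/
theorem le_length_program (n l : ℕ) (A : ℕ → ℕ → Bool) : 3 * n ^ 2 ≤ (program n l A).length := by
  rw [program, List.length_append, List.length_flatMap]
  have h1 : ((List.range n).map fun i => (copyRow n l i (A i)).length).sum =
      n * (3 * n + 3 * l + 3) := by simp [length_copyRow]
  rw [h1]
  nlinarith

/-- A positive result certifies a triangle for every oracle word, whatever its length. Conversely,
the digits of a vertex of a triangle are an accepted choice once at least `l` bits are available;
surplus bits are never inspected. -/
theorem encList_program_mem_lang (n l : ℕ) (hn : n ≤ 2 ^ l) (hl : 2 ^ l ≤ 2 * n)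
    (A : ℕ → ℕ → Bool) :
    encList (program n l A) ∈ lang ↔
      ∃ v < n, ∃ i < n, ∃ j < n, A v i = true ∧ A i j = true ∧ A v j = true := by
  constructor
  · rintro ⟨w, -, hw⟩
    rw [accepts_encList] at hw
    obtain ⟨v, hv, -, h⟩ := (found_program n l hn A w).1 hw
    exact ⟨v, hv, h⟩
  · rintro ⟨v, hv, h⟩
    refine ⟨(List.range (bits (encList (program n l A)).length)).map v.testBit, by simp, ?_⟩
    rw [accepts_encList]
    refine (found_program n l hn A _).2 ⟨v, hv, fun d hd => ?_, h⟩
    have hlb : l ≤ bits (encList (program n l A)).length := by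
      -- `(2 ^ l)² ≤ 4n² ≤ 9n²`, and the word consists of at least `3n²` instructions of three bits.
      have h1 : 2 ^ (2 * l) ≤ (encList (program n l A)).length := by
        rw [length_encList, mul_comm 2 l, pow_mul]
        have := le_length_program n l A
        nlinarith
      have h2 : ((2 * l : ℕ) : ℝ) ≤ Real.logb 2 (encList (program n l A)).length := by
        rw [Real.le_logb_iff_rpow_le (by norm_num)
          (by exact_mod_cast lt_of_lt_of_le (by positivity) h1), Real.rpow_natCast]
        exact_mod_cast h1
      have h3 : (l : ℝ) ≤ 1 / 2 * Real.logb 2 (encList (program n l A)).length := by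
        push_cast at h2; linarith
      exact_mod_cast h3.trans (Nat.le_ceil _)
    rw [word_natCast]
    simp [List.getElem?_range (hd.trans_le hlb)]

end Op

/-! ## Structured programs for random access machines -/

namespace RAM

/-- The contents of the registers and the unread input. -/
abbrev Mem := (ℕ → ℤ) × List ℤ

namespace Instr

/-- The instruction with next label `l`. -/
def relabel {Λ : Type} (l : Λ) : Instr Unit → Instr Λ
  | load a _ => load a l
  | store a _ => store a l
  | add a _ => add a l
  | sub a _ => sub a l
  | mult a _ => mult a l
  | div a _ => div a l
  | read a _ => read a l
  | jgtz _ _ => jgtz l l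
  | jzero _ _ => jzero l l
  | halt b => halt b

/-- The program that consists of one instruction. -/
def toProgram (i : Instr Unit) : Program := ⟨Unit, inferInstance, (), fun _ => i⟩

/-- The effect of an instruction on the memory. -/
def effect (i : Instr Unit) (m : Mem) : Mem :=
  ((step i.toProgram ⟨(), m.1, m.2⟩).mem, (step i.toProgram ⟨(), m.1, m.2⟩).input)

/-- The cost of an instruction. -/
def cost (i : Instr Unit) (m : Mem) : ℕ := stepCost i.toProgram ⟨(), m.1, m.2⟩

/-- The instruction is neither a jump nor `halt`. -/
def IsBasic : Instr Unit → Prop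
  | jgtz _ _ | jzero _ _ | halt _ => False
  | _ => True

end Instr

/-- The effect of a basic instruction does not depend on the surrounding program, so it can be taken
from the one-instruction program. -/
theorem step_relabel {P : Program} {c : P.Λ} {i : Instr Unit} {l : P.Λ} (hi : i.IsBasic)
    (h : P.code c = i.relabel l) (m : Mem) :
    step P ⟨c, m.1, m.2⟩ = ⟨l, (i.effect m).1, (i.effect m).2⟩ := by
  cases i <;> simp_all [step, Instr.relabel, Instr.effect, Instr.toProgram, Instr.IsBasic]

theorem stepCost_relabel {P : Program} {c : P.Λ} {i : Instr Unit} {l : P.Λ}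
    (h : P.code c = i.relabel l) (m : Mem) : stepCost P ⟨c, m.1, m.2⟩ = i.cost m := by
  cases i <;> simp_all [stepCost, Instr.relabel, Instr.cost, Instr.toProgram]

/-- Structured code: `ifz s t` executes `s` if the accumulator is zero and `t` otherwise, `loop s`
repeats `s` as long as the accumulator is positive. -/
inductive Code where
  | instr (i : Instr Unit)
  | seq (s t : Code)
  | ifz (s t : Code)
  | loop (s : Code)

namespace Code

/-- `Exec s m c m'`: started with memory `m`, the code `s` ends with memory `m'`,
at cost `c`. -/
inductive Exec : Code → Mem → ℕ → Mem → Prop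
  | instr {i : Instr Unit} (hi : i.IsBasic) (m : Mem) :
      Exec (instr i) m (i.cost m) (i.effect m)
  | seq {s t : Code} {m m' m'' : Mem} {c c' : ℕ} (h : Exec s m c m') (h' : Exec t m' c' m'') :
      Exec (seq s t) m (c + c') m''
  | ifz_zero {s t : Code} {m m' : Mem} {c : ℕ} (h0 : m.1 0 = 0) (h : Exec s m c m') :
      Exec (ifz s t) m (size (m.1 0) + c) m'
  | ifz_ne {s t : Code} {m m' : Mem} {c : ℕ} (h0 : m.1 0 ≠ 0) (h : Exec t m c m') :
      Exec (ifz s t) m (size (m.1 0) + c) m'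
  | loop_end {s : Code} {m : Mem} (h0 : ¬ 0 < m.1 0) : Exec (loop s) m (size (m.1 0)) m
  | loop_step {s : Code} {m m' m'' : Mem} {c c' : ℕ} (h0 : 0 < m.1 0) (h : Exec s m c m')
      (h' : Exec (loop s) m' c' m'') : Exec (loop s) m (size (m.1 0) + (c + c')) m''

/-- The labels of a piece of code. -/
def Lab : Code → Type
  | instr _ => Unit
  | seq s t => s.Lab ⊕ t.Lab
  | ifz s t => Option (s.Lab ⊕ t.Lab)
  | loop s => Option s.Lab

theorem finite_lab : ∀ s : Code, Finite s.Lab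
  | instr _ => inferInstanceAs (Finite Unit)
  | seq s t =>
    have := finite_lab s; have := finite_lab t
    inferInstanceAs (Finite (s.Lab ⊕ t.Lab))
  | ifz s t =>
    have := finite_lab s; have := finite_lab t
    inferInstanceAs (Finite (Option (s.Lab ⊕ t.Lab)))
  | loop s =>
    have := finite_lab s
    inferInstanceAs (Finite (Option s.Lab))

/-- The label at which a piece of code starts. -/
def entry : (s : Code) → s.Lab
  | instr _ => ()
  | seq s _ => Sum.inl s.entry
  | ifz _ _ => none
  | loop _ => none

/-- The instructions of a piece of code inside a program with labels `Λ`. -/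
def codeAt {Λ : Type} : (s : Code) → (s.Lab → Λ) → Λ → s.Lab → Instr Λ
  | instr i, _, e, _ => i.relabel e
  | seq s t, f, _, Sum.inl l => s.codeAt (fun a => f (Sum.inl a)) (f (Sum.inr t.entry)) l
  | seq _ t, f, e, Sum.inr l => t.codeAt (fun a => f (Sum.inr a)) e l
  | ifz s t, f, _, none => .jzero (f (some (Sum.inl s.entry))) (f (some (Sum.inr t.entry)))
  | ifz s _, f, e, some (Sum.inl l) => s.codeAt (fun a => f (some (Sum.inl a))) e l
  | ifz _ t, f, e, some (Sum.inr l) => t.codeAt (fun a => f (some (Sum.inr a))) e l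
  | loop s, f, e, none => .jgtz (f (some s.entry)) e
  | loop s, f, _, some l => s.codeAt (fun a => f (some a)) (f none) l

end Code

/-- The program gets from `c` to `c'` at cost `n`. -/
def Reach (P : Program) (c : Cfg P) (n : ℕ) (c' : Cfg P) : Prop :=
  ∃ t, (step P)^[t] c = c' ∧ ∑ s ∈ Finset.range t, stepCost P ((step P)^[s] c) = n

theorem Reach.single {P : Program} {c c' : Cfg P} (h : step P c = c') :
    Reach P c (stepCost P c) c' := ⟨1, h, by simp⟩

theorem Reach.trans {P : Program} {c c' c'' : Cfg P} {n n' : ℕ} (h : Reach P c n c')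
    (h' : Reach P c' n' c'') : Reach P c (n + n') c'' := by
  obtain ⟨t, rfl, rfl⟩ := h
  obtain ⟨t', rfl, rfl⟩ := h'
  refine ⟨t + t', by rw [add_comm, Function.iterate_add_apply], ?_⟩
  rw [Finset.sum_range_add]
  simp only [add_comm t, Function.iterate_add_apply]

/-- Correctness of compilation, for code whose labels are placed by `f` and whose exit is `e`. The
body of a loop exits to the test label `f none`, which is also the entry of the loop, so the
remaining passes are covered by the second induction hypothesis with the same `f` and `e`. -/
theorem Code.Exec.reach {P : Program} {s : Code} {m m' : Mem} {n : ℕ} (h : s.Exec m n m')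
    (f : s.Lab → P.Λ) (e : P.Λ) (hf : ∀ l, P.code (f l) = s.codeAt f e l) :
    Reach P ⟨f s.entry, m.1, m.2⟩ n ⟨e, m'.1, m'.2⟩ := by
  induction h generalizing e with
  | instr hi m =>
    have hc := hf ()
    rw [← stepCost_relabel hc m]
    exact .single (step_relabel hi hc m)
  | @seq s t _ _ _ _ _ _ _ ih ih' =>
    exact (ih (fun a => f (Sum.inl a)) (f (Sum.inr t.entry)) fun l => hf (Sum.inl l)).trans
      (ih' (fun a => f (Sum.inr a)) e fun l => hf (Sum.inr l))
  | @ifz_zero s t m _ _ h0 _ ih =>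
    have hc : P.code (f none) = _ := hf none
    simp only [codeAt] at hc
    have hs : step P ⟨f none, m.1, m.2⟩ = ⟨f (some (Sum.inl s.entry)), m.1, m.2⟩ := by
      simp [step, hc, h0]
    have h1 := Reach.single hs
    have hcost : stepCost P ⟨f none, m.1, m.2⟩ = size (m.1 0) := by simp [stepCost, hc]
    rw [hcost] at h1
    exact h1.trans (ih (fun a => f (some (Sum.inl a))) e fun l => hf (some (Sum.inl l)))
  | @ifz_ne s t m _ _ h0 _ ih =>
    have hc : P.code (f none) = _ := hf none
    simp only [codeAt] at hc
    have hs : step P ⟨f none, m.1, m.2⟩ = ⟨f (some (Sum.inr t.entry)), m.1, m.2⟩ := by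
      simp [step, hc, h0]
    have h1 := Reach.single hs
    have hcost : stepCost P ⟨f none, m.1, m.2⟩ = size (m.1 0) := by simp [stepCost, hc]
    rw [hcost] at h1
    exact h1.trans (ih (fun a => f (some (Sum.inr a))) e fun l => hf (some (Sum.inr l)))
  | @loop_end s m h0 =>
    have hc : P.code (f none) = _ := hf none
    simp only [codeAt] at hc
    have hs : step P ⟨f none, m.1, m.2⟩ = ⟨e, m.1, m.2⟩ := by
      simp only [step, hc, if_neg h0]
    have h1 := Reach.single hs
    have hcost : stepCost P ⟨f none, m.1, m.2⟩ = size (m.1 0) := by simp [stepCost, hc]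
    rw [hcost] at h1
    exact h1
  | @loop_step s m _ _ _ _ h0 _ _ ih ih' =>
    have hc : P.code (f none) = _ := hf none
    simp only [codeAt] at hc
    have hs : step P ⟨f none, m.1, m.2⟩ = ⟨f (some s.entry), m.1, m.2⟩ := by
      simp only [step, hc, if_pos h0]
    have h1 := Reach.single hs
    have hcost : stepCost P ⟨f none, m.1, m.2⟩ = size (m.1 0) := by simp [stepCost, hc]
    rw [hcost] at h1
    exact h1.trans ((ih (fun a => f (some a)) (f none) fun l => hf (some l)).trans (ih' f e hf))

/-- The program that executes `s` and then answers whether the accumulator is positive. -/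
def Code.toProgram (s : Code) : Program where
  Λ := s.Lab ⊕ Option Bool
  finΛ := have := s.finite_lab; inferInstance
  start := Sum.inl s.entry
  code := fun l => match l with
    | Sum.inl l => s.codeAt Sum.inl (Sum.inr none) l
    | Sum.inr none => .jgtz (Sum.inr (some true)) (Sum.inr (some false))
    | Sum.inr (some b) => .halt b

/-- The additional cost is that of the final jump on the accumulator and of `halt`. -/
theorem Code.Exec.answersWithin {s : Code} {inp : List ℤ} {m : Mem} {n : ℕ}
    (h : s.Exec (fun _ => 0, inp) n m) :
    AnswersWithin s.toProgram inp (decide (0 < m.1 0)) (n + size (m.1 0) + 1) := by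
  have h1 := h.reach (P := s.toProgram) Sum.inl (Sum.inr none) fun l => rfl
  have h2 : step s.toProgram ⟨Sum.inr none, m.1, m.2⟩ =
      ⟨Sum.inr (some (decide (0 < m.1 0))), m.1, m.2⟩ := by
    by_cases h0 : 0 < m.1 0 <;> simp [step, toProgram, h0]
  obtain ⟨t, ht, hn⟩ := h1.trans (Reach.single h2)
  refine ⟨t, ?_, ?_⟩
  · rw [show init s.toProgram inp = ⟨Sum.inl s.entry, fun _ => 0, inp⟩ from rfl, ht]
    rfl
  · rw [Finset.sum_range_succ, show init s.toProgram inp = ⟨Sum.inl s.entry, fun _ => 0, inp⟩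
      from rfl, hn, ht]
    exact le_rfl

theorem size_mono {i j : ℤ} (h : i.natAbs ≤ j.natAbs) : size i ≤ size j :=
  Nat.add_le_add_right (Nat.log_mono_right h) 1

/-! ## Bounded execution -/

/-- All registers and input numbers are at most `W` in absolute value. -/
def AllLe (W : ℕ) (m : Mem) : Prop := (∀ r, (m.1 r).natAbs ≤ W) ∧ ∀ z ∈ m.2, z.natAbs ≤ W

namespace Operand

/-- The numbers in the operand are at most `W`. -/
def Le (W : ℕ) : Operand → Prop
  | lit i => i.natAbs ≤ W
  | reg i => i ≤ W
  | ind i => i ≤ W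

theorem cost_le {W : ℕ} {m : Mem} (hm : AllLe W m) {a : Operand} (ha : a.Le W) :
    a.cost m.1 ≤ 3 * size W := by
  have hr : ∀ r, size (m.1 r) ≤ size W := fun r => size_mono (by simpa using hm.1 r)
  cases a with
  | lit i =>
    have : size i ≤ size W := size_mono (by simpa [Le] using ha)
    simp only [cost]; omega
  | reg i =>
    have : size i ≤ size W := size_mono (by simpa [Le] using ha)
    have := hr i
    simp only [cost]; omega
  | ind i =>
    have : size i ≤ size W := size_mono (by simpa [Le] using ha)
    have := hr i
    have := hr (m.1 i).toNat
    simp only [cost]; omega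

end Operand

namespace Addr

/-- The numbers in the target address are at most `W`. -/
def Le (W : ℕ) : Addr → Prop
  | reg i => i ≤ W
  | ind i => i ≤ W

theorem cost_le {W : ℕ} {m : Mem} (hm : AllLe W m) {a : Addr} (ha : a.Le W) :
    a.cost m.1 ≤ 3 * size W := by
  have hr : ∀ r, size (m.1 r) ≤ size W := fun r => size_mono (by simpa using hm.1 r)
  cases a with
  | reg i =>
    have : size i ≤ size W := size_mono (by simpa [Le] using ha)
    simp only [cost]; omega
  | ind i =>
    have : size i ≤ size W := size_mono (by simpa [Le] using ha)
    have := hr i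
    simp only [cost]; omega

end Addr

/-- The numbers in the instruction are at most `W`. -/
def Instr.Le (W : ℕ) : Instr Unit → Prop
  | load a _ | add a _ | sub a _ | mult a _ | div a _ => a.Le W
  | store a _ | read a _ => a.Le W
  | _ => True

/-- An instruction is charged for at most three numbers of its operand or address and one more, the
accumulator or the number read. This turns logarithmic cost into a count of instructions times a
common factor. -/
theorem Instr.cost_le {W : ℕ} {m : Mem} (hm : AllLe W m) {i : Instr Unit} (hi : i.Le W) :
    i.cost m ≤ 4 * size W := by
  have h0 : size (m.1 0) ≤ size W := size_mono (by simpa using hm.1 0)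
  have h1 : 1 ≤ size W := by simp [size]
  have h2 : size (m.2.headD 0) ≤ size W := by
    refine size_mono ?_
    rcases hl : m.2 with _ | ⟨z, l⟩
    · simp
    · simpa using hm.2 z (by simp [hl])
  cases i with
  | load a _ | add a _ | sub a _ | mult a _ | div a _ =>
    have := Operand.cost_le hm hi
    simp only [cost, stepCost, toProgram]
    omega
  | store a _ | read a _ =>
    have := Addr.cost_le hm hi
    simp only [cost, stepCost, toProgram]
    omega
  | jgtz _ _ | jzero _ _ | halt _ =>
    simp only [cost, stepCost, toProgram]
    omega

/-- Execution at a cost of at most `k` units of `4 * size W`. -/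
def ExecB (W k : ℕ) (s : Code) (m m' : Mem) : Prop :=
  ∃ c, s.Exec m c m' ∧ c ≤ k * (4 * size W)

namespace ExecB

variable {W k k' : ℕ} {s t : Code} {m m' m'' : Mem}

theorem instr {i : Instr Unit} (hi : i.IsBasic) (hl : i.Le W) (hm : AllLe W m) :
    ExecB W 1 (.instr i) m (i.effect m) :=
  ⟨_, .instr hi m, by simpa using Instr.cost_le hm hl⟩

theorem seq (h : ExecB W k s m m') (h' : ExecB W k' t m' m'') :
    ExecB W (k + k') (.seq s t) m m'' := by
  obtain ⟨c, h, hc⟩ := h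
  obtain ⟨c', h', hc'⟩ := h'
  exact ⟨_, h.seq h', by rw [add_mul]; omega⟩

theorem size_acc_le (hm : AllLe W m) : size (m.1 0) ≤ 1 * (4 * size W) := by
  have : size (m.1 0) ≤ size W := size_mono (by simpa using hm.1 0)
  omega

theorem ifz_zero (hm : AllLe W m) (h0 : m.1 0 = 0) (h : ExecB W k s m m') :
    ExecB W (1 + k) (.ifz s t) m m' := by
  obtain ⟨c, h, hc⟩ := h
  exact ⟨_, .ifz_zero h0 h, by rw [add_mul]; have := size_acc_le hm; omega⟩

theorem ifz_ne (hm : AllLe W m) (h0 : m.1 0 ≠ 0) (h : ExecB W k t m m') :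
    ExecB W (1 + k) (.ifz s t) m m' := by
  obtain ⟨c, h, hc⟩ := h
  exact ⟨_, .ifz_ne h0 h, by rw [add_mul]; have := size_acc_le hm; omega⟩

theorem loop_end (hm : AllLe W m) (h0 : ¬ 0 < m.1 0) : ExecB W 1 (.loop s) m m :=
  ⟨_, .loop_end h0, size_acc_le hm⟩

theorem loop_step (hm : AllLe W m) (h0 : 0 < m.1 0) (h : ExecB W k s m m')
    (h' : ExecB W k' (.loop s) m' m'') : ExecB W (1 + (k + k')) (.loop s) m m'' := by
  obtain ⟨c, h, hc⟩ := h
  obtain ⟨c', h', hc'⟩ := h'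
  exact ⟨_, .loop_step h0 h h', by rw [add_mul, add_mul]; have := size_acc_le hm; omega⟩

theorem mono (h : ExecB W k s m m') (hk : k ≤ k') : ExecB W k' s m m' := by
  obtain ⟨c, h, hc⟩ := h
  exact ⟨c, h, hc.trans (Nat.mul_le_mul_right _ hk)⟩

end ExecB

end RAM

set_option linter.unusedSectionVars false

/-! ## Programs with variables and two-way infinite arrays -/

namespace RAM

/-- The values of the variables, the contents of the arrays and the unread input. -/
@[ext]
structure Store (ι α : Type) where
  var : ι → ℤ
  arr : α → ℤ → ℤ
  input : List ℤ

namespace Store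

variable {ι α : Type} [DecidableEq ι] [DecidableEq α]

/-- Assignment to a variable. -/
def setVar (σ : Store ι α) (x : ι) (v : ℤ) : Store ι α :=
  { σ with var := Function.update σ.var x v }

/-- Assignment to an array cell. -/
def setArr (σ : Store ι α) (a : α) (p v : ℤ) : Store ι α :=
  { σ with arr := Function.update σ.arr a (Function.update (σ.arr a) p v) }

/-- All values are at most `V` in absolute value. -/
structure Bdd (V : ℕ) (σ : Store ι α) : Prop where
  var : ∀ x, (σ.var x).natAbs ≤ V
  arr : ∀ a p, (σ.arr a p).natAbs ≤ V
  input : ∀ z ∈ σ.input, z.natAbs ≤ V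

theorem Bdd.setVar {V : ℕ} {σ : Store ι α} (h : σ.Bdd V) (x : ι) {v : ℤ} (hv : v.natAbs ≤ V) :
    (σ.setVar x v).Bdd V := by
  refine ⟨fun y => ?_, h.arr, h.input⟩
  simp only [Store.setVar, Function.update_apply]
  split
  exacts [hv, h.var y]

theorem Bdd.setArr {V : ℕ} {σ : Store ι α} (h : σ.Bdd V) (a : α) (p : ℤ) {v : ℤ}
    (hv : v.natAbs ≤ V) : (σ.setArr a p v).Bdd V := by
  refine ⟨h.var, fun b q => ?_, h.input⟩
  simp only [Store.setArr, Function.update_apply]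
  split
  · simp only [Function.update_apply]
    split
    exacts [hv, h.arr a q]
  · exact h.arr b q

end Store

/-! ### Register layout for variables and two-way infinite arrays -/

section Registers

variable {ι : Type} (α : Type) [Fintype ι] [Fintype α]

/-- The register of a variable. -/
noncomputable def regVar (x : ι) : ℕ := 2 + (Fintype.card α + 1) * Fintype.equivFin ι x

variable {α}

/-- The register of an array cell. -/
noncomputable def regArr (a : α) (p : ℤ) : ℕ :=
  3 + Fintype.equivFin α a + (Fintype.card α + 1) * (p * (2 * p - 1)).toNat

theorem mul_two_mul_sub_one_nonneg (p : ℤ) : 0 ≤ p * (2 * p - 1) := by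
  rcases le_or_gt p 0 with h | h <;> nlinarith

/-- The difference of two values factors as `(p - q) (2 (p + q) - 1)`, and the second factor is odd.
The polynomial `p (2p - 1)` runs through the triangular numbers; it numbers the cells of a two-way
infinite array without a case distinction on the sign. -/
theorem mul_two_mul_sub_one_injective : Function.Injective fun p : ℤ => p * (2 * p - 1) := by
  intro p q h
  have h1 : (p - q) * (2 * (p + q) - 1) = 0 := by simp only at h; linear_combination h
  rcases mul_eq_zero.1 h1 with h2 | h2 <;> omega

theorem regArr_cast (a : α) (p : ℤ) :
    (regArr a p : ℤ) =
      (Fintype.card α + 1 : ℕ) * (p * (2 * p - 1)) + (3 + Fintype.equivFin α a : ℕ) := by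
  rw [regArr]
  push_cast
  rw [Int.toNat_of_nonneg (mul_two_mul_sub_one_nonneg p)]
  ring

theorem regVar_injective : Function.Injective (regVar α : ι → ℕ) := by
  intro x y h
  simp only [regVar, Nat.add_left_cancel_iff] at h
  exact (Fintype.equivFin ι).injective (Fin.ext (Nat.eq_of_mul_eq_mul_left (by omega) h))

/-- The residue modulo `Fintype.card α + 1` determines the array, the quotient the cell. -/
theorem regArr_inj {a b : α} {p q : ℤ} (h : regArr a p = regArr b q) : a = b ∧ p = q := by
  simp only [regArr] at h
  have ha := (Fintype.equivFin α a).isLt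
  have hb := (Fintype.equivFin α b).isLt
  have h' : ((Fintype.equivFin α a : ℕ) + (Fintype.card α + 1) * (p * (2 * p - 1)).toNat) =
      Fintype.equivFin α b + (Fintype.card α + 1) * (q * (2 * q - 1)).toNat := by omega
  have h1 := congrArg (· % (Fintype.card α + 1)) h'
  simp only [Nat.add_mul_mod_self_left] at h1
  rw [Nat.mod_eq_of_lt (by omega), Nat.mod_eq_of_lt (by omega)] at h1
  refine ⟨(Fintype.equivFin α).injective (Fin.ext h1), mul_two_mul_sub_one_injective ?_⟩
  rw [h1, Nat.add_left_cancel_iff] at h'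
  have h2 := Nat.eq_of_mul_eq_mul_left (by omega) h'
  have hp := mul_two_mul_sub_one_nonneg p
  have hq := mul_two_mul_sub_one_nonneg q
  simp only
  omega

/-- Counted from register `2`, variables have residue `0` modulo `Fintype.card α + 1`, array cells a
nonzero residue. -/
theorem regVar_ne_regArr (x : ι) (a : α) (p : ℤ) : regVar α x ≠ regArr a p := by
  intro h
  simp only [regVar, regArr] at h
  have ha := (Fintype.equivFin α a).isLt
  have h' : (Fintype.card α + 1) * (Fintype.equivFin ι x : ℕ) = 1 + Fintype.equivFin α a +
      (Fintype.card α + 1) * (p * (2 * p - 1)).toNat := by omega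
  have h1 := congrArg (· % (Fintype.card α + 1)) h'
  simp only [Nat.add_mul_mod_self_left, Nat.mul_mod_right] at h1
  rw [Nat.mod_eq_of_lt (by omega)] at h1
  omega

variable (ι α)

/-- A bound for all numbers that occur when all values are at most `V`. -/
def regBound (V : ℕ) : ℕ :=
  (Fintype.card α + 1) * (Fintype.card ι + 2 * V * V + V + 3) + Fintype.card α + V + 5

variable {ι α}

/-- Room for intermediate results such as the sum or difference of two values, and for small
constants. -/
theorem le_regBound (V : ℕ) : 2 * V + 8 ≤ regBound ι α V := by
  have := Nat.le_mul_of_pos_left (Fintype.card ι + 2 * V * V + V + 3)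
    (show 0 < Fintype.card α + 1 by omega)
  unfold regBound
  nlinarith

theorem regVar_le (V : ℕ) (x : ι) : regVar α x ≤ regBound ι α V := by
  have := (Fintype.equivFin ι x).isLt
  have : (Fintype.card α + 1) * (Fintype.equivFin ι x : ℕ) ≤
    (Fintype.card α + 1) * (Fintype.card ι + 2 * V * V + V + 3) :=
    Nat.mul_le_mul_left _ (by nlinarith)
  unfold regVar regBound
  omega

end Registers

/-! ### Stores represented in memory, and the basic commands -/

section Rep

variable {ι α : Type} [Fintype ι] [Fintype α] [DecidableEq ι] [DecidableEq α]

/-- The memory `m` represents the store `σ`. -/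
structure Rep (V : ℕ) (σ : Store ι α) (m : Mem) : Prop where
  var : ∀ x, m.1 (regVar α x) = σ.var x
  arr : ∀ a p, m.1 (regArr a p) = σ.arr a p
  input : m.2 = σ.input
  allLe : AllLe (regBound ι α V) m
  bdd : σ.Bdd V

variable {V : ℕ} {σ : Store ι α} {m : Mem}

theorem two_le_regVar (x : ι) : 2 ≤ regVar α x := by simp [regVar]

theorem two_le_regArr (a : α) (p : ℤ) : 2 ≤ regArr a p := by simp only [regArr]; omega

theorem AllLe.update {W : ℕ} (hm : AllLe W m) (r : ℕ) {v : ℤ} (hv : v.natAbs ≤ W) :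
    AllLe W (Function.update m.1 r v, m.2) := by
  refine ⟨fun r' => ?_, hm.2⟩
  simp only [Function.update_apply]
  split
  exacts [hv, hm.1 r']

/-- Registers `0` (accumulator) and `1` (computed address) carry no part of the store, so they may
hold anything up to `regBound`. -/
theorem Rep.update_aux (h : Rep V σ m) {r : ℕ} (hr : r < 2) {v : ℤ}
    (hv : v.natAbs ≤ regBound ι α V) : Rep V σ (Function.update m.1 r v, m.2) where
  var x := by
    have := two_le_regVar (α := α) x
    simpa [Function.update_of_ne (show regVar α x ≠ r by omega)] using h.var x
  arr a p := by
    have := two_le_regArr a p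
    simpa [Function.update_of_ne (show regArr a p ≠ r by omega)] using h.arr a p
  input := h.input
  allLe := h.allLe.update r hv
  bdd := h.bdd

theorem Rep.update_var (h : Rep V σ m) (x : ι) {v : ℤ} (hv : v.natAbs ≤ V) :
    Rep V (σ.setVar x v) (Function.update m.1 (regVar α x) v, m.2) where
  var y := by
    by_cases hxy : y = x
    · simp [hxy, Store.setVar]
    · simp [Store.setVar, hxy, regVar_injective.ne hxy, h.var]
  arr a p := by
    simpa [Store.setVar, Function.update_of_ne (regVar_ne_regArr x a p).symm] using h.arr a p
  input := h.input
  allLe := h.allLe.update _ (hv.trans (by have := le_regBound (ι := ι) (α := α) V; omega))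
  bdd := h.bdd.setVar x hv

theorem Rep.update_arr (h : Rep V σ m) (a : α) (p : ℤ) {v : ℤ} (hv : v.natAbs ≤ V) :
    Rep V (σ.setArr a p v) (Function.update m.1 (regArr a p) v, m.2) where
  var y := by
    simpa [Store.setArr, Function.update_of_ne (regVar_ne_regArr y a p)] using h.var y
  arr b q := by
    by_cases hb : b = a
    · subst hb
      by_cases hq : q = p
      · simp [hq, Store.setArr]
      · have : regArr b q ≠ regArr b p := fun e => hq (regArr_inj e).2
        simp [Store.setArr, hq, this, h.arr]
    · have : regArr b q ≠ regArr a p := fun e => hb (regArr_inj e).1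
      simp [Store.setArr, hb, this, h.arr]
  input := h.input
  allLe := h.allLe.update _ (hv.trans (by have := le_regBound (ι := ι) (α := α) V; omega))
  bdd := h.bdd.setArr a p hv

/-- The code leads from the store `σ` to the store `σ'` in at most `u` time units. -/
def Runs (V : ℕ) (s : Code) (σ : Store ι α) (u : ℕ) (σ' : Store ι α) : Prop :=
  ∀ m, Rep V σ m → ∃ m', ExecB (regBound ι α V) u s m m' ∧ Rep V σ' m'

namespace Code

/-- Load the number `n`. -/
def loadC (n : ℤ) : Code := .instr (.load (.lit n) ())

variable (α) in
/-- Load a variable. -/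
noncomputable def loadV (x : ι) : Code := .instr (.load (.reg (regVar α x)) ())

variable (α) in
/-- Store the accumulator in a variable. -/
noncomputable def storeV (x : ι) : Code := .instr (.store (.reg (regVar α x)) ())

/-- Compute the address of the array cell whose index is the value of a variable. -/
noncomputable def address (a : α) (y : ι) : Code :=
  .seq (loadV α y) <| .seq (.instr (.mult (.lit 2) ())) <| .seq (.instr (.sub (.lit 1) ())) <|
  .seq (.instr (.mult (.reg (regVar α y)) ())) <|
  .seq (.instr (.mult (.lit (Fintype.card α + 1 : ℕ)) ())) <|
  .seq (.instr (.add (.lit (3 + Fintype.equivFin α a : ℕ)) ())) (.instr (.store (.reg 1) ()))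

variable (α) in
/-- `x := n` -/
noncomputable def const (x : ι) (n : ℤ) : Code := .seq (loadC n) (storeV α x)

variable (α) in
/-- `x := y + n` -/
noncomputable def addC (x y : ι) (n : ℤ) : Code :=
  .seq (loadV α y) <| .seq (.instr (.add (.lit n) ())) (storeV α x)

variable (α) in
/-- `x := x / 2` -/
noncomputable def halve (x : ι) : Code :=
  .seq (loadV α x) <| .seq (.instr (.div (.lit 2) ())) (storeV α x)

variable (α) in
/-- Read the next input number into a variable. -/
noncomputable def readV (x : ι) : Code := .instr (.read (.reg (regVar α x)) ())

/-- `x := a[y]` -/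
noncomputable def get (x : ι) (a : α) (y : ι) : Code :=
  .seq (address a y) <| .seq (.instr (.load (.ind 1) ())) (storeV α x)

/-- `a[y] := n` -/
noncomputable def putC (a : α) (y : ι) (n : ℤ) : Code :=
  .seq (address a y) <| .seq (loadC n) (.instr (.store (.ind 1) ()))

/-- `a[y] := x` -/
noncomputable def putV (a : α) (y x : ι) : Code :=
  .seq (address a y) <| .seq (loadV α x) (.instr (.store (.ind 1) ()))

variable (α) in
/-- `if x = n then s else t` -/
noncomputable def ifEq (x : ι) (n : ℤ) (s t : Code) : Code :=
  .seq (loadV α x) <| .seq (.instr (.sub (.lit n) ())) (.ifz s t)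

variable (α) in
/-- `if x is even then s else t` -/
noncomputable def ifEven (x : ι) (s t : Code) : Code :=
  .seq (loadV α x) <| .seq (.instr (.div (.lit 2) ())) <| .seq (.instr (.mult (.lit 2) ())) <|
  .seq (.instr (.sub (.reg (regVar α x)) ())) (.ifz s t)

variable (α) in
/-- `while x > 0 do s` -/
noncomputable def whilePos (x : ι) (s : Code) : Code :=
  .seq (loadV α x) (.loop (.seq s (loadV α x)))

end Code

open Code

theorem natAbs_le_regBound {v : ℤ} (h : v.natAbs ≤ 2 * V + 8) :
    v.natAbs ≤ regBound ι α V := h.trans (le_regBound V)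

/-- The new accumulator is bounded by `regBound` instead of `V`, since addresses exceed `V`. That
register `1` is kept matters when a value is loaded between computing an address and using it. -/
theorem Rep.acc (hm : Rep V σ m) {i : Instr Unit} (hi : i.IsBasic)
    (hl : i.Le (regBound ι α V)) {v : ℤ} (he : i.effect m = (Function.update m.1 0 v, m.2))
    (hv : v.natAbs ≤ regBound ι α V) :
    ∃ m', ExecB (regBound ι α V) 1 (.instr i) m m' ∧ Rep V σ m' ∧ m'.1 0 = v ∧
      m'.1 1 = m.1 1 :=
  ⟨_, ExecB.instr hi hl hm.allLe, he ▸ hm.update_aux (by omega) hv, by rw [he]; simp,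
    by rw [he]; simp⟩

theorem Rep.loadC (hm : Rep V σ m) {n : ℤ} (hn : n.natAbs ≤ V) :
    ∃ m', ExecB (regBound ι α V) 1 (Code.loadC n) m m' ∧ Rep V σ m' ∧ m'.1 0 = n ∧
      m'.1 1 = m.1 1 :=
  hm.acc (i := .load (.lit n) ()) trivial
    (show n.natAbs ≤ _ from natAbs_le_regBound (by omega)) rfl (natAbs_le_regBound (by omega))

theorem Rep.loadV (hm : Rep V σ m) (x : ι) :
    ∃ m', ExecB (regBound ι α V) 1 (Code.loadV α x) m m' ∧ Rep V σ m' ∧ m'.1 0 = σ.var x ∧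
      m'.1 1 = m.1 1 :=
  hm.acc (i := .load (.reg (regVar α x)) ()) trivial (regVar_le V x) (by rw [← hm.var x]; rfl)
    (natAbs_le_regBound (by have := hm.bdd.var x; omega))

theorem Rep.storeV (hm : Rep V σ m) (x : ι) (h0 : (m.1 0).natAbs ≤ V) :
    ∃ m', ExecB (regBound ι α V) 1 (Code.storeV α x) m m' ∧ Rep V (σ.setVar x (m.1 0)) m' :=
  ⟨_, ExecB.instr (i := .store (.reg (regVar α x)) ()) trivial (regVar_le V x) hm.allLe,
    hm.update_var x h0⟩

theorem Rep.storeArr (hm : Rep V σ m) (a : α) (p : ℤ) (h1 : m.1 1 = regArr a p)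
    (h0 : (m.1 0).natAbs ≤ V) :
    ∃ m', ExecB (regBound ι α V) 1 (.instr (.store (.ind 1) ())) m m' ∧
      Rep V (σ.setArr a p (m.1 0)) m' := by
  have hW := le_regBound (ι := ι) (α := α) V
  refine ⟨_, ExecB.instr (i := .store (.ind 1) ()) trivial (show 1 ≤ _ by omega) hm.allLe, ?_⟩
  have : (Instr.store (.ind 1) ()).effect m =
      (Function.update m.1 (regArr a p) (m.1 0), m.2) := by
    simp [Instr.effect, step, Instr.toProgram, Addr.target, h1]
  rw [this]
  exact hm.update_arr a p h0

theorem Rep.address (hm : Rep V σ m) (a : α) (y : ι) :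
    ∃ m', ExecB (regBound ι α V) 7 (Code.address a y) m m' ∧ Rep V σ m' ∧
      m'.1 1 = regArr a (σ.var y) := by
  have hy := hm.bdd.var y
  have hr := regArr_cast a (σ.var y)
  have hnn := mul_two_mul_sub_one_nonneg (σ.var y)
  generalize hp : σ.var y = p at hy hr hnn ⊢
  -- This estimate is the source of the quadratic term in `regBound`.
  have hpp : p * (2 * p - 1) ≤ 2 * V * V + V := by
    have h1 : |p| ≤ V := by rw [Int.abs_eq_natAbs]; exact_mod_cast hy
    have := abs_le.1 h1
    nlinarith
  have hD : ((Fintype.card α + 1 : ℕ) : ℤ) * (p * (2 * p - 1)) ≤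
      ((Fintype.card α + 1 : ℕ) : ℤ) * (Fintype.card ι + 2 * V * V + V + 3) :=
    mul_le_mul_of_nonneg_left (by linarith [Int.natCast_nonneg (Fintype.card ι)]) (by positivity)
  have hD0 : 0 ≤ ((Fintype.card α + 1 : ℕ) : ℤ) * (p * (2 * p - 1)) := by positivity
  -- The intermediate products are dominated by the final one, so a single bound serves all of them.
  have hD1 : p * (2 * p - 1) ≤ ((Fintype.card α + 1 : ℕ) : ℤ) * (p * (2 * p - 1)) :=
    le_mul_of_one_le_left hnn (by push_cast; linarith [Int.natCast_nonneg (Fintype.card α)])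
  have hia := (Fintype.equivFin α a).isLt
  have hB : (regBound ι α V : ℤ) = ((Fintype.card α + 1 : ℕ) : ℤ) *
      (Fintype.card ι + 2 * V * V + V + 3) + Fintype.card α + V + 5 := by
    unfold regBound; push_cast; ring
  have hW := le_regBound (ι := ι) (α := α) V
  obtain ⟨m1, e1, r1, h1, -⟩ := hm.loadV y
  rw [hp] at h1
  obtain ⟨m2, e2, r2, h2, -⟩ := r1.acc (i := .mult (.lit 2) ()) trivial
    (show (2 : ℤ).natAbs ≤ _ by omega) (v := m1.1 0 * 2) rfl (by rw [h1]; omega)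
  obtain ⟨m3, e3, r3, h3, -⟩ := r2.acc (i := .sub (.lit 1) ()) trivial
    (show (1 : ℤ).natAbs ≤ _ by omega) (v := m2.1 0 - 1) rfl (by rw [h2, h1]; omega)
  have h3' : m3.1 0 * m3.1 (regVar α y) = p * (2 * p - 1) := by
    rw [h3, h2, h1, r3.var, hp]; ring
  obtain ⟨m4, e4, r4, h4, -⟩ := r3.acc (i := .mult (.reg (regVar α y)) ()) trivial
    (regVar_le V y) (v := m3.1 0 * m3.1 (regVar α y)) rfl (by rw [h3']; omega)
  rw [h3'] at h4
  have h4' : m4.1 0 * (Fintype.card α + 1 : ℕ) =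
      (Fintype.card α + 1 : ℕ) * (p * (2 * p - 1)) := by rw [h4]; ring
  obtain ⟨m5, e5, r5, h5, -⟩ := r4.acc (i := .mult (.lit (Fintype.card α + 1 : ℕ)) ()) trivial
    (show ((Fintype.card α + 1 : ℕ) : ℤ).natAbs ≤ _ by
      unfold regBound; rw [Int.natAbs_natCast]; nlinarith)
    (v := m4.1 0 * (Fintype.card α + 1 : ℕ)) rfl (by rw [h4']; omega)
  rw [h4'] at h5
  obtain ⟨m6, e6, r6, h6, -⟩ := r5.acc (i := .add (.lit (3 + Fintype.equivFin α a : ℕ)) ())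
    trivial
    (show ((3 + Fintype.equivFin α a : ℕ) : ℤ).natAbs ≤ _ by
      rw [Int.natAbs_natCast]; unfold regBound; omega)
    (v := m5.1 0 + (3 + Fintype.equivFin α a : ℕ)) rfl (by rw [h5]; omega)
  rw [h5, ← hr] at h6
  refine ⟨(Function.update m6.1 1 (m6.1 0), m6.2),
    e1.seq (e2.seq (e3.seq (e4.seq (e5.seq (e6.seq (ExecB.instr
    (i := .store (.reg 1) ()) trivial (show 1 ≤ _ by omega) r6.allLe)))))),
    r6.update_aux (by omega) (r6.allLe.1 0), ?_⟩
  simp [h6]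

namespace Runs

variable {s t : Code} {σ' σ'' : Store ι α} {u u' : ℕ}

theorem seq (h : Runs V s σ u σ') (h' : Runs V t σ' u' σ'') :
    Runs V (.seq s t) σ (u + u') σ'' := by
  intro m hm
  obtain ⟨m', e, r⟩ := h m hm
  obtain ⟨m'', e', r'⟩ := h' m' r
  exact ⟨m'', e.seq e', r'⟩

theorem mono (h : Runs V s σ u σ') (hu : u ≤ u') : Runs V s σ u' σ' := by
  intro m hm
  obtain ⟨m', e, r⟩ := h m hm
  exact ⟨m', e.mono hu, r⟩

theorem of_eq (h : Runs V s σ u σ') (hu : u ≤ u') (hs : σ' = σ'') : Runs V s σ u' σ'' :=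
  hs ▸ h.mono hu

theorem const (x : ι) {n : ℤ} (hn : n.natAbs ≤ V) :
    Runs V (Code.const α x n) σ 2 (σ.setVar x n) := by
  intro m hm
  obtain ⟨m1, e1, r1, h1, -⟩ := hm.loadC hn
  obtain ⟨m2, e2, r2⟩ := r1.storeV x (by rwa [h1])
  exact ⟨m2, e1.seq e2, h1 ▸ r2⟩

theorem addC (x y : ι) {n : ℤ} (hn : n.natAbs ≤ V) (hv : (σ.var y + n).natAbs ≤ V) :
    Runs V (Code.addC α x y n) σ 3 (σ.setVar x (σ.var y + n)) := by
  intro m hm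
  obtain ⟨m1, e1, r1, h1, -⟩ := hm.loadV y
  rw [← h1] at hv ⊢
  obtain ⟨m2, e2, r2, h2, -⟩ := r1.acc (i := .add (.lit n) ()) trivial
    (show n.natAbs ≤ _ from natAbs_le_regBound (by omega)) (v := m1.1 0 + n) rfl
    (natAbs_le_regBound (by omega))
  obtain ⟨m3, e3, r3⟩ := r2.storeV x (by rwa [h2])
  exact ⟨m3, e1.seq (e2.seq e3), h2 ▸ r3⟩

theorem halve (x : ι) : Runs V (Code.halve α x) σ 3 (σ.setVar x (σ.var x / 2)) := by
  intro m hm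
  have hx := hm.bdd.var x
  obtain ⟨m1, e1, r1, h1, -⟩ := hm.loadV x
  rw [← h1] at hx ⊢
  obtain ⟨m2, e2, r2, h2, -⟩ := r1.acc (i := .div (.lit 2) ()) trivial
    (show (2 : ℤ).natAbs ≤ _ from natAbs_le_regBound (by omega)) (v := (m1.1 0).fdiv 2) rfl
    (natAbs_le_regBound (by rw [Int.fdiv_eq_ediv_of_nonneg _ (by norm_num)]; omega))
  rw [Int.fdiv_eq_ediv_of_nonneg _ (by norm_num)] at h2
  obtain ⟨m3, e3, r3⟩ := r2.storeV x (by omega)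
  exact ⟨m3, e1.seq (e2.seq e3), h2 ▸ r3⟩

theorem readV (x : ι) :
    Runs V (Code.readV α x) σ 1
      { σ.setVar x (σ.input.headD 0) with input := σ.input.tail } := by
  intro m hm
  refine ⟨_, ExecB.instr (i := .read (.reg (regVar α x)) ()) trivial (regVar_le V x) hm.allLe, ?_⟩
  have he : (Instr.read (.reg (regVar α x)) ()).effect m =
    (Function.update m.1 (regVar α x) (σ.input.headD 0), σ.input.tail) := by
    rw [← hm.input]; rfl
  rw [he]
  have hb : (σ.input.headD 0).natAbs ≤ V := by
    rcases hl : σ.input with _ | ⟨z, l⟩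
    · simp
    · simpa using hm.bdd.input z (by simp [hl])
  have r := hm.update_var x hb
  have hi : m.2.tail = σ.input.tail := by rw [hm.input]
  exact ⟨r.var, r.arr, rfl, ⟨r.allLe.1, fun z hz => r.allLe.2 z (by
    rw [← hi] at hz; exact List.mem_of_mem_tail hz)⟩,
    ⟨r.bdd.var, r.bdd.arr, fun z hz => hm.bdd.input z (List.mem_of_mem_tail hz)⟩⟩

theorem get (x : ι) (a : α) (y : ι) :
    Runs V (Code.get x a y) σ 9 (σ.setVar x (σ.arr a (σ.var y))) := by
  intro m hm
  obtain ⟨m1, e1, r1, h1⟩ := hm.address a y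
  have hb := hm.bdd.arr a (σ.var y)
  rw [← r1.arr] at hb ⊢
  obtain ⟨m2, e2, r2, h2, -⟩ := r1.acc (i := .load (.ind 1) ()) trivial
    (show 1 ≤ _ by have := le_regBound (ι := ι) (α := α) V; omega) (v := m1.1 (m1.1 1).toNat) rfl
    (r1.allLe.1 _)
  rw [h1, Int.toNat_natCast] at h2
  obtain ⟨m3, e3, r3⟩ := r2.storeV x (by rwa [h2])
  exact ⟨m3, e1.seq (e2.seq e3), h2 ▸ r3⟩

theorem putC (a : α) (y : ι) {n : ℤ} (hn : n.natAbs ≤ V) :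
    Runs V (Code.putC a y n) σ 9 (σ.setArr a (σ.var y) n) := by
  intro m hm
  obtain ⟨m1, e1, r1, h1⟩ := hm.address a y
  obtain ⟨m2, e2, r2, h2, h2'⟩ := r1.loadC hn
  obtain ⟨m3, e3, r3⟩ := r2.storeArr a (σ.var y) (h2'.trans h1) (by rwa [h2])
  exact ⟨m3, e1.seq (e2.seq e3), h2 ▸ r3⟩

theorem putV (a : α) (y x : ι) :
    Runs V (Code.putV a y x) σ 9 (σ.setArr a (σ.var y) (σ.var x)) := by
  intro m hm
  obtain ⟨m1, e1, r1, h1⟩ := hm.address a y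
  obtain ⟨m2, e2, r2, h2, h2'⟩ := r1.loadV x
  obtain ⟨m3, e3, r3⟩ := r2.storeArr a (σ.var y) (h2'.trans h1) (by rw [h2]; exact hm.bdd.var x)
  exact ⟨m3, e1.seq (e2.seq e3), h2 ▸ r3⟩

theorem ifEq_aux (hm : Rep V σ m) (x : ι) {n : ℤ} (hn : n.natAbs ≤ V) :
    ∃ m', (∀ s t k m'', ExecB (regBound ι α V) k (.ifz s t) m' m'' →
        ExecB (regBound ι α V) (k + 2) (Code.ifEq α x n s t) m m'') ∧
      Rep V σ m' ∧ m'.1 0 = σ.var x - n := by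
  have hb := hm.bdd.var x
  obtain ⟨m1, e1, r1, h1, -⟩ := hm.loadV x
  rw [← h1] at hb ⊢
  obtain ⟨m2, e2, r2, h2, -⟩ := r1.acc (i := .sub (.lit n) ()) trivial
    (show n.natAbs ≤ _ from natAbs_le_regBound (by omega)) (v := m1.1 0 - n) rfl
    (natAbs_le_regBound (by omega))
  exact ⟨m2, fun s t k m'' h => (e1.seq (e2.seq h)).mono (by omega), r2, h2⟩

theorem ifEq_pos {x : ι} {n : ℤ} (hn : n.natAbs ≤ V) (hx : σ.var x = n) (h : Runs V s σ u σ') :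
    Runs V (Code.ifEq α x n s t) σ (u + 3) σ' := by
  intro m hm
  obtain ⟨m1, e1, r1, h1⟩ := ifEq_aux hm x hn
  obtain ⟨m2, e2, r2⟩ := h _ r1
  exact ⟨m2, (e1 _ _ _ _ (e2.ifz_zero r1.allLe (by omega))).mono (by omega), r2⟩

theorem ifEq_neg {x : ι} {n : ℤ} (hn : n.natAbs ≤ V) (hx : σ.var x ≠ n) (h : Runs V t σ u σ') :
    Runs V (Code.ifEq α x n s t) σ (u + 3) σ' := by
  intro m hm
  obtain ⟨m1, e1, r1, h1⟩ := ifEq_aux hm x hn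
  obtain ⟨m2, e2, r2⟩ := h _ r1
  exact ⟨m2, (e1 _ _ _ _ (e2.ifz_ne r1.allLe (by omega))).mono (by omega), r2⟩

/-- The accumulator ends with `2⌊x/2⌋ - x`, which vanishes exactly for even `x`. -/
theorem ifEven_aux (hm : Rep V σ m) (x : ι) :
    ∃ m', (∀ s t k m'', ExecB (regBound ι α V) k (.ifz s t) m' m'' →
        ExecB (regBound ι α V) (k + 4) (Code.ifEven α x s t) m m'') ∧
      Rep V σ m' ∧ m'.1 0 = - (σ.var x % 2) := by
  have hb := hm.bdd.var x
  obtain ⟨m1, e1, r1, h1, -⟩ := hm.loadV x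
  obtain ⟨m2, e2, r2, h2, -⟩ := r1.acc (i := .div (.lit 2) ()) trivial
    (show (2 : ℤ).natAbs ≤ _ from natAbs_le_regBound (by omega)) (v := (m1.1 0).fdiv 2) rfl
    (natAbs_le_regBound (by rw [Int.fdiv_eq_ediv_of_nonneg _ (by norm_num)]; omega))
  rw [Int.fdiv_eq_ediv_of_nonneg _ (by norm_num)] at h2
  obtain ⟨m3, e3, r3, h3, -⟩ := r2.acc (i := .mult (.lit 2) ()) trivial
    (show (2 : ℤ).natAbs ≤ _ from natAbs_le_regBound (by omega)) (v := m2.1 0 * 2) rfl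
    (natAbs_le_regBound (by omega))
  have hx := r3.var x
  obtain ⟨m4, e4, r4, h4, -⟩ := r3.acc (i := .sub (.reg (regVar α x)) ()) trivial (regVar_le V x)
    (v := m3.1 0 - m3.1 (regVar α x)) rfl (natAbs_le_regBound (by omega))
  exact ⟨m4, fun s t k m'' h => (e1.seq (e2.seq (e3.seq (e4.seq h)))).mono (by omega), r4,
    by omega⟩

theorem ifEven_pos {x : ι} (hx : σ.var x % 2 = 0) (h : Runs V s σ u σ') :
    Runs V (Code.ifEven α x s t) σ (u + 5) σ' := by
  intro m hm
  obtain ⟨m1, e1, r1, h1⟩ := ifEven_aux hm x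
  obtain ⟨m2, e2, r2⟩ := h _ r1
  exact ⟨m2, (e1 _ _ _ _ (e2.ifz_zero r1.allLe (by omega))).mono (by omega), r2⟩

theorem ifEven_neg {x : ι} (hx : σ.var x % 2 ≠ 0) (h : Runs V t σ u σ') :
    Runs V (Code.ifEven α x s t) σ (u + 5) σ' := by
  intro m hm
  obtain ⟨m1, e1, r1, h1⟩ := ifEven_aux hm x
  obtain ⟨m2, e2, r2⟩ := h _ r1
  exact ⟨m2, (e1 _ _ _ _ (e2.ifz_ne r1.allLe (by omega))).mono (by omega), r2⟩

/-- `S j` is the store before pass `j`. Since the loop tests the accumulator, `x` is reloaded after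
each pass; load and test account for the `2` per pass and the `2` at the ends. The induction is on
the number of passes that remain. -/
theorem whilePos {x : ι} {n : ℕ} (S : ℕ → Store ι α)
    (hS : ∀ j < n, 0 < (S j).var x ∧ Runs V s (S j) u (S (j + 1))) (hn : (S n).var x ≤ 0) :
    Runs V (Code.whilePos α x s) (S 0) (n * (u + 2) + 2) (S n) := by
  have key : ∀ k, k ≤ n → ∀ m, Rep V (S (n - k)) m → m.1 0 = (S (n - k)).var x →
      ∃ m', ExecB (regBound ι α V) (k * (u + 2) + 1) (.loop (.seq s (Code.loadV α x))) m m' ∧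
        Rep V (S n) m' := by
    intro k
    induction k with
    | zero =>
      intro _ m hm h0
      exact ⟨m, (ExecB.loop_end hm.allLe (by rw [h0]; exact hn.not_gt)).mono (by omega), hm⟩
    | succ k ih =>
      intro hk m hm h0
      obtain ⟨hpos, hrun⟩ := hS (n - (k + 1)) (by omega)
      obtain ⟨m1, e1, r1⟩ := hrun m hm
      rw [show n - (k + 1) + 1 = n - k by omega] at r1
      obtain ⟨m2, e2, r2, h2, -⟩ := r1.loadV x
      obtain ⟨m3, e3, r3⟩ := ih (by omega) _ r2 h2
      exact ⟨m3, (ExecB.loop_step hm.allLe (by rwa [h0]) (e1.seq e2) e3).mono (by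
        rw [add_mul]; omega), r3⟩
  intro m hm
  obtain ⟨m1, e1, r1, h1, -⟩ := hm.loadV x
  obtain ⟨m2, e2, r2⟩ := key n le_rfl m1 (by simpa using r1) (by simpa using h1)
  exact ⟨m2, (e1.seq e2).mono (by omega), r2⟩

/-- A program that ends with the answer in the variable `x`. -/
theorem answersWithin {x : ι} {inp : List ℤ} (hinp : ∀ z ∈ inp, z.natAbs ≤ V)
    (h : Runs V s ⟨fun _ => 0, fun _ _ => 0, inp⟩ u σ') :
    AnswersWithin (Code.seq s (Code.loadV α x)).toProgram inp (decide (0 < σ'.var x))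
      ((u + 3) * (4 * size (regBound ι α V))) := by
  have hW := le_regBound (ι := ι) (α := α) V
  have r0 : Rep V (⟨fun _ => 0, fun _ _ => 0, inp⟩ : Store ι α) (fun _ => 0, inp) :=
    ⟨fun _ => rfl, fun _ _ => rfl, rfl, ⟨fun _ => by simp, fun z hz => (hinp z hz).trans (by omega)⟩,
      ⟨fun _ => by simp, fun _ _ => by simp, hinp⟩⟩
  obtain ⟨m1, e1, r1⟩ := h _ r0
  obtain ⟨m2, e2, r2, h2, -⟩ := r1.loadV x
  obtain ⟨c, e, hc⟩ := e1.seq e2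
  have ha := e.answersWithin
  rw [h2] at ha
  obtain ⟨t, ht, hsum⟩ := ha
  refine ⟨t, ht, hsum.trans ?_⟩
  -- Of the three additional units one pays for loading the answer; the other two cover the final
  -- jump and `halt`.
  have h1 : size (σ'.var x) ≤ size (regBound ι α V) :=
    size_mono (by simpa using natAbs_le_regBound (by have := r1.bdd.var x; omega))
  have h2 : 1 ≤ size (regBound ι α V) := by simp [size]
  nlinarith

end Runs

end Rep

end RAM

namespace RAM

/-! ### Loop invariants and case distinctions -/

section Control

variable {ι α : Type} [Fintype ι] [Fintype α] [DecidableEq ι] [DecidableEq α]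
variable {V : ℕ} {σ σ' : Store ι α} {s t : Code} {u : ℕ}

/-- For bodies whose resulting store is known only through an invariant: choosing a successor for
each store yields the sequence that `Runs.whilePos` needs. -/
theorem Runs.whilePos_exists {x : ι} (I : ℕ → Store ι α → Prop) {n : ℕ}
    (hI : ∀ j < n, ∀ τ, I j τ → 0 < τ.var x ∧ ∃ τ', Runs V s τ u τ' ∧ I (j + 1) τ')
    (hn : ∀ τ, I n τ → τ.var x ≤ 0) (h0 : I 0 σ) :
    ∃ σ', Runs V (Code.whilePos α x s) σ (n * (u + 2) + 2) σ' ∧ I n σ' := by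
  choose! f hf using fun j (hj : j < n) τ (h : I j τ) => (hI j hj τ h).2
  let S : ℕ → Store ι α := fun j => Nat.rec σ (fun j τ => f j τ) j
  have hS : ∀ j ≤ n, I j (S j) := by
    intro j
    induction j with
    | zero => exact fun _ => h0
    | succ j ih => exact fun hj => (hf j hj (S j) (ih (by omega))).2
  exact ⟨S n, Runs.whilePos (n := n) S (fun j hj => ⟨(hI j hj _ (hS j hj.le)).1,
    (hf j hj (S j) (hS j hj.le)).1⟩) (hn _ (hS n le_rfl)), hS n le_rfl⟩

namespace Code

/-- Do nothing. -/
def skip : Code := loadC 0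

/-- Execute `f i` for the members `i` of a list, the last one first. -/
def forList {κ : Type} (f : κ → Code) : List κ → Code
  | [] => skip
  | i :: l => .seq (forList f l) (f i)

variable (α) in
/-- Execute `s` if all conditions `x = n` in the list hold, and `t` otherwise. -/
noncomputable def guard (s t : Code) : List (ι × ℤ) → Code
  | [] => s
  | c :: l => ifEq α c.1 c.2 (guard s t l) t

variable (α) in
/-- Execute `f p` for the first `p` in the list whose conditions hold. -/
noncomputable def dispatch {κ : Type} (cond : κ → List (ι × ℤ)) (f : κ → Code) : List κ → Code
  | [] => skip
  | p :: l => guard α (f p) (dispatch cond f l) (cond p)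

end Code

theorem Runs.skip : Runs V Code.skip σ 1 σ := by
  intro m hm
  obtain ⟨m1, e1, r1, -, -⟩ := hm.loadC (n := 0) (by simp)
  exact ⟨m1, e1, r1⟩

theorem Runs.guard_pos (l : List (ι × ℤ)) (hV : ∀ c ∈ l, c.2.natAbs ≤ V)
    (hl : ∀ c ∈ l, σ.var c.1 = c.2) (h : Runs V s σ u σ') :
    Runs V (Code.guard α s t l) σ (u + 3 * l.length) σ' := by
  induction l with
  | nil => exact h
  | cons c l ih =>
    exact (Runs.ifEq_pos (hV c (by simp)) (hl c (by simp))
      (ih (fun c hc => hV c (by simp [hc])) fun c hc => hl c (by simp [hc]))).mono (by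
        simp only [List.length_cons]; omega)

theorem Runs.guard_neg (l : List (ι × ℤ)) (hV : ∀ c ∈ l, c.2.natAbs ≤ V)
    (hl : ∃ c ∈ l, σ.var c.1 ≠ c.2) (h : Runs V t σ u σ') :
    Runs V (Code.guard α s t l) σ (u + 3 * l.length) σ' := by
  induction l with
  | nil => simp at hl
  | cons c l ih =>
    by_cases hc : σ.var c.1 = c.2
    · have hl' : ∃ c ∈ l, σ.var c.1 ≠ c.2 := by
        obtain ⟨d, hd, hne⟩ := hl
        rcases List.mem_cons.1 hd with rfl | hd
        · exact absurd hc hne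
        · exact ⟨d, hd, hne⟩
      exact (Runs.ifEq_pos (hV c (by simp)) hc
        (ih (fun c hc => hV c (by simp [hc])) hl')).mono (by simp only [List.length_cons]; omega)
    · exact (Runs.ifEq_neg (hV c (by simp)) hc h).mono (by simp only [List.length_cons]; omega)

/-- All guards but that of `p` fail, and each guard passed costs at most `3 * d` units. For a fixed
list this is a constant. -/
theorem Runs.dispatch {κ : Type} {cond : κ → List (ι × ℤ)} {f : κ → Code} {p : κ} {d : ℕ}
    (l : List κ) (hp : p ∈ l) (hd : ∀ p ∈ l, (cond p).length ≤ d)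
    (hV : ∀ p ∈ l, ∀ c ∈ cond p, c.2.natAbs ≤ V) (hpos : ∀ c ∈ cond p, σ.var c.1 = c.2)
    (hneg : ∀ p' ∈ l, p' ≠ p → ∃ c ∈ cond p', σ.var c.1 ≠ c.2) (h : Runs V (f p) σ u σ') :
    Runs V (Code.dispatch α cond f l) σ (u + 3 * d * l.length) σ' := by
  induction l with
  | nil => simp at hp
  | cons q l ih =>
    have hdq := hd q (by simp)
    have hlen : 3 * d * (q :: l).length = 3 * d * l.length + 3 * d := by
      simp only [List.length_cons]; ring
    rw [hlen]
    by_cases hq : q = p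
    · subst hq
      exact (Runs.guard_pos _ (hV q (by simp)) hpos h).mono (by omega)
    · have hp' : p ∈ l := (List.mem_cons.1 hp).resolve_left (Ne.symm hq)
      exact (Runs.guard_neg _ (hV q (by simp)) (hneg q (by simp) hq)
        (ih hp' (fun p h => hd p (by simp [h])) (fun p h => hV p (by simp [h]))
          fun p h => hneg p (by simp [h]))).mono (by omega)

end Control

/-! ## Simulation of a Turing machine -/

/-- Variables of the program that generates the input of a Turing machine with `K` tapes and
simulates it. -/
inductive Var (K : ℕ) where
  | n | i | j | k | r | a | b | c | t | ptr | state | run | ans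
  | head (i : Fin K)
  | scan (i : Fin K)
  deriving DecidableEq, Fintype

end RAM

namespace MultiTapeTM

open RAM

variable (M : MultiTapeTM)

/-- The stores for the simulation of `M`: array `some i` is tape `i`. -/
abbrev SimStore : Type := Store (Var (M.k + 2)) (Option (Fin (M.k + 2)))

open Classical in
/-- The code of a tape symbol. -/
noncomputable def symCode (γ : M.Γ) : ℤ :=
  if γ = M.sym none then 0 else
    have := M.finΓ
    ((Finite.equivFin M.Γ γ : ℕ) : ℤ) + 1

/-- The code of a state. -/
noncomputable def stateCode (q : M.Q) : ℤ :=
  have := M.finQ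
  ((Finite.equivFin M.Q q : ℕ) : ℤ)

/-- The blank has code `0` so that registers never written to already represent blank cells. -/
theorem symCode_blank : M.symCode (M.sym none) = 0 := by simp [symCode]

theorem symCode_injective : Function.Injective M.symCode := by
  intro γ γ' h
  have := M.finΓ
  unfold symCode at h
  split_ifs at h with h1 h2 h2
  · rw [h1, h2]
  · simp only at h; omega
  · simp only at h; omega
  · exact (Finite.equivFin M.Γ).injective (Fin.ext (by simp only at h; omega))

theorem stateCode_injective : Function.Injective M.stateCode := by
  intro q q' h
  have := M.finQ
  exact (Finite.equivFin M.Q).injective (Fin.ext (by simp only [stateCode] at h; omega))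

/-- A bound for the codes of symbols and states. -/
noncomputable def codeBound : ℕ := Nat.card M.Γ + Nat.card M.Q + 1

theorem symCode_le (γ : M.Γ) : (M.symCode γ).natAbs ≤ M.codeBound := by
  have := M.finΓ
  unfold symCode codeBound
  split_ifs
  · simp
  · have := (Finite.equivFin M.Γ γ).isLt
    simp only
    omega

theorem stateCode_le (q : M.Q) : (M.stateCode q).natAbs ≤ M.codeBound := by
  have := M.finQ
  unfold stateCode codeBound
  have := (Finite.equivFin M.Q q).isLt
  simp only
  omega

/-- All pairs of a state and scanned symbols. -/
noncomputable def situations : List (M.Q × (Fin (M.k + 2) → M.Γ)) :=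
  have := M.finQ
  have := M.finΓ
  have := Fintype.ofFinite (M.Q × (Fin (M.k + 2) → M.Γ))
  Finset.univ.toList

theorem mem_situations (p) : p ∈ M.situations := by simp [situations]

/-- Read the scanned symbols. -/
noncomputable def scanCode : List (Fin (M.k + 2)) → Code :=
  Code.forList fun i => Code.get (Var.scan i) (some i) (Var.head i)

/-- Write symbols and move the heads. -/
noncomputable def writeCode (a : Fin (M.k + 2) → M.Γ) (m : Fin (M.k + 2) → Move) :
    List (Fin (M.k + 2)) → Code :=
  Code.forList fun i => .seq (Code.putC (some i) (Var.head i) (M.symCode (a i)))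
    (Code.addC (Option (Fin (M.k + 2))) (Var.head i) (Var.head i) (m i).shift)

/-- The conditions for a state and scanned symbols. -/
noncomputable def situationCond (p : M.Q × (Fin (M.k + 2) → M.Γ)) :
    List (Var (M.k + 2) × ℤ) :=
  (Var.state, M.stateCode p.1) :: (List.finRange (M.k + 2)).map fun i => (Var.scan i, M.symCode (p.2 i))

/-- What to do in a state with scanned symbols. -/
noncomputable def situationCode (p : M.Q × (Fin (M.k + 2) → M.Γ)) : Code :=
  match M.tr p.1 p.2 with
  | none => .seq (Code.const (Option (Fin (M.k + 2))) (Var.run : Var (M.k + 2)) 0)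
      (Code.const (Option (Fin (M.k + 2))) (Var.ans : Var (M.k + 2)) (if M.acc p.1 then 1 else 0))
  | some (q, a, m) => .seq (M.writeCode a m (List.finRange (M.k + 2)))
      (Code.const (Option (Fin (M.k + 2))) (Var.state : Var (M.k + 2)) (M.stateCode q))

/-- The simulation of one step. -/
noncomputable def stepCode : Code :=
  .seq (M.scanCode (List.finRange (M.k + 2)))
    (Code.dispatch (Option (Fin (M.k + 2))) M.situationCond M.situationCode M.situations)

/-- The simulation of a run. -/
noncomputable def simCode : Code :=
  .seq (Code.const (Option (Fin (M.k + 2))) (Var.state : Var (M.k + 2)) (M.stateCode M.start)) <|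
  .seq (Code.const (Option (Fin (M.k + 2))) (Var.run : Var (M.k + 2)) 1)
    (Code.whilePos (Option (Fin (M.k + 2))) (Var.run : Var (M.k + 2)) M.stepCode)

/-- The time for the simulation of one step. -/
noncomputable def stepTime : ℕ :=
  9 * (M.k + 2) + 1 + (12 * (M.k + 2) + 5 + 3 * (M.k + 3) * M.situations.length)

variable {M} {V : ℕ}

theorem runs_scanCode (σ : M.SimStore) (l : List (Fin (M.k + 2))) :
    ∃ σ' : M.SimStore, Runs V (M.scanCode l) σ (9 * l.length + 1) σ' ∧ σ'.arr = σ.arr ∧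
      (∀ x, (∀ i, x ≠ Var.scan i) → σ'.var x = σ.var x) ∧
      ∀ i ∈ l, σ'.var (Var.scan i) = σ.arr (some i) (σ.var (Var.head i)) := by
  induction l with
  | nil => exact ⟨σ, Runs.skip, rfl, fun _ _ => rfl, by simp⟩
  | cons i l ih =>
    obtain ⟨σ', h, ha, hv, hs⟩ := ih
    have hrun : Runs V (M.scanCode (i :: l)) σ _ _ :=
      h.seq (Runs.get (Var.scan i) (some i) (Var.head i))
    refine ⟨_, hrun.mono (by simp only [List.length_cons]; omega), ha, fun x hx => ?_, fun i' hi' => ?_⟩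
    · simp [Store.setVar, Function.update_of_ne (hx i), hv x hx]
    · by_cases e : i' = i
      · subst e
        simp [Store.setVar, ha, hv]
      · simpa [Store.setVar, e] using hs i' ((List.mem_cons.1 hi').resolve_left e)

/-- No index may repeat, since the commands for a tape move its head. The slack of `1` in the bound
on head positions pays for this move. -/
theorem runs_writeCode (a : Fin (M.k + 2) → M.Γ) (m : Fin (M.k + 2) → Move) (σ : M.SimStore)
    (hV : M.codeBound ≤ V) (hσ : ∀ i, (σ.var (Var.head i)).natAbs + 1 ≤ V)
    (l : List (Fin (M.k + 2))) (hl : l.Nodup) :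
    ∃ σ' : M.SimStore, Runs V (M.writeCode a m l) σ (12 * l.length + 1) σ' ∧
      (∀ x, (∀ i, x ≠ Var.head i) → σ'.var x = σ.var x) ∧
      (∀ i ∈ l, σ'.var (Var.head i) = σ.var (Var.head i) + (m i).shift ∧
        σ'.arr (some i) =
          Function.update (σ.arr (some i)) (σ.var (Var.head i)) (M.symCode (a i))) ∧
      ∀ i ∉ l, σ'.var (Var.head i) = σ.var (Var.head i) ∧ σ'.arr (some i) = σ.arr (some i) := by
  induction l with
  | nil => exact ⟨σ, Runs.skip, fun _ _ => rfl, by simp, fun _ _ => ⟨rfl, rfl⟩⟩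
  | cons i l ih =>
    obtain ⟨hi, hl⟩ := List.nodup_cons.1 hl
    obtain ⟨σ', h, hv, hin, hout⟩ := ih hl
    obtain ⟨hh, ha⟩ := hout i hi
    have hs : (m i).shift.natAbs ≤ 1 := by cases m i <;> simp [Move.shift]
    have hsi := hσ i
    have hrun : Runs V (M.writeCode a m (i :: l)) σ _ _ :=
      h.seq ((Runs.putC (some i) (Var.head i) (n := M.symCode (a i))
        ((M.symCode_le _).trans hV)).seq (Runs.addC (Var.head i) (Var.head i) (n := (m i).shift)
          (by omega) (by simp only [Store.setArr, hh]; omega)))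
    refine ⟨_, hrun.mono (by simp only [List.length_cons]; omega), fun x hx => ?_, fun i' hi' => ?_, fun i' hi' => ?_⟩
    · simp [Store.setVar, Store.setArr, Function.update_of_ne (hx i), hv x hx]
    · by_cases e : i' = i
      · subst e
        simp [Store.setVar, Store.setArr, hh, ha]
      · have := hin i' ((List.mem_cons.1 hi').resolve_left e)
        simp [Store.setVar, Store.setArr, e, this]
    · have e : i' ≠ i := fun e => hi' (by simp [e])
      have := hout i' fun h => hi' (by simp [h])
      simp [Store.setVar, Store.setArr, e, this]

/-- The store represents the configuration. -/
structure Sim (σ : M.SimStore) (c : M.Cfg) : Prop where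
  state : σ.var Var.state = M.stateCode c.state
  head : ∀ i, σ.var (Var.head i) = c.head i
  tape : ∀ i p, σ.arr (some i) p = M.symCode (c.tape i p)

/-- After scanning, the codes of state and symbols match exactly one situation. A halting situation
is itself simulated by a pass, which clears `run` and records the answer. -/
theorem Sim.runs_stepCode {σ : M.SimStore} {c : M.Cfg} (h : Sim σ c) (hV : M.codeBound ≤ V)
    (hc : ∀ i, (c.head i).natAbs + 1 ≤ V) :
    ∃ σ' : M.SimStore, Runs V M.stepCode σ M.stepTime σ' ∧
      (M.Halted c → σ'.var Var.run = 0 ∧ (0 < σ'.var Var.ans ↔ M.acc c.state = true)) ∧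
      (¬ M.Halted c → σ'.var Var.run = σ.var Var.run ∧ Sim σ' (M.step c)) := by
  obtain ⟨σ₁, h₁, ha₁, hv₁, hs₁⟩ := runs_scanCode (V := V) σ (List.finRange (M.k + 2))
  let p : M.Q × (Fin (M.k + 2) → M.Γ) := (c.state, fun i => c.tape i (c.head i))
  have hscan : ∀ i, σ₁.var (Var.scan i) = M.symCode (p.2 i) := fun i => by
    rw [hs₁ i (by simp), h.head, h.tape]
  have hstate : σ₁.var Var.state = M.stateCode p.1 := by rw [hv₁ _ (by simp), h.state]
  suffices hsuff : ∃ σ' : M.SimStore,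
      Runs V (M.situationCode p) σ₁ (12 * (M.k + 2) + 5) σ' ∧
      (M.Halted c → σ'.var Var.run = 0 ∧ (0 < σ'.var Var.ans ↔ M.acc c.state = true)) ∧
      (¬ M.Halted c → σ'.var Var.run = σ.var Var.run ∧ Sim σ' (M.step c)) by
    obtain ⟨σ', h', hpost⟩ := hsuff
    refine ⟨σ', (h₁.seq (Runs.dispatch (p := p) (d := M.k + 3) M.situations (M.mem_situations p)
      ?_ ?_ ?_ ?_ h')).mono ?_, hpost⟩
    · intro p _
      simp [situationCond]
    · intro p' _ c' hc'
      simp only [situationCond, List.mem_cons, List.mem_map] at hc'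
      rcases hc' with rfl | ⟨i, -, rfl⟩
      · exact (M.stateCode_le _).trans hV
      · exact (M.symCode_le _).trans hV
    · intro c' hc'
      simp only [situationCond, List.mem_cons, List.mem_map] at hc'
      rcases hc' with rfl | ⟨i, -, rfl⟩
      · exact hstate
      · exact hscan i
    · intro p' _ hne
      -- If all conditions of `p'` held, its codes would equal those of `p`, and injectivity of the
      -- codes would give `p' = p`.
      by_contra! hall
      refine hne (Prod.ext (M.stateCode_injective ?_) (funext fun i => M.symCode_injective ?_))
      · exact (hall (Var.state, M.stateCode p'.1) (by simp [situationCond])).symm.trans hstate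
      · exact (hall (Var.scan i, M.symCode (p'.2 i)) (by simp [situationCond])).symm.trans (hscan i)
    · simp [stepTime]
  have hnext : M.tr p.1 p.2 = M.next c := rfl
  unfold situationCode
  rw [hnext]
  rcases hn : M.next c with _ | ⟨q, a, mv⟩
  · have hb : ((if M.acc p.1 then 1 else 0 : ℤ)).natAbs ≤ V := by
      have : 1 ≤ V := le_trans (by unfold codeBound; omega) hV
      split_ifs <;> simp [this]
    refine ⟨_, ((Runs.const Var.run (n := 0) (by simp)).seq (Runs.const Var.ans hb)).mono (by omega),
      fun _ => ⟨by simp [Store.setVar], ?_⟩, fun h => absurd hn h⟩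
    simp only [Store.setVar, Function.update_self, p]
    split_ifs with hacc <;> simp [hacc]
  · have hhead : ∀ i, σ₁.var (Var.head i) = c.head i := fun i => by rw [hv₁ _ (by simp), h.head]
    obtain ⟨σ₂, h₂, hv₂, hin, -⟩ := runs_writeCode a mv σ₁ hV
      (fun i => by rw [hhead]; exact hc i) _ (List.nodup_finRange (M.k + 2))
    refine ⟨_, (h₂.seq (Runs.const Var.state ((M.stateCode_le q).trans hV))).mono (by simp),
      fun h => absurd (hn.symm.trans h) (by simp), fun _ => ⟨?_, ⟨?_, fun i => ?_, fun i p => ?_⟩⟩⟩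
    · simp [Store.setVar, hv₂, hv₁]
    · simp [Store.setVar, step, hn]
    · simp [Store.setVar, step, hn, (hin i (by simp)).1, hhead]
    · simp only [Store.setVar, step, hn, (hin i (by simp)).2, hhead, ha₁]
      simp only [Function.update_apply]
      split_ifs
      · rfl
      · exact h.tape i p

/-- Head positions serve as array indices, so this bounds the register numbers used in the
simulation. -/
theorem natAbs_head_iterate_le (x w : List Bool) (t : ℕ) (i : Fin (M.k + 2)) :
    ((M.step^[t] (M.init x w)).head i).natAbs ≤ t := by
  induction t with
  | zero => simp [init]
  | succ t ih =>
    rw [Function.iterate_succ_apply']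
    generalize M.step^[t] (M.init x w) = c at *
    unfold step
    rcases M.next c with _ | ⟨q, a, mv⟩
    · exact ih.trans (by omega)
    · have : (mv i).shift.natAbs ≤ 1 := by cases mv i <;> simp [Move.shift]
      simp only
      omega

theorem runs_simCode {x : List Bool} {T : ℕ} (hT : M.HaltsWithin x [] T)
    (hV : M.codeBound + T + 1 ≤ V) {σ : M.SimStore} (hhead : ∀ i, σ.var (Var.head i) = 0)
    (htape : ∀ i p, σ.arr (some i) p = M.symCode ((M.init x []).tape i p)) :
    ∃ σ' : M.SimStore, Runs V M.simCode σ ((T + 1) * (M.stepTime + 2) + 6) σ' ∧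
      (0 < σ'.var Var.ans ↔ M.Accepts x []) := by
  classical
  have hex : ∃ t, M.Halted (M.step^[t] (M.init x [])) := ⟨T, hT⟩
  -- With `N` the exact halting time, the loop makes `N` passes that simulate steps and one more
  -- that notices the halt.
  set N := Nat.find hex with hN
  have hNT : N ≤ T := Nat.find_min' hex hT
  have hhalt : M.HaltsWithin x [] N := Nat.find_spec hex
  have hlt : ∀ j < N, ¬ M.Halted (M.step^[j] (M.init x [])) := fun j hj => Nat.find_min hex hj
  have hq : (M.stateCode M.start).natAbs ≤ V := (M.stateCode_le _).trans (by omega)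
  -- Up to pass `N` the store represents the current configuration; after pass `N + 1` only the
  -- answer matters.
  let I : ℕ → M.SimStore → Prop := fun j τ =>
    (j ≤ N → τ.var Var.run = 1 ∧ Sim τ (M.step^[j] (M.init x []))) ∧
    (j = N + 1 → τ.var Var.run = 0 ∧ (0 < τ.var Var.ans ↔ M.Accepts x []))
  have h1 : Runs V (Code.const _ Var.state (M.stateCode M.start)) σ 2 _ := Runs.const _ hq
  have h2 : Runs V (Code.const _ Var.run 1) (σ.setVar Var.state (M.stateCode M.start)) 2 _ :=
    Runs.const _ (n := 1) (by simp; omega)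
  have hloop : ∃ σ' : M.SimStore, Runs V
      (Code.whilePos (Option (Fin (M.k + 2))) (Var.run : Var (M.k + 2)) M.stepCode)
      ((σ.setVar Var.state (M.stateCode M.start)).setVar Var.run 1)
      ((N + 1) * (M.stepTime + 2) + 2) σ' ∧ I (N + 1) σ' := by
    refine Runs.whilePos_exists I ?_ (fun τ hτ => (hτ.2 rfl).1.le) ?_
    · intro j hj τ hτ
      obtain ⟨hrun, hsim⟩ := hτ.1 (by omega)
      obtain ⟨τ', hr, hh, hnh⟩ := hsim.runs_stepCode (V := V) (by omega) fun i => by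
        have := natAbs_head_iterate_le (M := M) x [] j i
        omega
      refine ⟨by omega, τ', hr, fun hj' => ?_, fun hj' => ?_⟩
      · obtain ⟨h1, h2⟩ := hnh (hlt j (by omega))
        rw [Function.iterate_succ_apply']
        exact ⟨h1.trans hrun, h2⟩
      · obtain rfl : j = N := by omega
        obtain ⟨h1, h2⟩ := hh hhalt
        exact ⟨h1, h2.trans (accepts_iff hhalt).symm⟩
    · refine ⟨fun _ => ⟨by simp [Store.setVar], ⟨?_, fun i => ?_, fun i p => ?_⟩⟩, by omega⟩
      · simp [Store.setVar, init]
      · simp [Store.setVar, init, hhead]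
      · exact htape i p
  obtain ⟨σ', h3, hI⟩ := hloop
  refine ⟨σ', (h1.seq (h2.seq h3)).mono ?_, (hI.2 rfl).2⟩
  have : (N + 1) * (M.stepTime + 2) ≤ (T + 1) * (M.stepTime + 2) :=
    Nat.mul_le_mul_right _ (by omega)
  omega

end MultiTapeTM

/-! ## Generation of the instructions for a graph -/

namespace MultiTapeTM

open RAM

/-- The integer that stands for a bit. -/
def bitVal (b : Bool) : ℤ := if b then 1 else 0

/-- The values of the variables during the generation; `m` entries of the matrix have been read, and
`out` has been written to the input tape. -/
@[ext]
structure Gen where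
  (n i j k r a b c t m : ℕ)
  out : List Bool

namespace Gen

/-- Output of further instructions. -/
def emit (g : Gen) (l : List Op) : Gen := { g with out := g.out ++ Op.encList l }

theorem emit_emit (g : Gen) (l l' : List Op) : (g.emit l).emit l' = g.emit (l ++ l') := by
  simp [emit, Op.encList_append]

variable (M : MultiTapeTM) (B : ℕ → Bool) (s : ℕ)

/-- The store during the generation; the matrix consists of the first `s` values of `B`. -/
noncomputable def store (g : Gen) : M.SimStore where
  var := fun x => match x with
    | .n => g.n
    | .i => g.i
    | .j => g.j
    | .k => g.k
    | .r => g.r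
    | .a => g.a
    | .b => g.b
    | .c => g.c
    | .t => g.t
    | .ptr => g.out.length
    | _ => 0
  arr := fun a p => match a with
    | none => if 0 ≤ p ∧ p < g.m then bitVal (B p.toNat) else 0
    | some i => M.symCode (M.wordTape (if i = 0 then g.out else []) p)
  input := ((List.range s).map fun q => bitVal (B q)).drop g.m

variable {M B s} {V : ℕ} {g g' : Gen}

/-- This lemma and its seven companions turn assignments into updates of a `Gen` record, so that the
generating code can be followed on records. -/
theorem setVar_i (g : Gen) (v : ℕ) :
    (g.store M B s).setVar Var.i v = ({ g with i := v } : Gen).store M B s :=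
  Store.ext (funext fun x => by cases x <;> simp [Store.setVar, store]) rfl rfl

theorem setVar_j (g : Gen) (v : ℕ) :
    (g.store M B s).setVar Var.j v = ({ g with j := v } : Gen).store M B s :=
  Store.ext (funext fun x => by cases x <;> simp [Store.setVar, store]) rfl rfl

theorem setVar_k (g : Gen) (v : ℕ) :
    (g.store M B s).setVar Var.k v = ({ g with k := v } : Gen).store M B s :=
  Store.ext (funext fun x => by cases x <;> simp [Store.setVar, store]) rfl rfl

theorem setVar_r (g : Gen) (v : ℕ) :
    (g.store M B s).setVar Var.r v = ({ g with r := v } : Gen).store M B s :=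
  Store.ext (funext fun x => by cases x <;> simp [Store.setVar, store]) rfl rfl

theorem setVar_a (g : Gen) (v : ℕ) :
    (g.store M B s).setVar Var.a v = ({ g with a := v } : Gen).store M B s :=
  Store.ext (funext fun x => by cases x <;> simp [Store.setVar, store]) rfl rfl

theorem setVar_b (g : Gen) (v : ℕ) :
    (g.store M B s).setVar Var.b v = ({ g with b := v } : Gen).store M B s :=
  Store.ext (funext fun x => by cases x <;> simp [Store.setVar, store]) rfl rfl

theorem setVar_c (g : Gen) (v : ℕ) :
    (g.store M B s).setVar Var.c v = ({ g with c := v } : Gen).store M B s :=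
  Store.ext (funext fun x => by cases x <;> simp [Store.setVar, store]) rfl rfl

theorem setVar_t (g : Gen) (v : ℕ) :
    (g.store M B s).setVar Var.t v = ({ g with t := v } : Gen).store M B s :=
  Store.ext (funext fun x => by cases x <;> simp [Store.setVar, store]) rfl rfl

/-- Execution between stores of the generation. -/
abbrev Runs' (M : MultiTapeTM) (B : ℕ → Bool) (s V : ℕ) (c : Code) (g : Gen) (u : ℕ)
    (g' : Gen) : Prop :=
  Runs V c (g.store M B s) u (g'.store M B s)

theorem runs_addC (x y : Var (M.k + 2)) (z : ℤ) (v : ℕ) (hz : z.natAbs ≤ V)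
    (hv : (g.store M B s).var y + z = v) (hV : v ≤ V)
    (hg : (g.store M B s).setVar x v = g'.store M B s) :
    Runs' M B s V (Code.addC (Option (Fin (M.k + 2))) x y z) g 3 g' :=
  (Runs.addC x y hz (by rw [hv]; simpa using hV)).of_eq le_rfl (by rw [hv, hg])

theorem runs_const (x : Var (M.k + 2)) (v : ℕ) (hV : v ≤ V)
    (hg : (g.store M B s).setVar x v = g'.store M B s) :
    Runs' M B s V (Code.const (Option (Fin (M.k + 2))) x v) g 2 g' :=
  (Runs.const x (by simpa using hV)).of_eq le_rfl hg

theorem runs_halve (x : Var (M.k + 2)) (v : ℕ) (hv : (g.store M B s).var x = v)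
    (hg : (g.store M B s).setVar x (v / 2 : ℕ) = g'.store M B s) :
    Runs' M B s V (Code.halve (Option (Fin (M.k + 2))) x) g 3 g' :=
  (Runs.halve x).of_eq le_rfl (by rw [hv, ← hg]; simp)

theorem runs_while {x : Var (M.k + 2)} {c : Code} {u u' n : ℕ} (G : ℕ → Gen)
    (hG : ∀ j < n, 0 < ((G j).store M B s).var x ∧ Runs' M B s V c (G j) u (G (j + 1)))
    (hn : ((G n).store M B s).var x = 0) (h0 : G 0 = g) (h1 : G n = g')
    (hu : n * (u + 2) + 2 ≤ u') :
    Runs' M B s V (Code.whilePos (Option (Fin (M.k + 2))) x c) g u' g' := by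
  subst h0 h1
  exact (Runs.whilePos (n := n) (fun j => (G j).store M B s) hG hn.le).mono hu

variable (M) in
/-- Write a bit to the input tape. -/
noncomputable def emitBit (b : Bool) : Code :=
  .seq (Code.putC (some (0 : Fin (M.k + 2))) (Var.ptr : Var (M.k + 2)) (M.symCode (M.sym (some b))))
    (Code.addC (Option (Fin (M.k + 2))) (Var.ptr : Var (M.k + 2)) Var.ptr 1)

variable (M) in
/-- Write a list of bits to the input tape. -/
noncomputable def emitBits : List Bool → Code
  | [] => Code.skip
  | b :: l => .seq (emitBit M b) (emitBits l)

variable (M) in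
/-- Write an instruction to the input tape. -/
noncomputable def emitOp (o : Op) : Code := emitBits M o.enc

theorem runs_emitBit (b : Bool) (hV : M.codeBound ≤ V) (hg : g.out.length + 1 ≤ V) :
    Runs' M B s V (emitBit M b) g 12 { g with out := g.out ++ [b] } := by
  refine ((Runs.putC (some 0) Var.ptr ((M.symCode_le _).trans hV)).seq
    (Runs.addC Var.ptr Var.ptr (n := 1) (by simp; omega) ?_)).of_eq le_rfl ?_
  · simp only [Store.setArr, store]
    omega
  · refine Store.ext (funext fun x => ?_) (funext fun a => funext fun p => ?_) rfl
    · cases x <;> simp [Store.setVar, Store.setArr, store]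
    · rcases a with _ | i
      · simp [Store.setVar, Store.setArr, store]
      · by_cases hi : i = 0
        · subst hi
          simp only [Store.setVar, Store.setArr, store, Function.update_self, if_true,
            Function.update_apply]
          split_ifs with hp
          · subst hp
            simp [wordTape]
          -- Away from the cell at `ptr` the longer word has the same letters as the old one; beyond
          -- its end both tapes are blank.
          · congr 1
            unfold wordTape
            congr 1
            split_ifs with h0
            · rw [List.getElem?_append]
              split_ifs with hlt
              · rfl
              · rw [List.getElem?_eq_none (by omega), List.getElem?_eq_none (by simp; omega)]
            · rfl
        · simp [Store.setVar, Store.setArr, store, hi]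

theorem runs_emitBits (l : List Bool) (hV : M.codeBound ≤ V) (hg : g.out.length + l.length ≤ V) :
    Runs' M B s V (emitBits M l) g (12 * l.length + 1) { g with out := g.out ++ l } := by
  induction l generalizing g with
  | nil => rw [List.append_nil]; exact Runs.skip
  | cons b l ih =>
    simp only [List.length_cons] at hg
    refine ((runs_emitBit b hV (by omega)).seq (ih (by simp; omega))).of_eq
      (by simp only [List.length_cons]; omega) (by simp)

theorem runs_emitOp (o : Op) (hV : M.codeBound ≤ V) (hg : g.out.length + 3 ≤ V) :
    Runs' M B s V (emitOp M o) g 37 (g.emit [o]) := by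
  have h3 : o.enc.length = 3 := by obtain ⟨a, b, c, h, -⟩ := o.exists_enc; simp [h]
  refine (runs_emitBits o.enc hV (by omega)).of_eq (by omega) ?_
  simp [emit, Op.encList]

theorem length_out_emit (g : Gen) (l : List Op) :
    (g.emit l).out.length = g.out.length + 3 * l.length := by
  simp [emit, Op.length_encList]

variable (M) in
/-- Write as many copies of an instruction as the variable `c` tells. -/
noncomputable def drain (o : Op) : Code :=
  Code.whilePos (Option (Fin (M.k + 2))) (Var.c : Var (M.k + 2)) <|
    .seq (emitOp M o) (Code.addC (Option (Fin (M.k + 2))) (Var.c : Var (M.k + 2)) Var.c (-1))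

theorem runs_drain (o : Op) (hV : M.codeBound ≤ V) (hg : g.out.length + 3 * g.c ≤ V)
    (hc : g.c ≤ V) :
    Runs' M B s V (drain M o) g (42 * g.c + 2)
      (({ g with c := 0 } : Gen).emit (List.replicate g.c o)) := by
  refine runs_while (u := 40) (n := g.c)
    (fun j => ({ g with c := g.c - j } : Gen).emit (List.replicate j o)) (fun j hj => ⟨?_, ?_⟩)
    ?_ ?_ ?_ ?_
  · simp only [store, emit]; omega
  · have hlen := length_out_emit ({ g with c := g.c - j } : Gen) (List.replicate j o)
    rw [List.length_replicate] at hlen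
    refine (runs_emitOp o hV (by rw [hlen]; simp only; omega)).seq
      (runs_addC (v := g.c - (j + 1)) Var.c Var.c (-1) (by simp; omega) ?_ (by omega) ?_)
    · simp only [store, emit]; omega
    · rw [setVar_c, emit_emit, ← List.replicate_succ']
      rfl
  · simp [store, emit]
  · simp [emit, Op.encList]
  · simp
  · omega

variable (M) in
/-- Write as many copies of an instruction as the variable `x` tells. -/
noncomputable def repeatOp (x : Var (M.k + 2)) (o : Op) : Code :=
  .seq (Code.addC (Option (Fin (M.k + 2))) (Var.c : Var (M.k + 2)) x 0) (drain M o)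

theorem runs_repeatOp (x : Var (M.k + 2)) (o : Op) (v : ℕ) (hx : (g.store M B s).var x = v)
    (hV : M.codeBound ≤ V) (hg : g.out.length + 3 * v ≤ V) (hv : v ≤ V) :
    Runs' M B s V (repeatOp M x o) g (42 * v + 5)
      (({ g with c := 0 } : Gen).emit (List.replicate v o)) :=
  ((runs_addC (g' := { g with c := v }) Var.c x 0 v (by simp) (by simpa using hx) hv
    (setVar_c g v)).seq (runs_drain (g := { g with c := v }) o hV hg hv)).of_eq (by simp only; omega)
      rfl

variable (M) in
/-- Write the instructions that compare the oracle bits with the digits of `i`. -/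
noncomputable def digitsCode : Code :=
  .seq (Code.addC (Option (Fin (M.k + 2))) (Var.a : Var (M.k + 2)) Var.i 0) <|
  .seq (Code.addC (Option (Fin (M.k + 2))) (Var.b : Var (M.k + 2)) Var.n 0) <|
  Code.whilePos (Option (Fin (M.k + 2))) (Var.b : Var (M.k + 2)) <|
  .seq (Code.ifEven (Option (Fin (M.k + 2))) (Var.a : Var (M.k + 2)) (emitOp M .isZero)
    (emitOp M .isOne)) <|
  .seq (emitOp M .right) <|
  .seq (Code.halve (Option (Fin (M.k + 2))) (Var.a : Var (M.k + 2))) <|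
  .seq (Code.halve (Option (Fin (M.k + 2))) (Var.b : Var (M.k + 2)))
    (Code.addC (Option (Fin (M.k + 2))) (Var.c : Var (M.k + 2)) Var.c 1)

/-- Halving `b` from `n` down to `0` takes `n.size` passes, so no logarithm has to be computed.
Meanwhile `a` sheds the digits of `i`, and `c` counts the passes, to be used for moving the head
back. -/
theorem runs_digitsCode (hV : M.codeBound ≤ V) (hin : g.i < g.n) (hn : g.n ≤ V)
    (hg : g.out.length + 6 * g.n.size ≤ V) (hc : g.c = 0) :
    Runs' M B s V (digitsCode M) g (90 * g.n.size + 8)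
      (({ g with a := 0, b := 0, c := g.n.size } : Gen).emit (Op.digits g.n.size g.i)) := by
  have h1 : Runs' M B s V _ g 3 { g with a := g.i } :=
    runs_addC Var.a Var.i 0 g.i (by simp) (by simp [store]) (by omega) (setVar_a _ _)
  have h2 : Runs' M B s V _ { g with a := g.i } 3 { g with a := g.i, b := g.n } :=
    runs_addC Var.b Var.n 0 g.n (by simp) (by simp [store]) (by omega) (setVar_b _ _)
  refine (h1.seq (h2.seq (runs_while (u := 88) (n := g.n.size) (u' := 90 * g.n.size + 2)
    (fun j => ({ g with a := g.i / 2 ^ j, b := g.n / 2 ^ j, c := j } : Gen).emit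
      (Op.digits j g.i)) (fun j hj => ⟨?_, ?_⟩) ?_ ?_ ?_ (by omega)))).of_eq (by omega) rfl
  · have : 0 < g.n / 2 ^ j := Nat.div_pos (Nat.lt_size.1 hj) (by positivity)
    simp only [store, emit]
    exact_mod_cast this
  · have hlen := length_out_emit ({ g with a := g.i / 2 ^ j, b := g.n / 2 ^ j, c := j } : Gen)
      (Op.digits j g.i)
    rw [Op.length_digits] at hlen
    simp only at hlen
    have hjV : j + 1 ≤ V := by omega
    have hbit := Nat.testBit_eq_decide_div_mod_eq (x := g.i) (i := j)
    have hif : Runs' M B s V (Code.ifEven (Option (Fin (M.k + 2))) (Var.a : Var (M.k + 2))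
        (emitOp M .isZero) (emitOp M .isOne))
        (({ g with a := g.i / 2 ^ j, b := g.n / 2 ^ j, c := j } : Gen).emit (Op.digits j g.i)) 42
        ((({ g with a := g.i / 2 ^ j, b := g.n / 2 ^ j, c := j } : Gen).emit
          (Op.digits j g.i)).emit [if g.i.testBit j then .isOne else .isZero]) := by
      by_cases h : g.i / 2 ^ j % 2 = 0
      · rw [hbit, h]
        exact Runs.ifEven_pos (by simp only [store, emit]; omega)
          (runs_emitOp _ hV (by omega))
      · rw [hbit, show g.i / 2 ^ j % 2 = 1 by omega]
        exact Runs.ifEven_neg (by simp only [store, emit]; omega)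
          (runs_emitOp _ hV (by omega))
    have hr := runs_emitOp (M := M) (B := B) (s := s) (V := V)
      (g := (({ g with a := g.i / 2 ^ j, b := g.n / 2 ^ j, c := j } : Gen).emit
          (Op.digits j g.i)).emit [if g.i.testBit j then .isOne else .isZero]) .right hV
      (by rw [length_out_emit]; simp only [List.length_cons, List.length_nil]; omega)
    rw [emit_emit, emit_emit, List.append_assoc, List.singleton_append, ← Op.digits_succ] at hr
    rw [emit_emit] at hif
    refine (hif.seq (hr.seq (Runs.seq (runs_halve
      (g' := ({ g with a := g.i / 2 ^ (j + 1), b := g.n / 2 ^ j, c := j } : Gen).emit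
        (Op.digits (j + 1) g.i)) Var.a (g.i / 2 ^ j) (by simp [store, emit]) ?_) (Runs.seq
      (runs_halve (g' := ({ g with a := g.i / 2 ^ (j + 1), b := g.n / 2 ^ (j + 1), c := j } :
        Gen).emit (Op.digits (j + 1) g.i)) Var.b (g.n / 2 ^ j) (by simp [store, emit]) ?_)
      (runs_addC Var.c Var.c 1 (j + 1) (by simp; omega) (by simp [store, emit]) hjV ?_))))).mono
      (by omega)
    · rw [setVar_a, Nat.div_div_eq_div_mul, ← pow_succ]; rfl
    · rw [setVar_b, Nat.div_div_eq_div_mul, ← pow_succ]; rfl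
    · rw [setVar_c]; rfl
  · have : g.n / 2 ^ g.n.size = 0 := Nat.div_eq_of_lt (Nat.lt_size_self _)
    simp only [store, emit]
    exact_mod_cast this
  · simp [emit, Op.encList, Op.digits, hc]
  -- As `i < n`, the digits of `i` are exhausted too, so `a` also ends at `0`.
  · have h1 : g.n / 2 ^ g.n.size = 0 := Nat.div_eq_of_lt (Nat.lt_size_self _)
    have h2 : g.i / 2 ^ g.n.size = 0 := Nat.div_eq_of_lt (hin.trans (Nat.lt_size_self _))
    simp only [h1, h2]

end Gen

end MultiTapeTM

/-! ### Instructions for the entries of the matrix -/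

namespace MultiTapeTM

open RAM

namespace Gen

variable {M : MultiTapeTM} {B : ℕ → Bool} {s V : ℕ} {g g' : Gen}

theorem natAbs_bitVal_le (b : Bool) : (bitVal b).natAbs ≤ 1 := by cases b <;> simp [bitVal]

theorem bitVal_eq (b : Bool) : bitVal b = (b.toNat : ℤ) := by cases b <;> rfl

variable (M) in
/-- Write the instructions for the matrix entry in the variable `t` and go to the next entry. -/
noncomputable def entryCode (o : Op) : Code :=
  .seq (Code.addC (Option (Fin (M.k + 2))) (Var.r : Var (M.k + 2)) Var.r 1) <|
  .seq (Code.ifEq (Option (Fin (M.k + 2))) (Var.t : Var (M.k + 2)) 0 (emitOp M .nop)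
    (emitOp M o)) <|
  .seq (emitOp M .left) <|
  .seq (Code.const (Option (Fin (M.k + 2))) (Var.t : Var (M.k + 2)) 0)
    (Code.addC (Option (Fin (M.k + 2))) (Var.j : Var (M.k + 2)) Var.j (-1))

/-- The variables during the work on a row. -/
def atRow (n i k j r c m : ℕ) (out : List Bool) (l : List Op) : Gen :=
  ⟨n, i, j, k, r, 0, 0, c, 0, m, out ++ Op.encList l⟩

theorem atRow_emit (n i k j r c m : ℕ) (out : List Bool) (l l' : List Op) :
    (atRow n i k j r c m out l).emit l' = atRow n i k j r c m out (l ++ l') := by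
  simp [atRow, emit, Op.encList_append]

theorem length_out_atRow (n i k j r c m : ℕ) (out : List Bool) (l : List Op) :
    (atRow n i k j r c m out l).out.length = out.length + 3 * l.length := by
  simp [atRow, Op.length_encList]

variable {n i k j r c m : ℕ} {out : List Bool} {l : List Op}

theorem runs_emitOp_atRow (o : Op) (hV : M.codeBound ≤ V)
    (hl : out.length + 3 * l.length + 3 ≤ V) :
    Runs' M B s V (emitOp M o) (atRow n i k j r c m out l) 37
      (atRow n i k j r c m out (l ++ [o])) :=
  (runs_emitOp o hV (by rw [length_out_atRow]; exact hl)).of_eq le_rfl (by rw [atRow_emit])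

theorem runs_entryCode (o : Op) (hV : M.codeBound + 1 ≤ V) (hr : r + 1 ≤ V) (hj : j + 1 ≤ V)
    (hl : out.length + 3 * l.length + 6 ≤ V) :
    Runs' M B s V (entryCode M o)
      { atRow n i k (j + 1) r c m out l with t := (B r).toNat } 85
      (atRow n i k j (r + 1) c m out (l ++ [if B r then o else .nop, .left])) := by
  have h1 : Runs' M B s V _ { atRow n i k (j + 1) r c m out l with t := (B r).toNat } 3
      { atRow n i k (j + 1) (r + 1) c m out l with t := (B r).toNat } :=
    runs_addC Var.r Var.r 1 (r + 1) (by simp; omega) (by simp [store, atRow]) hr (setVar_r _ _)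
  have h2 : Runs' M B s V (Code.ifEq (Option (Fin (M.k + 2))) (Var.t : Var (M.k + 2)) 0
      (emitOp M .nop) (emitOp M o))
      { atRow n i k (j + 1) (r + 1) c m out l with t := (B r).toNat } 40
      { atRow n i k (j + 1) (r + 1) c m out (l ++ [if B r then o else .nop]) with
        t := (B r).toNat } := by
    have hlen : ({ atRow n i k (j + 1) (r + 1) c m out l with t := (B r).toNat } :
        Gen).out.length + 3 ≤ V := by
      have := length_out_atRow n i k (j + 1) (r + 1) c m out l
      simp only; omega
    cases hb : B r
    · refine (Runs.ifEq_pos (by simp) (by simp [store]) ((runs_emitOp .nop (by omega)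
        (by rw [hb] at hlen; exact hlen)).of_eq le_rfl ?_)).mono (by omega)
      simp [emit, atRow, Op.encList_append]
    · refine (Runs.ifEq_neg (by simp) (by simp [store]) ((runs_emitOp o (by omega)
        (by rw [hb] at hlen; exact hlen)).of_eq le_rfl ?_)).mono (by omega)
      simp [emit, atRow, Op.encList_append]
  have h3 : Runs' M B s V (emitOp M .left)
      { atRow n i k (j + 1) (r + 1) c m out (l ++ [if B r then o else .nop]) with
        t := (B r).toNat } 37
      { atRow n i k (j + 1) (r + 1) c m out (l ++ [if B r then o else .nop, .left]) with
        t := (B r).toNat } := by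
    refine (runs_emitOp .left (by omega) ?_).of_eq le_rfl ?_
    · have := length_out_atRow n i k (j + 1) (r + 1) c m out (l ++ [if B r then o else .nop])
      simp only [List.length_append, List.length_cons, List.length_nil] at this ⊢
      omega
    · simp [emit, atRow, Op.encList]
  have h4 : Runs' M B s V (Code.const (Option (Fin (M.k + 2))) Var.t ((0 : ℕ) : ℤ))
      { atRow n i k (j + 1) (r + 1) c m out (l ++ [if B r then o else .nop, .left]) with
        t := (B r).toNat } 2
      (atRow n i k (j + 1) (r + 1) c m out (l ++ [if B r then o else .nop, .left])) :=
    runs_const Var.t 0 (by omega) (setVar_t _ _)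
  have h5 : Runs' M B s V _
      (atRow n i k (j + 1) (r + 1) c m out (l ++ [if B r then o else .nop, .left])) 3
      (atRow n i k j (r + 1) c m out (l ++ [if B r then o else .nop, .left])) :=
    runs_addC Var.j Var.j (-1) j (by simp; omega) (by simp [store, atRow]) (by omega)
      (setVar_j _ _)
  exact h1.seq (h2.seq (h3.seq (h4.seq h5)))

variable (M) in
/-- Read a matrix entry and store it in the matrix. -/
noncomputable def readEntry : Code :=
  .seq (Code.readV (Option (Fin (M.k + 2))) (Var.t : Var (M.k + 2)))
    (Code.putV (none : Option (Fin (M.k + 2))) (Var.r : Var (M.k + 2)) Var.t)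

/-- The input can be read only once but the second pass needs the entries again, so each is also
stored in the array `none`. -/
theorem runs_readEntry (hr : r < s) :
    Runs' M B s V (readEntry M) (atRow n i k j r c r out l) 10
      { atRow n i k j r c (r + 1) out l with t := (B r).toNat } := by
  refine ((Runs.readV Var.t).seq (Runs.putV none Var.r Var.t)).of_eq le_rfl ?_
  have hin : (((List.range s).map fun q => bitVal (B q)).drop r).headD 0 = ((B r).toNat : ℤ) := by
    rw [List.headD_eq_head?_getD, List.head?_drop]
    simp [List.getElem?_range hr, bitVal_eq]
  refine Store.ext (funext fun x => ?_) (funext fun a => funext fun p => ?_) ?_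
  · cases x
    case t =>
      simp only [Store.setVar, Store.setArr, Function.update_self]
      exact hin
    all_goals simp [Store.setVar, Store.setArr, store, atRow]
  · rcases a with _ | q
    · have hrt : (Var.r : Var (M.k + 2)) ≠ Var.t := by simp
      simp only [Store.setVar, Store.setArr, store, atRow, Function.update_self, hin,
        Function.update_of_ne hrt]
      rw [Function.update_apply]
      by_cases hp : p = r
      · subst hp
        simp [bitVal_eq]
      · rw [if_neg hp]
        split_ifs <;> first | rfl | omega
    · simp [Store.setVar, Store.setArr, store, atRow]
  · simp [Store.setVar, Store.setArr, store, atRow]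

variable (M) in
/-- Read a row of the matrix and write instructions for its entries. -/
noncomputable def readRow : Code :=
  .seq (Code.addC (Option (Fin (M.k + 2))) (Var.j : Var (M.k + 2)) Var.n 0) <|
  Code.whilePos (Option (Fin (M.k + 2))) (Var.j : Var (M.k + 2)) <|
  .seq (readEntry M) (entryCode M .write)

variable (M) in
/-- Write instructions for the entries of a row that has been read before. -/
noncomputable def scanRow : Code :=
  .seq (Code.addC (Option (Fin (M.k + 2))) (Var.j : Var (M.k + 2)) Var.n 0) <|
  Code.whilePos (Option (Fin (M.k + 2))) (Var.j : Var (M.k + 2)) <|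
  .seq (Code.get (Var.t : Var (M.k + 2)) (none : Option (Fin (M.k + 2))) Var.r)
    (entryCode M .check)

theorem runs_init_j (hn : n ≤ V) :
    Runs' M B s V (Code.addC (Option (Fin (M.k + 2))) (Var.j : Var (M.k + 2)) Var.n 0)
      (atRow n i k 0 r c m out l) 3 (atRow n i k n r c m out l) :=
  runs_addC Var.j Var.n 0 n (by simp) (by simp [store, atRow]) hn (setVar_j _ _)

theorem runs_readRow (hV : M.codeBound + 1 ≤ V) (hn : n ≤ V) (hr : r + n ≤ s) (hs : s ≤ V)
    (hl : out.length + 3 * l.length + 6 * n ≤ V) :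
    Runs' M B s V (readRow M) (atRow n i k 0 r c r out l) (97 * n + 5)
      (atRow n i k 0 (r + n) c (r + n) out (l ++ Op.entries .write (fun q => B (r + q)) n)) := by
  refine ((runs_init_j hn).seq (runs_while (u := 95) (n := n) (u' := 97 * n + 2)
    (fun q => atRow n i k (n - q) (r + q) c (r + q) out
      (l ++ Op.entries .write (fun q => B (r + q)) q))
    (fun q hq => ⟨?_, ?_⟩) ?_ ?_ ?_ (by omega))).mono (by omega)
  · simp only [store, atRow]; omega
  · have hlen := Op.length_entries .write (fun q => B (r + q)) q
    -- As `q < n`, the truncated difference is a successor, the form in which `runs_entryCode`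
    -- expects the counter `j`.
    obtain ⟨d, hd⟩ : ∃ d, n - q = d + 1 := ⟨n - q - 1, by omega⟩
    rw [hd, show n - (q + 1) = d by omega, Op.entries_succ, ← List.append_assoc, ← add_assoc]
    exact (runs_readEntry (by omega)).seq (runs_entryCode .write hV (by omega) (by omega)
      (by rw [List.length_append, hlen]; omega))
  · simp [store, atRow]
  · simp [Op.entries]
  · simp

theorem runs_scanRow (hV : M.codeBound + 1 ≤ V) (hn : n ≤ V) (hr : r + n ≤ m) (hs : m ≤ V)
    (hl : out.length + 3 * l.length + 6 * n ≤ V) :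
    Runs' M B s V (scanRow M) (atRow n i k 0 r c m out l) (96 * n + 5)
      (atRow n i k 0 (r + n) c m out (l ++ Op.entries .check (fun q => B (r + q)) n)) := by
  refine ((runs_init_j hn).seq (runs_while (u := 94) (n := n) (u' := 96 * n + 2)
    (fun q => atRow n i k (n - q) (r + q) c m out
      (l ++ Op.entries .check (fun q => B (r + q)) q))
    (fun q hq => ⟨?_, ?_⟩) ?_ ?_ ?_ (by omega))).mono (by omega)
  · simp only [store, atRow]; omega
  · have hlen := Op.length_entries .check (fun q => B (r + q)) q
    obtain ⟨d, hd⟩ : ∃ d, n - q = d + 1 := ⟨n - q - 1, by omega⟩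
    rw [hd, show n - (q + 1) = d by omega, Op.entries_succ, ← List.append_assoc, ← add_assoc]
    refine Runs.seq (σ' := store M B s { atRow n i k (d + 1) (r + q) c m out
      (l ++ Op.entries .check (fun q => B (r + q)) q) with t := (B (r + q)).toNat })
      ((Runs.get Var.t none Var.r).of_eq le_rfl ?_)
      (runs_entryCode .check hV (by omega) (by omega) (by rw [List.length_append, hlen]; omega))
    have e : ((atRow n i k (d + 1) (r + q) c m out
        (l ++ Op.entries .check (fun q => B (r + q)) q)).store M B s).arr none ((r + q : ℕ) : ℤ) =
        ((B (r + q)).toNat : ℕ) := by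
      change (if 0 ≤ ((r + q : ℕ) : ℤ) ∧ ((r + q : ℕ) : ℤ) < (m : ℤ)
        then bitVal (B ((r + q : ℕ) : ℤ).toNat) else 0) = _
      rw [if_pos ⟨by omega, by omega⟩, Int.toNat_natCast, bitVal_eq]
    have hr' : ((atRow n i k (d + 1) (r + q) c m out
        (l ++ Op.entries .check (fun q => B (r + q)) q)).store M B s).var Var.r =
        ((r + q : ℕ) : ℤ) := rfl
    rw [hr', e]
    exact setVar_t _ _
  · simp [store, atRow]
  · simp [Op.entries]
  · simp

theorem runs_repeatOp_atRow (x : Var (M.k + 2)) (o : Op) (v : ℕ)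
    (hx : ((atRow n i k 0 r 0 m out l).store M B s).var x = v)
    (hV : M.codeBound ≤ V) (hl : out.length + 3 * l.length + 3 * v ≤ V) (hv : v ≤ V) :
    Runs' M B s V (repeatOp M x o) (atRow n i k 0 r 0 m out l) (42 * v + 5)
      (atRow n i k 0 r 0 m out (l ++ List.replicate v o)) :=
  (runs_repeatOp x o v hx hV (by rwa [length_out_atRow]) hv).of_eq le_rfl
    (by rw [← atRow_emit]; rfl)

/-! ### Instructions for whole rows and for the whole graph -/

variable (M) in
/-- Write the instructions that copy a row. -/
noncomputable def copyRowCode : Code :=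
  .seq (emitOp M .set) <| .seq (digitsCode M) <| .seq (drain M .left) <|
  .seq (emitOp M .left) <| .seq (readRow M) <| .seq (repeatOp M .n .right) (emitOp M .right)

variable (M) in
/-- Write the instructions that check a row. -/
noncomputable def checkRowCode : Code :=
  .seq (emitOp M .left) <| .seq (repeatOp M .i .left) <| .seq (emitOp M .set) <|
  .seq (emitOp M .isOne) <| .seq (repeatOp M .i .right) <| .seq (scanRow M) <|
  .seq (repeatOp M .n .right) (emitOp M .right)

theorem size_le_self (n : ℕ) : n.size ≤ n := Nat.size_le.2 n.lt_two_pow_self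

/-- The room `3 * (6 * n + 3)` suffices because the `3n + 3 n.size + 3` instructions of a row take
three bits each and `n.size ≤ n`. -/
theorem runs_copyRowCode (hV : M.codeBound + 1 ≤ V) (hi : i < n) (hr : r + n ≤ s) (hs : s ≤ V)
    (hl : out.length + 3 * l.length + 3 * (6 * n + 3) ≤ V) :
    Runs' M B s V (copyRowCode M) (atRow n i k 0 r 0 r out l) (300 * (n + 1))
      (atRow n i k 0 (r + n) 0 (r + n) out
        (l ++ Op.copyRow n n.size i fun q => B (r + q))) := by
  have hsz := size_le_self n
  have h1 := runs_emitOp_atRow (M := M) (B := B) (s := s) (V := V) (n := n) (i := i) (k := k)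
    (j := 0) (r := r) (c := 0) (m := r) (out := out) (l := l) .set (by omega) (by omega)
  have h2 : Runs' M B s V (digitsCode M) (atRow n i k 0 r 0 r out (l ++ [.set])) (90 * n.size + 8)
      (atRow n i k 0 r n.size r out (l ++ [.set] ++ Op.digits n.size i)) := by
    refine (runs_digitsCode (by omega) hi ?_ ?_ rfl).of_eq le_rfl ?_
    · change n ≤ V; omega
    · rw [length_out_atRow]; simp only [List.length_append, List.length_singleton]
      change _ + 6 * n.size ≤ _; omega
    · rw [← atRow_emit (l' := Op.digits _ _)]; rfl
  have h3 : Runs' M B s V (drain M .left)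
      (atRow n i k 0 r n.size r out (l ++ [.set] ++ Op.digits n.size i)) (42 * n.size + 2)
      (atRow n i k 0 r 0 r out (l ++ [.set] ++ Op.digits n.size i ++
        List.replicate n.size .left)) := by
    refine (runs_drain .left (by omega) ?_ ?_).of_eq le_rfl ?_
    · rw [length_out_atRow]
      simp only [List.length_append, List.length_singleton, Op.length_digits]
      change _ + 3 * n.size ≤ _; omega
    · change n.size ≤ V; omega
    · rw [← atRow_emit (l' := List.replicate _ _)]; rfl
  have h4 := runs_emitOp_atRow (M := M) (B := B) (s := s) (V := V) (n := n) (i := i) (k := k)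
    (j := 0) (r := r) (c := 0) (m := r) (out := out) (l := l ++ [.set] ++ Op.digits n.size i ++
        List.replicate n.size .left) .left (by omega) (by
      simp only [List.length_append, List.length_singleton, Op.length_digits,
        List.length_replicate]; omega)
  have h5 := runs_readRow (M := M) (B := B) (s := s) (V := V) (n := n) (i := i) (k := k)
    (r := r) (c := 0) (out := out) (l := l ++ [.set] ++ Op.digits n.size i ++
        List.replicate n.size .left ++ [.left]) hV (by omega) hr hs (by
      simp only [List.length_append, List.length_singleton, Op.length_digits,
        List.length_replicate]; omega)
  have h6 := runs_repeatOp_atRow (M := M) (B := B) (s := s) (V := V) (n := n) (i := i) (k := k)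
    (r := r + n) (m := r + n) (out := out) (l := l ++ [.set] ++ Op.digits n.size i ++
        List.replicate n.size .left ++ [.left] ++ Op.entries .write (fun q => B (r + q)) n)
        .n .right n rfl (by omega) (by
      simp only [List.length_append, List.length_singleton, Op.length_digits,
        List.length_replicate, Op.length_entries]; omega) (by omega)
  have h7 := runs_emitOp_atRow (M := M) (B := B) (s := s) (V := V) (n := n) (i := i) (k := k)
    (j := 0) (r := r + n) (c := 0) (m := r + n) (out := out) (l := l ++ [.set] ++
        Op.digits n.size i ++ List.replicate n.size .left ++ [.left] ++
        Op.entries .write (fun q => B (r + q)) n ++ List.replicate n .right)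
        .right (by omega) (by
      simp only [List.length_append, List.length_singleton, Op.length_digits,
        List.length_replicate, Op.length_entries]; omega)
  refine (h1.seq (h2.seq (h3.seq (h4.seq (h5.seq (h6.seq h7)))))).of_eq (by omega) ?_
  simp [Op.copyRow]

theorem runs_checkRowCode (hV : M.codeBound + 1 ≤ V) (hi : i < n) (hr : r + n ≤ m) (hs : m ≤ V)
    (hl : out.length + 3 * l.length + 3 * (5 * n + 4) ≤ V) :
    Runs' M B s V (checkRowCode M) (atRow n i k 0 r 0 m out l) (300 * (n + 1))
      (atRow n i k 0 (r + n) 0 m out (l ++ Op.checkRow n i fun q => B (r + q))) := by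
  have h1 := runs_emitOp_atRow (M := M) (B := B) (s := s) (V := V) (n := n) (i := i) (k := k)
    (j := 0) (r := r) (c := 0) (m := m) (out := out) (l := l) .left (by omega) (by omega)
  have h2 := runs_repeatOp_atRow (M := M) (B := B) (s := s) (V := V) (n := n) (i := i) (k := k)
    (r := r) (m := m) (out := out) (l := l ++ [.left])
    .i .left i rfl (by omega) (by simp only [List.length_append, List.length_singleton]; omega)
    (by omega)
  have h3 := runs_emitOp_atRow (M := M) (B := B) (s := s) (V := V) (n := n) (i := i) (k := k)
    (j := 0) (r := r) (c := 0) (m := m) (out := out) (l := l ++ [.left] ++ List.replicate i .left)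
    .set (by omega) (by
      simp only [List.length_append, List.length_singleton, List.length_replicate]; omega)
  have h4 := runs_emitOp_atRow (M := M) (B := B) (s := s) (V := V) (n := n) (i := i) (k := k)
    (j := 0) (r := r) (c := 0) (m := m) (out := out)
    (l := l ++ [.left] ++ List.replicate i .left ++ [.set]) .isOne (by omega) (by
      simp only [List.length_append, List.length_singleton, List.length_replicate]; omega)
  have h5 := runs_repeatOp_atRow (M := M) (B := B) (s := s) (V := V) (n := n) (i := i) (k := k)
    (r := r) (m := m) (out := out)
    (l := l ++ [.left] ++ List.replicate i .left ++ [.set] ++ [.isOne])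
    .i .right i rfl (by omega) (by
      simp only [List.length_append, List.length_singleton, List.length_replicate]; omega)
    (by omega)
  have h6 := runs_scanRow (M := M) (B := B) (s := s) (V := V) (n := n) (i := i) (k := k)
    (r := r) (c := 0) (m := m) (out := out) (l := l ++ [.left] ++ List.replicate i .left ++
      [.set] ++ [.isOne] ++ List.replicate i .right) hV (by omega) hr hs (by
      simp only [List.length_append, List.length_singleton, List.length_replicate]; omega)
  have h7 := runs_repeatOp_atRow (M := M) (B := B) (s := s) (V := V) (n := n) (i := i) (k := k)
    (r := r + n) (m := m) (out := out) (l := l ++ [.left] ++ List.replicate i .left ++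
      [.set] ++ [.isOne] ++ List.replicate i .right ++ Op.entries .check (fun q => B (r + q)) n)
    .n .right n rfl (by omega) (by
      simp only [List.length_append, List.length_singleton, List.length_replicate,
        Op.length_entries]; omega) (by omega)
  have h8 := runs_emitOp_atRow (M := M) (B := B) (s := s) (V := V) (n := n) (i := i) (k := k)
    (j := 0) (r := r + n) (c := 0) (m := m) (out := out) (l := l ++ [.left] ++
      List.replicate i .left ++ [.set] ++ [.isOne] ++ List.replicate i .right ++
      Op.entries .check (fun q => B (r + q)) n ++ List.replicate n .right) .right (by omega) (by
      simp only [List.length_append, List.length_singleton, List.length_replicate,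
        Op.length_entries]; omega)
  refine (h1.seq (h2.seq (h3.seq (h4.seq (h5.seq (h6.seq (h7.seq h8))))))).of_eq (by omega) ?_
  simp [Op.checkRow]

variable (M) in
/-- Execute `body` for `i = 0, …, n - 1`. -/
noncomputable def forRows (body : Code) : Code :=
  .seq (Code.addC (Option (Fin (M.k + 2))) (Var.k : Var (M.k + 2)) Var.n 0) <|
  Code.whilePos (Option (Fin (M.k + 2))) (Var.k : Var (M.k + 2)) <|
  .seq body <|
  .seq (Code.addC (Option (Fin (M.k + 2))) (Var.i : Var (M.k + 2)) Var.i 1)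
    (Code.addC (Option (Fin (M.k + 2))) (Var.k : Var (M.k + 2)) Var.k (-1))

/-- `R q` and `C q` are the position in the matrix and the number of entries read before row `q`:
both are `q * n` in the first pass, while in the second all `n * n` entries have been read. The
countdown `k` is left alone by the body, hence the quantifier over `k'`. -/
theorem runs_forRows {body : Code} {u : ℕ} (R C : ℕ → ℕ) (f : ℕ → List Op) (hn : n + 1 ≤ V)
    (h : ∀ q < n, ∀ k', Runs' M B s V body
      (atRow n q k' 0 (R q) 0 (C q) out (l ++ (List.range q).flatMap f)) u
      (atRow n q k' 0 (R (q + 1)) 0 (C (q + 1)) out ((l ++ (List.range q).flatMap f) ++ f q))) :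
    Runs' M B s V (forRows M body) (atRow n 0 0 0 (R 0) 0 (C 0) out l) (n * (u + 8) + 5)
      (atRow n n 0 0 (R n) 0 (C n) out (l ++ (List.range n).flatMap f)) := by
  have h0 : Runs' M B s V _ (atRow n 0 0 0 (R 0) 0 (C 0) out l) 3
      (atRow n 0 n 0 (R 0) 0 (C 0) out l) :=
    runs_addC Var.k Var.n 0 n (by simp) (by simp [store, atRow]) (by omega) (setVar_k _ _)
  refine (h0.seq (runs_while (u := u + 6) (n := n) (u' := n * (u + 8) + 2)
    (fun q => atRow n q (n - q) 0 (R q) 0 (C q) out (l ++ (List.range q).flatMap f))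
    (fun q hq => ⟨?_, ?_⟩) ?_ ?_ ?_ (by ring_nf; omega))).mono (by omega)
  · simp only [store, atRow]; omega
  · obtain ⟨d, hd⟩ : ∃ d, n - q = d + 1 := ⟨n - q - 1, by omega⟩
    rw [hd, show n - (q + 1) = d by omega]
    have e : l ++ (List.range (q + 1)).flatMap f = (l ++ (List.range q).flatMap f) ++ f q := by
      simp [List.range_succ]
    rw [e]
    have h1 : Runs' M B s V _
        (atRow n q (d + 1) 0 (R (q + 1)) 0 (C (q + 1)) out ((l ++ (List.range q).flatMap f) ++ f q))
        3 (atRow n (q + 1) (d + 1) 0 (R (q + 1)) 0 (C (q + 1)) out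
          ((l ++ (List.range q).flatMap f) ++ f q)) :=
      runs_addC Var.i Var.i 1 (q + 1) (by simp; omega) (by simp [store, atRow]) (by omega)
        (setVar_i _ _)
    have h2 : Runs' M B s V _
        (atRow n (q + 1) (d + 1) 0 (R (q + 1)) 0 (C (q + 1)) out
          ((l ++ (List.range q).flatMap f) ++ f q))
        3 (atRow n (q + 1) d 0 (R (q + 1)) 0 (C (q + 1)) out
          ((l ++ (List.range q).flatMap f) ++ f q)) :=
      runs_addC Var.k Var.k (-1) d (by simp; omega) (by simp [store, atRow]) (by omega)
        (setVar_k _ _)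
    exact ((h q hq _).seq (h1.seq h2)).mono (by omega)
  · simp [store, atRow]
  · simp
  · simp

variable (M) in
/-- Read a graph and write the instructions for it to the input tape. -/
noncomputable def genCode : Code :=
  .seq (Code.readV (Option (Fin (M.k + 2))) (Var.n : Var (M.k + 2))) <|
  .seq (forRows M (copyRowCode M)) <|
  .seq (Code.const (Option (Fin (M.k + 2))) (Var.i : Var (M.k + 2)) 0) <|
  .seq (Code.const (Option (Fin (M.k + 2))) (Var.r : Var (M.k + 2)) 0)
    (forRows M (checkRowCode M))

/-- With the matrix stored row by row in `B`, row `i` starts at `i * n`. Between the two passes only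
`i` and `r` have to be reset. -/
theorem runs_genCode (n : ℕ) (hV : M.codeBound + 100 * (n + 1) ^ 2 ≤ V) :
    Runs V (genCode M)
      (⟨fun _ => 0, fun _ _ => 0, (n : ℤ) :: (List.range (n * n)).map fun q => bitVal (B q)⟩ :
        M.SimStore) (1000 * (n + 1) ^ 2)
      ((atRow n n 0 0 (n * n) 0 (n * n) []
        (Op.program n n.size fun i j => B (i * n + j))).store M B (n * n)) := by
  have hsz := size_le_self n
  have hsq : (n + 1) ^ 2 = n * n + 2 * n + 1 := by ring
  have h1 : Runs V (Code.readV (Option (Fin (M.k + 2))) (Var.n : Var (M.k + 2)))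
      (⟨fun _ => 0, fun _ _ => 0, (n : ℤ) :: (List.range (n * n)).map fun q => bitVal (B q)⟩ :
        M.SimStore) 1 ((atRow n 0 0 0 0 0 0 [] []).store M B (n * n)) := by
    refine (Runs.readV Var.n).of_eq le_rfl (Store.ext (funext fun x => ?_)
      (funext fun a => funext fun p => ?_) ?_)
    · cases x <;> simp [Store.setVar, store, atRow, Op.encList]
    · rcases a with _ | i
      · have : ¬ (0 ≤ p ∧ p < 0) := by omega
        simp [Store.setVar, store, atRow, this]
      · simp [Store.setVar, store, atRow, Op.encList, wordTape, symCode_blank]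
    · simp [store, atRow]
  have hlen1 : ∀ q, ((List.range q).flatMap fun i =>
      Op.copyRow n n.size i fun j => B (i * n + j)).length = q * (3 * n + 3 * n.size + 3) := by
    intro q
    rw [List.length_flatMap]
    simp [Op.length_copyRow]
  have hlen2 : ∀ q ≤ n, ((List.range q).flatMap fun i =>
      Op.checkRow n i fun j => B (i * n + j)).length ≤ q * (5 * n + 4) := by
    intro q hq
    rw [List.length_flatMap]
    refine (List.sum_le_card_nsmul _ (5 * n + 4) ?_).trans (by simp)
    simp only [List.mem_map, List.mem_range]
    rintro _ ⟨i, hi, rfl⟩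
    exact Op.length_checkRow_le n i (by omega) _
  have h2 := runs_forRows (M := M) (B := B) (s := n * n) (V := V) (n := n) (out := []) (l := [])
    (body := copyRowCode M) (u := 300 * (n + 1)) (fun q => q * n) (fun q => q * n)
    (fun i => Op.copyRow n n.size i fun j => B (i * n + j)) (by omega) (by
      intro q hq k'
      have hqn : q * n + n ≤ n * n := by
        have := Nat.mul_le_mul_right n (show q + 1 ≤ n by omega)
        rwa [add_mul, one_mul] at this
      rw [add_mul, one_mul]
      refine runs_copyRowCode (by omega) hq hqn (by omega) ?_
      rw [List.nil_append, hlen1]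
      have : q * (3 * n + 3 * n.size + 3) ≤ n * (3 * n + 3 * n + 3) :=
        Nat.mul_le_mul (by omega) (by omega)
      simp only [List.length_nil]
      nlinarith)
  simp only [Nat.zero_mul, List.nil_append] at h2
  set L := (List.range n).flatMap fun i => Op.copyRow n n.size i fun j => B (i * n + j) with hL
  have h3 : Runs' M B (n * n) V (Code.const (Option (Fin (M.k + 2))) Var.i ((0 : ℕ) : ℤ))
      (atRow n n 0 0 (n * n) 0 (n * n) [] L) 2 (atRow n 0 0 0 (n * n) 0 (n * n) [] L) :=
    runs_const Var.i 0 (by omega) (setVar_i _ _)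
  have h4 : Runs' M B (n * n) V (Code.const (Option (Fin (M.k + 2))) Var.r ((0 : ℕ) : ℤ))
      (atRow n 0 0 0 (n * n) 0 (n * n) [] L) 2 (atRow n 0 0 0 0 0 (n * n) [] L) :=
    runs_const Var.r 0 (by omega) (setVar_r _ _)
  have h5 := runs_forRows (M := M) (B := B) (s := n * n) (V := V) (n := n) (out := []) (l := L)
    (body := checkRowCode M) (u := 300 * (n + 1)) (fun q => q * n) (fun _ => n * n)
    (fun i => Op.checkRow n i fun j => B (i * n + j)) (by omega) (by
      intro q hq k'
      have hqn : q * n + n ≤ n * n := by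
        have := Nat.mul_le_mul_right n (show q + 1 ≤ n by omega)
        rwa [add_mul, one_mul] at this
      rw [add_mul, one_mul]
      refine runs_checkRowCode (by omega) hq hqn (by omega) ?_
      have h2 := hlen2 q hq.le
      have : q * (5 * n + 4) ≤ n * (5 * n + 4) := Nat.mul_le_mul_right _ hq.le
      have : n * (3 * n + 3 * n.size + 3) ≤ n * (3 * n + 3 * n + 3) :=
        Nat.mul_le_mul_left _ (by omega)
      rw [List.length_append, hL, hlen1]
      simp only [List.length_nil]
      nlinarith)
  simp only [Nat.zero_mul] at h5
  exact (h1.seq (h2.seq (h3.seq (h4.seq h5)))).of_eq (by nlinarith) rfl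

end Gen

end MultiTapeTM

/-! ## Triangle detection by simulation -/

namespace MultiTapeTM

open RAM

theorem HaltsWithin.mono {M : MultiTapeTM} {x w : List Bool} {t t' : ℕ}
    (h : M.HaltsWithin x w t) (ht : t ≤ t') : M.HaltsWithin x w t' := by
  obtain ⟨d, rfl⟩ := Nat.exists_eq_add_of_le ht
  rw [HaltsWithin, add_comm, Function.iterate_add_apply, Halted.iterate_eq h]
  exact h

open Classical in
/-- The adjacency matrix of a graph. -/
noncomputable def adjBit {N : ℕ} (G : SimpleGraph (Fin N)) (i j : ℕ) : Bool :=
  decide (∃ (hi : i < N) (hj : j < N), G.Adj ⟨i, hi⟩ ⟨j, hj⟩)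

/-- Position `q = i * N + j` of the flattened matrix recovers `i` and `j` as quotient and remainder,
so the input becomes one indexed list, as the generating code reads it. -/
theorem graphInput_eq {N : ℕ} (G : SimpleGraph (Fin N)) :
    graphInput G =
      (N : ℤ) :: (List.range (N * N)).map fun q => bitVal (adjBit G (q / N) (q % N)) := by
  classical
  have h := List.ofFn_mul (m := N) (n := N)
    fun q : Fin (N * N) => bitVal (adjBit G (q / N) (q % N))
  have h1 : (List.range (N * N)).map (fun q => bitVal (adjBit G (q / N) (q % N))) =
      List.ofFn fun q : Fin (N * N) => bitVal (adjBit G (q / N) (q % N)) := by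
    rw [List.ofFn_eq_map, ← List.map_coe_finRange_eq_range, List.map_map]
    rfl
  rw [h1, h, graphInput, List.flatMap_def, List.ofFn_eq_map]
  congr 2
  refine List.map_congr_left fun i _ => ?_
  rw [List.ofFn_eq_map]
  refine List.map_congr_left fun j _ => ?_
  have hN : 0 < N := i.pos
  have e1 : (i * N + j : ℕ) / N = i := by
    rw [mul_comm, Nat.mul_add_div hN, Nat.div_eq_of_lt j.isLt, add_zero]
  have e2 : (i * N + j : ℕ) % N = j := by
    rw [mul_comm, Nat.mul_add_mod, Nat.mod_eq_of_lt j.isLt]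
  simp only [e1, e2, adjBit, bitVal]
  by_cases hG : G.Adj i j <;> simp [hG]

/-- The instructions for a graph. -/
noncomputable def graphWord {N : ℕ} (G : SimpleGraph (Fin N)) : List Bool :=
  Op.encList (Op.program N N.size fun i j => adjBit G ((i * N + j) / N) ((i * N + j) % N))

theorem length_graphWord_le {N : ℕ} (G : SimpleGraph (Fin N)) :
    (graphWord G).length ≤ 40 * (N + 1) ^ 2 := by
  have h1 := Op.length_program_le N N.size
    fun i j => adjBit G ((i * N + j) / N) ((i * N + j) % N)
  have h2 := Gen.size_le_self N
  have h3 : N * (8 * N + 3 * N.size + 7) ≤ N * (8 * N + 3 * N + 7) :=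
    Nat.mul_le_mul_left _ (by omega)
  rw [graphWord, Op.length_encList]
  nlinarith

theorem graphWord_mem_lang {N : ℕ} (G : SimpleGraph (Fin N)) :
    graphWord G ∈ Op.lang ↔ ∃ a b c, G.Adj a b ∧ G.Adj b c ∧ G.Adj a c := by
  have hbit : ∀ i < N, ∀ j < N, adjBit G ((i * N + j) / N) ((i * N + j) % N) = adjBit G i j := by
    intro i hi j hj
    rw [mul_comm, Nat.mul_add_div (by omega), Nat.div_eq_of_lt hj, add_zero, Nat.mul_add_mod,
      Nat.mod_eq_of_lt hj]
  -- The leading binary digit gives `2 ^ (N.size - 1) ≤ N` for `N > 0`; the empty graph has the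
  -- empty program and is treated separately.
  have hpow : N.size = 0 ∨ 2 ^ N.size ≤ 2 * N := by
    rcases Nat.eq_zero_or_eq_succ_pred N.size with h | h
    · exact Or.inl h
    · right
      rw [h, pow_succ, mul_comm]
      exact Nat.mul_le_mul_left _ (Nat.lt_size.1 (by omega))
  rcases hpow with h0 | hpow
  · obtain rfl := Nat.size_eq_zero.1 h0
    constructor
    · rintro ⟨w, -, hw⟩
      rw [graphWord, Op.accepts_encList] at hw
      simp [Op.program, Op.St.init] at hw
    · rintro ⟨a, -⟩
      exact a.elim0
  · rw [graphWord, Op.encList_program_mem_lang N N.size (Nat.lt_size_self N).le hpow]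
    constructor
    · rintro ⟨v, hv, i, hi, j, hj, h1, h2, h3⟩
      rw [hbit _ hv _ hi] at h1
      rw [hbit _ hi _ hj] at h2
      rw [hbit _ hv _ hj] at h3
      simp only [adjBit, decide_eq_true_eq] at h1 h2 h3
      exact ⟨⟨v, hv⟩, ⟨i, hi⟩, ⟨j, hj⟩, h1.2.2, h2.2.2, h3.2.2⟩
    · rintro ⟨a, b, c, h1, h2, h3⟩
      refine ⟨a, a.isLt, b, b.isLt, c, c.isLt, ?_, ?_, ?_⟩
      · rw [hbit _ a.isLt _ b.isLt]; simpa [adjBit] using h1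
      · rw [hbit _ b.isLt _ c.isLt]; simpa [adjBit] using h2
      · rw [hbit _ a.isLt _ c.isLt]; simpa [adjBit] using h3

/-! ### The triangle detection program built from a deciding machine -/

variable (M : MultiTapeTM)

/-- The program that detects triangles with the help of `M`. -/
noncomputable def triangleProgram : Program :=
  (Code.seq (.seq (Gen.genCode M) M.simCode)
    (Code.loadV (Option (Fin (M.k + 2))) (Var.ans : Var (M.k + 2)))).toProgram

/-- A bound for the values in a run of the program. -/
noncomputable def valueBound (N t : ℕ) : ℕ := M.codeBound + 100 * (N + 1) ^ 2 + t + 1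

/-- The running time of the program, when `M` takes at most `t` steps. -/
noncomputable def triangleTime (N t : ℕ) : ℕ :=
  (1000 * (N + 1) ^ 2 + ((t + 1) * (M.stepTime + 2) + 6) + 3) *
    (4 * size (regBound (Var (M.k + 2)) (Option (Fin (M.k + 2))) (M.valueBound N t)))

open Classical in
theorem answersWithin_triangleProgram {N t : ℕ} (G : SimpleGraph (Fin N))
    (ht : M.HaltsWithin (graphWord G) [] t) :
    AnswersWithin M.triangleProgram (graphInput G) (decide (M.Accepts (graphWord G) []))
      (M.triangleTime N t) := by
  set V := M.valueBound N t with hV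
  have hsq : (N + 1) ^ 2 = N * N + 2 * N + 1 := by ring
  have hV1 : M.codeBound + 100 * (N + 1) ^ 2 ≤ V := by rw [hV, valueBound]; omega
  have hV2 : M.codeBound + t + 1 ≤ V := by rw [hV, valueBound]; omega
  have h1 := Gen.runs_genCode (M := M) (B := fun q => adjBit G (q / N) (q % N)) N hV1
  rw [← graphInput_eq] at h1
  obtain ⟨σ', h2, h3⟩ := runs_simCode ht hV2
    (σ := (Gen.atRow N N 0 0 (N * N) 0 (N * N) []
      (Op.program N N.size fun i j => adjBit G ((i * N + j) / N) ((i * N + j) % N))).store M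
        (fun q => adjBit G (q / N) (q % N)) (N * N)) (fun i => rfl) (fun i p => by
      -- The generated word is on tape `0`; the oracle tape is blank like the work tapes, since
      -- there are no oracle bits.
      simp only [Gen.store, init, Gen.atRow, graphWord, List.nil_append]
      congr 2
      split_ifs <;> rfl)
  have hinp : ∀ z ∈ graphInput G, z.natAbs ≤ V := by
    rw [graphInput_eq]
    intro z hz
    rcases List.mem_cons.1 hz with rfl | hz
    · rw [Int.natAbs_natCast]; omega
    · obtain ⟨q, -, rfl⟩ := List.mem_map.1 hz
      exact (Gen.natAbs_bitVal_le _).trans (by omega)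
  have h4 := Runs.answersWithin (x := Var.ans) hinp (h1.seq h2)
  rw [decide_eq_decide.2 h3] at h4
  exact h4

end MultiTapeTM

/-! ### Asymptotics of the running time -/

section Asymptotics

open RAM MultiTapeTM

/-- The maximum over all word lengths up to a bound includes short words, so an estimate for every
`n` is required. The shift to `n + 1` keeps the power at least `1`, and the finitely many
exceptional values are absorbed into the constant. -/
theorem exists_le_mul_rpow {T : ℕ → ℕ} {c : ℝ} (hc : 0 ≤ c)
    (hT : (fun n => (T n : ℝ)) =O[atTop] fun n => (n : ℝ) ^ c) :
    ∃ C : ℝ, 0 ≤ C ∧ ∀ n, (T n : ℝ) ≤ C * ((n : ℝ) + 1) ^ c := by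
  obtain ⟨C, hC, h⟩ := hT.exists_nonneg
  obtain ⟨n₀, hn₀⟩ := eventually_atTop.1 h.bound
  have hsum : 0 ≤ ∑ m ∈ Finset.range n₀, (T m : ℝ) := Finset.sum_nonneg fun _ _ => by positivity
  refine ⟨C + ∑ m ∈ Finset.range n₀, (T m : ℝ), by positivity, fun n => ?_⟩
  have h1 : (1 : ℝ) ≤ ((n : ℝ) + 1) ^ c := Real.one_le_rpow (by simp) hc
  rw [add_mul]
  rcases lt_or_ge n n₀ with hn | hn
  · have h2 : (T n : ℝ) ≤ ∑ m ∈ Finset.range n₀, (T m : ℝ) :=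
      Finset.single_le_sum (f := fun m => (T m : ℝ)) (fun _ _ => by positivity)
        (Finset.mem_range.2 hn)
    nlinarith [mul_nonneg hC (zero_le_one.trans h1)]
  · have h2 := hn₀ n hn
    rw [Real.norm_natCast, Real.norm_of_nonneg (by positivity)] at h2
    have h3 : (n : ℝ) ^ c ≤ ((n : ℝ) + 1) ^ c := Real.rpow_le_rpow (by positivity) (by simp) hc
    nlinarith [mul_nonneg hsum (zero_le_one.trans h1), mul_le_mul_of_nonneg_left h3 hC]

/-- `T` need not be monotone and the word of a graph is only bounded in length, hence the supremum.
The quadratic length turns the exponent `δ / 2` into `δ`. -/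
theorem isBigO_sup {T : ℕ → ℕ} {δ : ℝ} (hδ : 0 ≤ δ)
    (hT : (fun n => (T n : ℝ)) =O[atTop] fun n => (n : ℝ) ^ (δ / 2)) :
    (fun N : ℕ => (((Finset.range (40 * (N + 1) ^ 2 + 1)).sup T : ℕ) : ℝ)) =O[atTop]
      fun N => (N : ℝ) ^ δ := by
  obtain ⟨C, hC, h⟩ := exists_le_mul_rpow (by positivity) hT
  refine IsBigO.of_bound (C * 164 ^ (δ / 2)) ?_
  filter_upwards [eventually_ge_atTop 1] with N hN
  have hN' : (1 : ℝ) ≤ N := by exact_mod_cast hN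
  rw [Real.norm_natCast, Real.norm_of_nonneg (by positivity)]
  obtain ⟨m, hm, he⟩ := Finset.exists_mem_eq_sup (Finset.range (40 * (N + 1) ^ 2 + 1))
    (by simp) T
  rw [he]
  -- For `N ≥ 1`, `40 (N + 1)² + 1 ≤ 160 N² + 1`, with some slack below `164 N²`.
  have hm' : (m : ℝ) + 1 ≤ 164 * (N : ℝ) ^ (2 : ℝ) := by
    have h1 : m ≤ 40 * (N + 1) ^ 2 := by simpa [Nat.lt_succ_iff] using hm
    have h2 : (m : ℝ) ≤ 40 * ((N : ℝ) + 1) ^ 2 := by exact_mod_cast h1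
    rw [Real.rpow_two]
    nlinarith
  have e : (164 * (N : ℝ) ^ (2 : ℝ)) ^ (δ / 2) = 164 ^ (δ / 2) * (N : ℝ) ^ δ := by
    rw [Real.mul_rpow (by norm_num) (by positivity), ← Real.rpow_mul (by positivity)]
    congr 2; ring
  calc (T m : ℝ) ≤ C * ((m : ℝ) + 1) ^ (δ / 2) := h m
    _ ≤ C * (164 * (N : ℝ) ^ (2 : ℝ)) ^ (δ / 2) := by gcongr
    _ = _ := by rw [e]; ring

/-- This is what `2 ≤ δ` is for: reading the graph and generating its word takes quadratically many
operations. -/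
theorem isBigO_sq {δ : ℝ} (hδ : 2 ≤ δ) :
    (fun N : ℕ => ((N : ℝ) + 1) ^ 2) =O[atTop] fun N => (N : ℝ) ^ δ := by
  refine IsBigO.of_bound 4 ?_
  filter_upwards [eventually_ge_atTop 1] with N hN
  have hN' : (1 : ℝ) ≤ N := by exact_mod_cast hN
  rw [Real.norm_of_nonneg (by positivity), Real.norm_of_nonneg (by positivity)]
  have h1 : (N : ℝ) ^ (2 : ℝ) ≤ (N : ℝ) ^ δ := Real.rpow_le_rpow_of_exponent_le hN' hδ
  rw [Real.rpow_two] at h1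
  nlinarith

theorem isBigO_const_rpow {δ : ℝ} (hδ : 2 ≤ δ) (c : ℝ) :
    (fun _ : ℕ => c) =O[atTop] fun N : ℕ => (N : ℝ) ^ δ := by
  refine IsBigO.trans ?_ (isBigO_sq hδ)
  refine IsBigO.of_bound |c| (Eventually.of_forall fun N => ?_)
  have : (1 : ℝ) ≤ ((N : ℝ) + 1) ^ 2 := by
    have : (0 : ℝ) ≤ N := by positivity
    nlinarith
  rw [Real.norm_eq_abs, Real.norm_of_nonneg (by positivity)]
  nlinarith [abs_nonneg c]

theorem regBound_le (ι α : Type) [Fintype ι] [Fintype α] :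
    ∃ K : ℕ, ∀ V, 1 ≤ V → regBound ι α V ≤ K * (V * V) := by
  refine ⟨(Fintype.card α + 1) * (Fintype.card ι + 6) + Fintype.card α + 6, fun V hV => ?_⟩
  have h1 : 1 ≤ V * V := Nat.mul_pos hV hV
  have h2 : V ≤ V * V := Nat.le_mul_self V
  have h3 : Fintype.card ι + 2 * V * V + V + 3 ≤ (Fintype.card ι + 6) * (V * V) := by
    have : Fintype.card ι ≤ Fintype.card ι * (V * V) := Nat.le_mul_of_pos_right _ (by omega)
    nlinarith
  have h4 := Nat.mul_le_mul_left (Fintype.card α + 1) h3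
  have h5 : Fintype.card α ≤ Fintype.card α * (V * V) := Nat.le_mul_of_pos_right _ (by omega)
  unfold regBound
  nlinarith

/-- Register contents and numbers are polynomially bounded in the values, and these in `N`, so one
unit of cost is `O(log N)`. -/
theorem isBigO_size {δ : ℝ} (ι α : Type) [Fintype ι] [Fintype α] {V : ℕ → ℕ}
    (hV1 : ∀ N, 1 ≤ V N) (hV : (fun N => (V N : ℝ)) =O[atTop] fun N : ℕ => (N : ℝ) ^ δ) :
    (fun N => ((size (regBound ι α (V N)) : ℕ) : ℝ)) =O[atTop] fun N : ℕ => Real.log N := by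
  obtain ⟨K, hK⟩ := regBound_le ι α
  obtain ⟨c, hc, h⟩ := hV.exists_pos
  set A : ℝ := |Real.log K| + 2 * |Real.log c| with hA
  refine IsBigO.of_bound (1 + (A + 2 * |δ|) / Real.log 2) ?_
  -- From `3` on, `log N ≥ 1`, so that additive constants are absorbed.
  filter_upwards [eventually_ge_atTop 3, h.bound] with N hN hb
  have hN' : (3 : ℝ) ≤ N := by exact_mod_cast hN
  have hlog : 1 ≤ Real.log N := by
    rw [Real.le_log_iff_exp_le (by linarith)]
    linarith [Real.exp_one_lt_d9]
  have hlog2 : 0 < Real.log 2 := Real.log_pos (by norm_num)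
  rw [Real.norm_natCast, Real.norm_of_nonneg (by positivity)] at hb
  rw [Real.norm_natCast, Real.norm_of_nonneg (by linarith)]
  have hW1 : 1 ≤ regBound ι α (V N) := by unfold regBound; omega
  have hWK := hK (V N) (hV1 N)
  have hVp : (0 : ℝ) < V N := by exact_mod_cast hV1 N
  have hKp : (0 : ℝ) < K := by
    rcases Nat.eq_zero_or_pos K with h0 | h0
    · rw [h0] at hWK; omega
    · exact_mod_cast h0
  have hlogV : Real.log (V N) ≤ Real.log c + δ * Real.log N := by
    rw [← Real.log_rpow (by linarith), ← Real.log_mul hc.ne' (by positivity)]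
    exact Real.log_le_log hVp hb
  have hlogW : Real.log (regBound ι α (V N)) ≤ (A + 2 * |δ|) * Real.log N := by
    have h1 : Real.log (regBound ι α (V N)) ≤ Real.log (K * (V N * V N)) :=
      Real.log_le_log (by exact_mod_cast hW1) (by exact_mod_cast hWK)
    rw [Real.log_mul hKp.ne' (by positivity), Real.log_mul hVp.ne' hVp.ne'] at h1
    have h2 : A ≤ A * Real.log N := le_mul_of_one_le_right (by positivity) hlog
    have h3 : δ * Real.log N ≤ |δ| * Real.log N :=
      mul_le_mul_of_nonneg_right (le_abs_self δ) (by linarith)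
    rw [add_mul]
    linarith [le_abs_self (Real.log K), le_abs_self (Real.log c)]
  have hsize : ((size (regBound ι α (V N)) : ℕ) : ℝ) ≤
      1 + Real.log (regBound ι α (V N)) / Real.log 2 := by
    have h1 : ((Nat.log 2 (regBound ι α (V N)) : ℕ) : ℝ) ≤ Real.logb 2 (regBound ι α (V N)) :=
      Real.natLog_le_logb _ _
    rw [← Real.log_div_log] at h1
    simp only [size, Int.natAbs_natCast]
    push_cast
    linarith
  calc ((size (regBound ι α (V N)) : ℕ) : ℝ) ≤ 1 + Real.log (regBound ι α (V N)) / Real.log 2 :=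
        hsize
    _ ≤ Real.log N + (A + 2 * |δ|) * Real.log N / Real.log 2 := by gcongr
    _ = _ := by ring

/-- Generating the word and deciding it by simulation costs `O(N ^ δ)` units of size `O(log N)`. -/
theorem triangleDetectionInTime_of_mem_DTIME {δ : ℝ} (hδ : 2 ≤ δ)
    (h : Op.lang ∈ DTIME fun n => (n : ℝ) ^ (δ / 2)) : TriangleDetectionInTime δ := by
  obtain ⟨M, T, hT, hM, hL⟩ := h
  let T' : ℕ → ℕ := fun N => (Finset.range (40 * (N + 1) ^ 2 + 1)).sup T
  have hT' : (fun N => (T' N : ℝ)) =O[atTop] fun N : ℕ => (N : ℝ) ^ δ :=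
    isBigO_sup (by linarith) hT
  -- The exponent `log (log N) / log N` is chosen so that `N` raised to it equals `log N`, the
  -- overhead of the logarithmic cost.
  refine ⟨M.triangleProgram, fun N => M.triangleTime N (T' N),
    fun N => Real.log (Real.log N) / Real.log N, ?_, ?_, fun N G => ?_⟩
  · have := (Real.isLittleO_log_id_atTop.tendsto_div_nhds_zero.comp
      Real.tendsto_log_atTop).comp tendsto_natCast_atTop_atTop
    simpa [Function.comp_def] using this
  · have e : (fun N : ℕ => (N : ℝ) ^ (δ + Real.log (Real.log N) / Real.log N)) =ᶠ[atTop]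
        fun N : ℕ => (N : ℝ) ^ δ * Real.log N := by
      filter_upwards [eventually_ge_atTop 3] with N hN
      have hN' : (3 : ℝ) ≤ N := by exact_mod_cast hN
      have hlog : 0 < Real.log N := Real.log_pos (by linarith)
      rw [Real.rpow_add (by linarith)]
      congr 1
      rw [Real.rpow_def_of_pos (by linarith), mul_div_cancel₀ _ hlog.ne', Real.exp_log hlog]
    refine IsBigO.trans_eventuallyEq ?_ e.symm
    simp only [triangleTime, Nat.cast_mul]
    have hV : (fun N => (M.valueBound N (T' N) : ℝ)) =O[atTop] fun N : ℕ => (N : ℝ) ^ δ := by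
      simp only [valueBound, Nat.cast_add, Nat.cast_mul, Nat.cast_pow]
      exact (((isBigO_const_rpow hδ _).add ((by simpa using isBigO_sq hδ :
        (fun N : ℕ => ((N : ℝ) + (1 : ℕ)) ^ 2) =O[atTop] _).const_mul_left _)).add hT').add
          (isBigO_const_rpow hδ _)
    refine IsBigO.mul ?_ ((isBigO_size _ _ (fun N => by unfold valueBound; omega)
      hV).const_mul_left _)
    simp only [Nat.cast_add, Nat.cast_mul, Nat.cast_pow]
    refine ((((by simpa using isBigO_sq hδ :
        (fun N : ℕ => ((N : ℝ) + (1 : ℕ)) ^ 2) =O[atTop] _).const_mul_left _)).add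
      (IsBigO.add ?_ (isBigO_const_rpow hδ _))).add (isBigO_const_rpow hδ _)
    simp only [mul_comm _ ((M.stepTime : ℝ) + _)]
    exact (hT'.add (isBigO_const_rpow hδ _)).const_mul_left _
  · have hhalt : M.HaltsWithin (graphWord G) [] (T' N) := by
      refine (hM _ [] rfl).mono (Finset.le_sup (f := T) ?_)
      have := length_graphWord_le G
      exact Finset.mem_range.2 (by omega)
    have hans := M.answersWithin_triangleProgram G hhalt
    have hiff : M.Accepts (graphWord G) [] ↔ ∃ a b c, G.Adj a b ∧ G.Adj b c ∧ G.Adj a c := by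
      rw [← graphWord_mem_lang, hL]
      constructor
      · exact fun h => ⟨[], rfl, h⟩
      · rintro ⟨w, hw, h⟩
        obtain rfl : w = [] := List.length_eq_zero_iff.1 hw
        exact h
    rwa [decide_eq_decide.2 hiff] at hans

end Asymptotics

theorem mainTheorem4 (K : Type*) [Field K]
    (hard : ∀ δ : ℝ, δ < matMulExponent K → ¬ TriangleDetectionInTime δ)
    (δ' : ℝ) (hpos : 0 < δ') (hlt : δ' < matMulExponent K) :
    ¬ NDTIME (fun n => ⌈(1 / 2 : ℝ) * Real.logb 2 n⌉₊) (fun n => (n : ℝ)) ⊆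
      DTIME (fun n => (n : ℝ) ^ (δ' / 2)) := by
  intro h
  have hmem := h Op.lang_mem_NDTIME
  -- Below `2` the time bound is sublinear and the separation unconditional; from `2` on, the
  -- generation of the word fits into the time bound and the reduction applies.
  rcases lt_or_ge δ' 2 with h2 | h2
  · exact Op.lang_not_mem_DTIME (by linarith) hmem
  · exact hard δ' hlt (triangleDetectionInTime_of_mem_DTIME h2 hmem)
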